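/- Notation. Let $\beta\in(0,\infty)$, $\Psi_\beta(x)=e^{x^\beta}-1$, $x_\beta=(\frac{1-\beta}{\beta})^{1/\beta}$ if $\beta<1$ and $x_\beta=0$ if $\beta\ge1$; let $E_\beta=\Psi_\beta$ on $[x_\beta,\infty)$, $E_\beta(x)=\Psi_\beta(x_\beta)+\Psi_\beta'(x_\beta)(x-x_\beta)$ on $[0,x_\beta)$, and $\Phi_\beta=E_\beta-E_\beta(0)$. For an interval $D$ let $\|g\|_{L^{\Phi_\beta}(D)}=\inf\{\lambda>0:\int_D\Phi_\beta(|g_r|/\lambda)\,dr\le1\}$. For $T>0$, $q\in(0,\infty]$ and a measurable $\Xi:\{0\le s\le t\le T\}\to V$ into a finite-dimensional normed space put $\omega_{\Phi_\beta}(\Xi,\tau)=\sup_{0\le h\le\tau}\|\Xi_{\cdot,\cdot+h}\|_{L^{\Phi_\beta}([0,T-h])}$ and $$\|\Xi\|_{B^{\alpha;2}_{\Phi_\beta,q}}=\big\|\tau^{-\alpha}\omega_{\Phi_\beta}(\Xi,\tau)\big\|_{L^q([0,T],d\tau/\tau)};$$ $B^{\alpha;2}_{\Phi_\beta,q}$ consists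 of the $\Xi$ for which this is finite. For a path $g:[0,T]\to V$ let $\delta g_{s,t}=g_t-g_s$ and $[g]_{B^\alpha_{\Phi_\beta,q}}=\|\delta g\|_{B^{\alpha;2}_{\Phi_\beta,q}}$; $B^\alpha_{\Phi_\beta,q}([0,T];V)$ is the space of $g\in L^{\Phi_\beta}([0,T];V)$ with $[g]_{B^\alpha_{\Phi_\beta,q}}<\infty$, each identified with its continuous representative. $\mathbb R^n$ carries the Euclidean norm, $\mathbb R^{m\times k}$ the Hilbert–Schmidt norm, $\mathcal L(\cdot;\cdot)$ the operator norm, and $\|f\|_{C^j_b}=\sum_{i=0}^j\sup_x|D^if(x)|$. For $X\in B^\alpha_{\Phi_\beta,q}([0,T];\mathbb R^n)$, a pair $(Y,Y')$ is controlled by $X$, written $(Y,Y')\in\mathscr D^X([0,T];\mathbb R^{m\times k})$, if $Y\in B^\alpha_{\Phi_\beta,q}([0,T];\mathbb R^{m\times k})$, $Y'\in B^\alpha_{\Phi_\beta,q}([0,T];\mathcal L(\mathbb R^n;\mathbb R^{m\times k}))$ and the remainder $R^Y_{s,t}=\delta Y_{s,t}-Y'_s\,\delta X_{s,t}$ lies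 in $B^{2\alpha;2}_{\Phi_{\beta/2},q/2}$; then $[(Y,Y')]_{\mathscr D^X}=[Y']_{B^\alpha_{\Phi_\beta,q}}+\|R^Y\|_{B^{2\alpha;2}_{\Phi_{\beta/2},q/2}}$. For $(\tilde Y,\tilde Y')\in\mathscr D^{\tilde X}$ put $$d_{X,\tilde X}=\|Y'-\tilde Y'\|_{L^{\Phi_\beta}([0,T])}+[Y'-\tilde Y']^{\,q\wedge1}_{B^\alpha_{\Phi_\beta,q}}+\|R^Y-R^{\tilde Y}\|^{\frac q2\wedge1}_{B^{2\alpha;2}_{\Phi_{\beta/2},q/2}}.$$ Theorem. Let $\alpha\in(\frac13,\frac12]$, $\beta\in(0,\infty)$, $q\in(0,\infty]$. (i) There is a finite constant $C(T)$, depending only on $\alpha,\beta,q,T$ and nondecreasing in $T$, such that for all $n,m,k$, all $T>0$, all $X\in B^\alpha_{\Phi_\beta,q}([0,T];\mathbb R^n)$, $(Y,Y')\in\mathscr D^X([0,T];\mathbb R^{m\times k})$ and $f\in C^2_b(\mathbb R^{m\times k};\mathbb R^{m\times n})$, with $f(Y)'_t=Df(Y_t)Y'_t$ and $A=|Y'_0|+[(Y,Y')]_{\mathscr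 D^X}$: $(f(Y),f(Y)')\in\mathscr D^X([0,T];\mathbb R^{m\times n})$, $$[f(Y)]_{B^\alpha_{\Phi_\beta,q}}\le\|Df\|_\infty\,[Y]_{B^\alpha_{\Phi_\beta,q}},$$ $$[f(Y)']_{B^\alpha_{\Phi_\beta,q}}\le C(T)\,\|f\|_{C^2_b}\,\big(1+[X]_{B^\alpha_{\Phi_\beta,q}}\big)\,(A\vee A^2),$$ $$[(f(Y),f(Y)')]_{\mathscr D^X}\le C(T)\,\|f\|_{C^2_b}\,\big(1+[X]_{B^\alpha_{\Phi_\beta,q}}\big)^2\,(A\vee A^2).$$ (ii) There is a finite constant $C(T,M)$, depending only on $\alpha,\beta,q,T,M$ and nondecreasing in $T$ and in $M$, such that for all $n,m,k$, all $T,M>0$, all $X,\tilde X\in B^\alpha_{\Phi_\beta,q}([0,T];\mathbb R^n)$, $(Y,Y')\in\mathscr D^X([0,T];\mathbb R^{m\times k})$ and $(\tilde Y,\tilde Y')\in\mathscr D^{\tilde X}([0,T];\mathbb R^{m\times k})$ with $$\big(|Y'_0|+[(Y,Y')]_{\mathscr D^X}\big)\vee\big(|\tilde Y'_0|+[(\tilde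 Y,\tilde Y')]_{\mathscr D^{\tilde X}}\big)\vee[X]_{B^\alpha_{\Phi_\beta,q}}\vee[\tilde X]_{B^\alpha_{\Phi_\beta,q}}\le M$$ and all $f\in C^3_b(\mathbb R^{m\times k};\mathbb R^{m\times n})$, both $$[f(Y)'-f(\tilde Y)']_{B^\alpha_{\Phi_\beta,q}}\quad\text{and}\quad\|R^{f(Y)}-R^{f(\tilde Y)}\|_{B^{2\alpha;2}_{\Phi_{\beta/2},q/2}}$$ are at most $$C(T,M)\,\|f\|_{C^3_b}\Big(|Y_0-\tilde Y_0|+|Y'_0-\tilde Y'_0|+[X-\tilde X]_{B^\alpha_{\Phi_\beta,q}}+d_{X,\tilde X}\Big).$$ -/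

import Mathlib

open MeasureTheory Set
open scoped ENNReal NNReal

noncomputable section

namespace BesovOrlicz

/-! ### Exponential Young functions and the Luxemburg norm -/

/-- `Ψ_β(x) = exp(x^β) - 1`. -/
def Psi (β x : ℝ) : ℝ := Real.exp (x ^ β) - 1

/-- The inflection point of `Ψ_β` (for `β < 1`), and `0` for `β ≥ 1`. -/
def xBeta (β : ℝ) : ℝ := if β < 1 then ((1 - β) / β) ^ (1 / β) else 0

/-- `Ψ_β` with its concave part on `[0, x_β)` replaced by the tangent line at `x_β`;
`β x^(β-1) exp(x^β)` is the derivative of `Ψ_β` at `x > 0`. -/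
def EBeta (β x : ℝ) : ℝ :=
  if xBeta β ≤ x then Psi β x
  else Psi β (xBeta β)
    + β * xBeta β ^ (β - 1) * Real.exp (xBeta β ^ β) * (x - xBeta β)

/-- The exponential Young function `Φ_β(x) = E_β(x) - E_β(0)`, used for `x ≥ 0`. -/
def Phi (β x : ℝ) : ℝ := EBeta β x - EBeta β 0

variable {V W : Type*} [NormedAddCommGroup V] [NormedSpace ℝ V]
  [NormedAddCommGroup W] [NormedSpace ℝ W]

/-- The Luxemburg norm of `g` on `D ⊆ ℝ`, with value `∞` if no `l` is admissible. -/
def luxNorm (β : ℝ) (D : Set ℝ) (g : ℝ → V) : ℝ≥0∞ :=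
  ⨅ (l : ℝ) (_ : 0 < l) (_ : ∫⁻ r in D, ENNReal.ofReal (Phi β (‖g r‖ / l)) ≤ 1),
    ENNReal.ofReal l

/-- Membership in the exponential Orlicz space on `D`. -/
def MemOrlicz (β : ℝ) (D : Set ℝ) (g : ℝ → V) : Prop :=
  AEStronglyMeasurable g (volume.restrict D) ∧
    ∃ l : ℝ, 0 < l ∧ ∫⁻ r in D, ENNReal.ofReal (Phi β (‖g r‖ / l)) < ∞

/-! ### Besov-Orlicz(-type) spaces -/

/-- The Orlicz modulus `sup_{h ∈ [0,τ]} ‖Ξ_{·,·+h}‖_{L^{Φ_β}([0,T-h])}`. -/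
def modulus (β T : ℝ) (Ξ : ℝ → ℝ → V) (τ : ℝ) : ℝ≥0∞ :=
  ⨆ h ∈ Icc (0 : ℝ) τ, luxNorm β (Icc 0 (T - h)) (fun r => Ξ r (r + h))

/-- The measure `dτ/τ` on `(0, T]`. -/
def scaleMeasure (T : ℝ) : Measure ℝ :=
  (volume.restrict (Ioc 0 T)).withDensity (fun τ => ENNReal.ofReal (1 / τ))

/-- The (quasi)norm of the two-parameter Besov-Orlicz-type space of smoothness `α`,
`‖ω(Ξ,τ) / τ^α‖_{L^q([0,T], dτ/τ)}`. -/
def boNorm₂ (α β : ℝ) (q : ℝ≥0∞) (T : ℝ) (Ξ : ℝ → ℝ → V) : ℝ≥0∞ :=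
  eLpNorm (fun τ => modulus β T Ξ τ / ENNReal.ofReal (τ ^ α)) q (scaleMeasure T)

/-- Membership in the two-parameter Besov-Orlicz-type space: `Ξ` is measurable on the simplex
`{0 ≤ s ≤ t ≤ T}`, so are the slices entering the modulus, and the (quasi)norm is finite. -/
def MemBO₂ (α β : ℝ) (q : ℝ≥0∞) (T : ℝ) (Ξ : ℝ → ℝ → V) : Prop :=
  AEStronglyMeasurable (fun p : ℝ × ℝ => Ξ p.1 p.2)
      (volume.restrict {p : ℝ × ℝ | 0 ≤ p.1 ∧ p.1 ≤ p.2 ∧ p.2 ≤ T}) ∧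
    (∀ h ∈ Icc (0 : ℝ) T,
      AEStronglyMeasurable (fun r => Ξ r (r + h)) (volume.restrict (Icc 0 (T - h)))) ∧
    boNorm₂ α β q T Ξ < ∞

/-- The Besov-Orlicz (quasi)seminorm of a path, i.e. the two-parameter (quasi)norm of its
increments. -/
def boSeminorm (α β : ℝ) (q : ℝ≥0∞) (T : ℝ) (f : ℝ → V) : ℝ≥0∞ :=
  boNorm₂ α β q T (fun s t => f t - f s)

/-- Membership in the Besov-Orlicz space `B^α_{Φ_β,q}([0,T];V)`. Its elements (`α > 0`) have a
unique continuous representative, and a path here is that representative. Only the values on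
`[0,T]` matter. -/
def MemBO (α β : ℝ) (q : ℝ≥0∞) (T : ℝ) (f : ℝ → V) : Prop :=
  ContinuousOn f (Icc 0 T) ∧ MemOrlicz β (Icc 0 T) f ∧ boSeminorm α β q T f < ∞

/-- The metric `‖f - g‖_{L^{Φ_β}} + [f - g]^{q ∧ 1}` of `B^α_{Φ_β,q}([0,T];V)`. -/
def boDist (α β : ℝ) (q : ℝ≥0∞) (T : ℝ) (f g : ℝ → V) : ℝ≥0∞ :=
  luxNorm β (Icc 0 T) (fun t => f t - g t)
    + boSeminorm α β q T (fun t => f t - g t) ^ (min q 1).toReal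

/-- The metric `‖Ξ - Ξ'‖^{q ∧ 1}` of the two-parameter space. -/
def boDist₂ (α β : ℝ) (q : ℝ≥0∞) (T : ℝ) (Ξ Ξ' : ℝ → ℝ → V) : ℝ≥0∞ :=
  boNorm₂ α β q T (fun s t => Ξ s t - Ξ' s t) ^ (min q 1).toReal

/-! ### Controlled paths -/

/-- The remainder `R^Y_{s,t} = δY_{s,t} - Y'_s δX_{s,t}`. -/
def remainder (X : ℝ → V) (Y : ℝ → W) (Y' : ℝ → V →L[ℝ] W) (s t : ℝ) : W :=
  Y t - Y s - Y' s (X t - X s)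

/-- `(Y, Y')` is a path controlled by `X`, the parameters `α, β, q` being those of `X`. -/
structure IsControlled (α β : ℝ) (q : ℝ≥0∞) (T : ℝ) (X : ℝ → V) (Y : ℝ → W)
    (Y' : ℝ → V →L[ℝ] W) : Prop where
  path : MemBO α β q T Y
  deriv : MemBO α β q T Y'
  rem : MemBO₂ (2 * α) (β / 2) (q / 2) T (remainder X Y Y')

/-- `[(Y,Y')] = [Y'] + ‖R^Y‖`. -/
def controlledSeminorm (α β : ℝ) (q : ℝ≥0∞) (T : ℝ) (X : ℝ → V) (Y : ℝ → W)
    (Y' : ℝ → V →L[ℝ] W) : ℝ≥0∞ :=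
  boSeminorm α β q T Y' + boNorm₂ (2 * α) (β / 2) (q / 2) T (remainder X Y Y')

/-- The distance of `(Y₁,Y₁')`, controlled by `X₁`, and `(Y₂,Y₂')`, controlled by `X₂`. -/
def controlledDist (α β : ℝ) (q : ℝ≥0∞) (T : ℝ) (X₁ : ℝ → V) (Y₁ : ℝ → W)
    (Y₁' : ℝ → V →L[ℝ] W) (X₂ : ℝ → V) (Y₂ : ℝ → W) (Y₂' : ℝ → V →L[ℝ] W) : ℝ≥0∞ :=
  boDist α β q T Y₁' Y₂'
    + boDist₂ (2 * α) (β / 2) (q / 2) T (remainder X₁ Y₁ Y₁') (remainder X₂ Y₂ Y₂')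

/-! ### Bounded smooth functions and composition -/

/-- The norm of `C_b^j`: the sum of the sup norms of the derivatives of order `0, …, j`. -/
def cbNorm (j : ℕ) (f : V → W) : ℝ≥0∞ :=
  ∑ i ∈ Finset.range (j + 1), ⨆ x, ‖iteratedFDeriv ℝ i f x‖ₑ

/-- `f ∈ C_b^j`. -/
def MemCb (j : ℕ) (f : V → W) : Prop := ContDiff ℝ j f ∧ cbNorm j f < ∞

/-- `f(Y)'_t = Df(Y_t) Y'_t`. -/
def compDeriv {U : Type*} [NormedAddCommGroup U] [NormedSpace ℝ U] (f : W → U) (Y : ℝ → W)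
    (Y' : ℝ → V →L[ℝ] W) (t : ℝ) : V →L[ℝ] U :=
  (fderiv ℝ f (Y t)).comp (Y' t)

/-- `ℝⁿ` with the Euclidean norm. -/
abbrev Vec (n : ℕ) : Type := EuclideanSpace ℝ (Fin n)

/-- The real `m × k` matrices with the Hilbert-Schmidt norm, i.e. the Euclidean norm of the
family of entries. -/
abbrev Mat (m k : ℕ) : Type := EuclideanSpace ℝ (Fin m × Fin k)

end BesovOrlicz

end

noncomputable section

namespace BesovOrlicz

/-! ### Elementary properties of the exponential Young functions -/

/-! Part (i) rests on the identity `remainder_comp`: the remainder of `f(Y)` is the Taylor error of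
`f` at `Y_s` in the direction `δY`, plus `Df(Y_s) R^Y`. The Taylor error is quadratic in `δY`.
Squaring turns the class `Φ_β` into `Φ_{β/2}`, because `Ψ_{β/2}(x²) = Ψ_β(x)`, and Hölder's
inequality in `dτ/τ` turns `L^q` into `L^{q/2}` while doubling the smoothness. Hence
`exists_BOBound_mul` places this term exactly in the space required of remainders. The derivative
`Df(Y)Y'` is treated by the product rule, which needs the supremum of `Y'`.

Two facts must be extracted from the definition of a controlled path: the supremum of `Y'`, and a
bound of `[Y]` by `A(1 + [X])`, with `A` formed from `Y'` and `R^Y` alone. The first follows from a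
Hölder embedding. The exponential class controls eighth moments, so averages of increments over
intervals of length `h` lose only `h^{-1/8}`; the dyadic argument of `AlmostAdditive` turns averages
into pointwise bounds, giving Hölder exponent `α - 1/8`. For the second, `δY = Y' δX + R^Y`, but
`R^Y` has only the weaker integrability `Φ_{β/2}`. It is almost additive: its defect `δY' δX` is
pointwise of order `|t-s|^{2α-1/4}`. The same dyadic argument therefore bounds `R^Y` pointwise by
this power, and since `2α - 1/4 > α`, any such function lies in the space of smoothness `α` for
every `β` and `q` (`exists_BOBound_of_remainder`).

Part (ii) repeats this for differences. The pointwise input is second-difference estimates for `Df`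
and for Taylor errors, in which every term contains one factor measuring the distance between the
two pairs. All estimates are linear in these distances. The powers `q ∧ 1` and `q/2 ∧ 1` in the
metric enter only at the end: on bounded data, a distance is at most a constant times any of its
powers with exponent in `[0,1]`.

All spaces are merely quasinormed when `q < 1`, so sums cost constants. The work is done with real
upper bounds (`BOBound`, `PathBound`) rather than with the extended norms. -/

theorem xBeta_nonneg (β : ℝ) (hβ : 0 < β) : 0 ≤ xBeta β := by
  unfold xBeta
  split_ifs with h
  · exact Real.rpow_nonneg (div_nonneg (by linarith) hβ.le) _
  · exact le_rfl

theorem xBeta_pos {β : ℝ} (hβ : 0 < β) (h1 : β < 1) : 0 < xBeta β := by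
  unfold xBeta
  rw [if_pos h1]
  exact Real.rpow_pos_of_pos (div_pos (by linarith) hβ) _

theorem Psi_mono {β x y : ℝ} (hβ : 0 < β) (hx : 0 ≤ x) (hxy : x ≤ y) : Psi β x ≤ Psi β y := by
  unfold Psi
  have := Real.rpow_le_rpow hx hxy hβ.le
  have := Real.exp_le_exp.2 this
  linarith

theorem rpow_le_Psi (β x : ℝ) : x ^ β ≤ Psi β x := by
  unfold Psi
  have := Real.add_one_le_exp (x ^ β)
  linarith

theorem Psi_nonneg {β x : ℝ} (hx : 0 ≤ x) : 0 ≤ Psi β x :=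
  (Real.rpow_nonneg hx β).trans (rpow_le_Psi β x)

theorem Psi_pos {β x : ℝ} (hx : 0 < x) : 0 < Psi β x :=
  (Real.rpow_pos_of_pos hx β).trans_le (rpow_le_Psi β x)

theorem Psi_zero {β : ℝ} (hβ : 0 < β) : Psi β 0 = 0 := by
  simp [Psi, Real.zero_rpow hβ.ne']

/-- Convexity of `exp` on the segment from `0` to `x ^ β`. It makes a small dilation gain a small
factor even where `Ψ_β` itself is not convex. -/
theorem Psi_mul_le {β t x : ℝ} (hβ : 0 < β) (ht : 0 ≤ t) (ht1 : t ≤ 1) (hx : 0 ≤ x) :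
    Psi β (t * x) ≤ t ^ β * Psi β x := by
  unfold Psi
  rw [Real.mul_rpow ht hx]
  have h0 : 0 ≤ t ^ β := Real.rpow_nonneg ht _
  have h1 : t ^ β ≤ 1 := Real.rpow_le_one ht ht1 hβ.le
  have := convexOn_exp.2 (mem_univ (x ^ β)) (mem_univ 0) h0 (sub_nonneg.2 h1) (by ring)
  simp only [smul_eq_mul, mul_zero, add_zero, Real.exp_zero, mul_one] at this
  linarith

/-- This identity is the origin of the parameter `β / 2` for remainders. -/
theorem Psi_half_sq {β x : ℝ} (hx : 0 ≤ x) : Psi (β / 2) (x ^ 2) = Psi β x := by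
  unfold Psi
  rw [← Real.rpow_natCast, ← Real.rpow_mul hx]
  congr 3
  push_cast
  ring

/-- The slope of the linear part of `Φ_β`. -/
def tangentSlope (β : ℝ) : ℝ := β * xBeta β ^ (β - 1) * Real.exp (xBeta β ^ β)

theorem tangentSlope_pos {β : ℝ} (hβ : 0 < β) (h1 : β < 1) : 0 < tangentSlope β := by
  have := Real.rpow_pos_of_pos (xBeta_pos hβ h1) (β - 1)
  unfold tangentSlope
  positivity

theorem Phi_eq_Psi {β x : ℝ} (h1 : 1 ≤ β) (hx : 0 ≤ x) : Phi β x = Psi β x := by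
  have hb : xBeta β = 0 := by simp [xBeta, not_lt.2 h1]
  have : Psi β 0 = 0 := Psi_zero (by linarith)
  simp [Phi, EBeta, hb, hx, this]

theorem Phi_of_ge {β x : ℝ} (hβ : 0 < β) (h1 : β < 1) (hx : xBeta β ≤ x) :
    Phi β x = Psi β x - Psi β (xBeta β) + tangentSlope β * xBeta β := by
  have hb := xBeta_pos hβ h1
  simp only [Phi, EBeta, hx, if_true, not_le.2 hb, if_false, tangentSlope]
  ring

theorem Phi_of_le {β x : ℝ} (hβ : 0 < β) (h1 : β < 1) (hx : x ≤ xBeta β) :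
    Phi β x = tangentSlope β * x := by
  have hb := xBeta_pos hβ h1
  rcases hx.eq_or_lt with h | h
  · rw [Phi_of_ge hβ h1 h.ge, h]
    ring
  · simp only [Phi, EBeta, not_le.2 h, not_le.2 hb, if_false, tangentSlope]
    ring

theorem Phi_zero (β : ℝ) : Phi β 0 = 0 := by simp [Phi]

theorem Phi_mono {β x y : ℝ} (hβ : 0 < β) (hx : 0 ≤ x) (hxy : x ≤ y) : Phi β x ≤ Phi β y := by
  rcases lt_or_ge β 1 with h1 | h1
  · have hs := tangentSlope_pos hβ h1
    rcases le_total y (xBeta β) with hy | hy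
    · rw [Phi_of_le hβ h1 hy, Phi_of_le hβ h1 (hxy.trans hy)]
      gcongr
    · rcases le_total x (xBeta β) with hx' | hx'
      · rw [Phi_of_ge hβ h1 hy, Phi_of_le hβ h1 hx']
        have := Psi_mono hβ (xBeta_nonneg β hβ) hy
        have := mul_le_mul_of_nonneg_left hx' hs.le
        linarith
      · rw [Phi_of_ge hβ h1 hy, Phi_of_ge hβ h1 hx']
        have := Psi_mono hβ hx hxy
        linarith
  · rw [Phi_eq_Psi h1 hx, Phi_eq_Psi h1 (hx.trans hxy)]
    exact Psi_mono hβ hx hxy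

theorem Phi_nonneg {β x : ℝ} (hβ : 0 < β) (hx : 0 ≤ x) : 0 ≤ Phi β x := by
  simpa [Phi_zero] using Phi_mono hβ le_rfl hx

theorem measurable_Phi (β : ℝ) : Measurable (Phi β) := by
  have hP : Measurable (Psi β) := by unfold Psi; fun_prop
  have hE : Measurable (EBeta β) := by
    unfold EBeta
    refine Measurable.ite measurableSet_Ici hP ?_
    fun_prop
  exact hE.sub_const _

/-- On the linear part, `x ≤ x_β^(1-β) x^β` and `x^β ≤ Ψ_β(x)`. Beyond it, the additive constant is
absorbed because `Ψ_β ≥ Ψ_β(x_β) > 0`. -/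
theorem exists_Phi_le_Psi {β : ℝ} (hβ : 0 < β) :
    ∃ C : ℝ, 0 < C ∧ ∀ x, 0 ≤ x → Phi β x ≤ C * Psi β x := by
  rcases lt_or_ge β 1 with h1 | h1
  · have hb := xBeta_pos hβ h1
    have hs := tangentSlope_pos hβ h1
    have hP : 0 < Psi β (xBeta β) := Psi_pos hb
    set C₁ := tangentSlope β * xBeta β ^ (1 - β)
    set C₂ := 1 + tangentSlope β * xBeta β / Psi β (xBeta β)
    have hC₂ : 0 < C₂ := by positivity
    refine ⟨max C₁ C₂, lt_max_of_lt_right hC₂, fun x hx => ?_⟩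
    rcases le_total x (xBeta β) with h | h
    · rw [Phi_of_le hβ h1 h]
      have e : x = x ^ (1 - β) * x ^ β := by
        rcases hx.eq_or_lt with h0 | h0
        · simp [← h0, Real.zero_rpow hβ.ne']
        · rw [← Real.rpow_add h0]; simp
      calc tangentSlope β * x = tangentSlope β * x ^ (1 - β) * x ^ β := by
            rw [mul_assoc, ← e]
        _ ≤ C₁ * Psi β x := by
            have := Real.rpow_le_rpow hx h (by linarith : 0 ≤ 1 - β)
            have h2 := rpow_le_Psi β x
            have h3 : 0 ≤ xBeta β ^ (1 - β) := Real.rpow_nonneg hb.le _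
            have h4 : 0 ≤ x ^ β := Real.rpow_nonneg hx _
            exact mul_le_mul (mul_le_mul_of_nonneg_left this hs.le) h2 h4 (by positivity)
        _ ≤ _ := by
            gcongr
            · exact Psi_nonneg hx
            · exact le_max_left _ _
    · rw [Phi_of_ge hβ h1 h]
      have h2 := Psi_mono hβ hb.le h
      calc Psi β x - Psi β (xBeta β) + tangentSlope β * xBeta β
          ≤ Psi β x + tangentSlope β * xBeta β / Psi β (xBeta β) * Psi β (xBeta β) := by
            rw [div_mul_cancel₀ _ hP.ne']; linarith
        _ ≤ Psi β x + tangentSlope β * xBeta β / Psi β (xBeta β) * Psi β x := by gcongr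
        _ = C₂ * Psi β x := by ring
        _ ≤ _ := by
            gcongr
            · exact Psi_nonneg hx
            · exact le_max_right _ _
  · exact ⟨1, one_pos, fun x hx => by rw [Phi_eq_Psi h1 hx, one_mul]⟩

/-- The restriction to `x ≥ x_β` is essential when `β < 1`: near `0`, `Ψ_β` behaves like `x^β`,
which no multiple of a linear function dominates. -/
theorem exists_Psi_le_Phi {β : ℝ} (hβ : 0 < β) :
    ∃ C : ℝ, 0 < C ∧ ∀ x, xBeta β ≤ x → Psi β x ≤ C * Phi β x := by
  rcases lt_or_ge β 1 with h1 | h1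
  · have hb := xBeta_pos hβ h1
    have hs := tangentSlope_pos hβ h1
    have hP : 0 < Psi β (xBeta β) := Psi_pos hb
    refine ⟨1 + Psi β (xBeta β) / (tangentSlope β * xBeta β), by positivity, fun x hx => ?_⟩
    have h2 : tangentSlope β * xBeta β ≤ Phi β x := by
      rw [← Phi_of_le hβ h1 le_rfl]; exact Phi_mono hβ hb.le hx
    calc Psi β x ≤ Phi β x
            + Psi β (xBeta β) / (tangentSlope β * xBeta β) * (tangentSlope β * xBeta β) := by
          rw [div_mul_cancel₀ _ (by positivity), Phi_of_ge hβ h1 hx]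
          have : 0 < tangentSlope β * xBeta β := by positivity
          linarith
      _ ≤ Phi β x + Psi β (xBeta β) / (tangentSlope β * xBeta β) * Phi β x := by gcongr
      _ = _ := by ring
  · have hb : xBeta β = 0 := by simp [xBeta, not_lt.2 h1]
    exact ⟨1, one_pos, fun x hx => by rw [Phi_eq_Psi h1 (hb ▸ hx), one_mul]⟩

theorem exists_small_rpow {β ε : ℝ} (hβ : 0 < β) (hε : 0 < ε) :
    ∃ t : ℝ, 0 < t ∧ t ≤ 1 ∧ t ≤ ε ∧ t ^ β ≤ ε := by
  have hp : 0 < ε ^ (1 / β) := Real.rpow_pos_of_pos hε _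
  refine ⟨min (min 1 ε) (ε ^ (1 / β)), by positivity, ?_, ?_, ?_⟩
  · exact (min_le_left _ _).trans (min_le_left _ _)
  · exact (min_le_left _ _).trans (min_le_right _ _)
  · calc (min (min 1 ε) (ε ^ (1 / β))) ^ β ≤ (ε ^ (1 / β)) ^ β :=
          Real.rpow_le_rpow (by positivity) (min_le_right _ _) hβ.le
      _ = ε := by rw [← Real.rpow_mul hε.le, one_div_mul_cancel hβ.ne', Real.rpow_one]

/-- This takes the place of convexity of `Φ_β` in the quasi-triangle inequality. Above `x_β` one
passes to `Ψ_β` and back; below, `Φ_β` is linear. -/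
theorem exists_Phi_mul_le_half {β : ℝ} (hβ : 0 < β) :
    ∃ t : ℝ, 0 < t ∧ t ≤ 1 ∧ ∀ x, 0 ≤ x → Phi β (t * x) ≤ 1 / 2 * Phi β x := by
  obtain ⟨C, hC, hPhi⟩ := exists_Phi_le_Psi hβ
  obtain ⟨C', hC', hPsi⟩ := exists_Psi_le_Phi hβ
  obtain ⟨t, ht, ht1, htε, htβ⟩ := exists_small_rpow hβ
    (show 0 < min (1 / 2) (1 / (2 * C * C')) by positivity)
  refine ⟨t, ht, ht1, fun x hx => ?_⟩
  rcases le_or_gt (xBeta β) x with h | h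
  · calc Phi β (t * x) ≤ C * Psi β (t * x) := hPhi _ (by positivity)
      _ ≤ C * (t ^ β * Psi β x) := by gcongr; exact Psi_mul_le hβ ht.le ht1 hx
      _ ≤ C * (1 / (2 * C * C') * (C' * Phi β x)) := by
          gcongr
          · exact Psi_nonneg hx
          · exact htβ.trans (min_le_right _ _)
          · exact hPsi x h
      _ = 1 / 2 * Phi β x := by field_simp
  · have h1 : β < 1 := by
      by_contra h1
      have hb : xBeta β = 0 := by simp [xBeta, h1]
      linarith
    have hs := tangentSlope_pos hβ h1
    have htx : t * x ≤ 1 / 2 * x := by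
      gcongr
      exact htε.trans (min_le_left _ _)
    rw [Phi_of_le hβ h1 h.le, Phi_of_le hβ h1 (by linarith)]
    nlinarith

/-- The Young-function form of the product estimate. For large `x` it is `Psi_half_sq` up to
comparison constants; for small `x`, a quadratic function is compared with a linear one. -/
theorem exists_Phi_half_sq_le {β : ℝ} (hβ : 0 < β) :
    ∃ t : ℝ, 0 < t ∧ t ≤ 1 ∧ ∀ x, 0 ≤ x → Phi (β / 2) (t * x ^ 2) ≤ 1 / 2 * Phi β x := by
  have hβ2 : 0 < β / 2 := by positivity
  obtain ⟨C, hC, hPhi⟩ := exists_Phi_le_Psi hβ2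
  obtain ⟨C', hC', hPsi⟩ := exists_Psi_le_Phi hβ
  obtain ⟨ε, hε, hε'⟩ : ∃ ε : ℝ, 0 < ε ∧ ∀ t, 0 ≤ t → t ≤ 1 → t ≤ ε → ∀ x, 0 ≤ x → x < xBeta β →
      Phi (β / 2) (t * x ^ 2) ≤ 1 / 2 * Phi β x := by
    rcases lt_or_ge β 1 with h1 | h1
    · have hb := xBeta_pos hβ h1
      have h12 : β / 2 < 1 := by linarith
      have hb2 := xBeta_pos hβ2 h12
      have hs := tangentSlope_pos hβ h1
      have hs2 := tangentSlope_pos hβ2 h12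
      -- The first bound keeps `t * x ^ 2` in the linear range of `Φ_{β/2}`; the second compares the
      -- two slopes after `x ^ 2 ≤ xBeta β * x`.
      refine ⟨min (xBeta (β / 2) / xBeta β ^ 2)
        (tangentSlope β / (2 * tangentSlope (β / 2) * xBeta β)), by positivity,
        fun t ht ht1 hte x hx hxb => ?_⟩
      have h3 : t * x ^ 2 ≤ xBeta (β / 2) := by
        calc t * x ^ 2 ≤ (xBeta (β / 2) / xBeta β ^ 2) * xBeta β ^ 2 := by
              gcongr
              exact hte.trans (min_le_left _ _)
          _ = _ := by field_simp
      rw [Phi_of_le hβ h1 hxb.le, Phi_of_le hβ2 h12 h3]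
      calc tangentSlope (β / 2) * (t * x ^ 2)
          ≤ tangentSlope (β / 2) * ((tangentSlope β / (2 * tangentSlope (β / 2) * xBeta β))
            * (xBeta β * x)) := by
            rw [sq]
            gcongr
            exact hte.trans (min_le_right _ _)
        _ = _ := by field_simp
    · have hb : xBeta β = 0 := by simp [xBeta, not_lt.2 h1]
      exact ⟨1, one_pos, fun t _ _ _ x hx hxb => absurd hxb (by rw [hb]; exact not_lt.2 hx)⟩
  obtain ⟨t, ht, ht1, htε, htβ⟩ := exists_small_rpow hβ2
    (show 0 < min ε (1 / (2 * C * C')) by positivity)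
  refine ⟨t, ht, ht1, fun x hx => ?_⟩
  rcases le_or_gt (xBeta β) x with h | h
  · calc Phi (β / 2) (t * x ^ 2) ≤ C * Psi (β / 2) (t * x ^ 2) := hPhi _ (by positivity)
      _ ≤ C * (t ^ (β / 2) * Psi (β / 2) (x ^ 2)) := by
          gcongr; exact Psi_mul_le hβ2 ht.le ht1 (by positivity)
      _ ≤ C * (1 / (2 * C * C') * (C' * Phi β x)) := by
          rw [Psi_half_sq hx]
          gcongr
          · exact Psi_nonneg hx
          · exact htβ.trans (min_le_right _ _)
          · exact hPsi x h
      _ = 1 / 2 * Phi β x := by field_simp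
  · exact hε' t ht.le ht1 (htε.trans (min_le_left _ _)) x hx h

/-- With `y = x ^ β` and `N ≥ p / β`, one has `x ^ p ≤ 1 + y ^ N` and `y ^ N ≤ N! exp y`. On `[0,
x_β]`, where `Ψ_β` is not controlled by `Φ_β`, the summand `1` suffices. -/
theorem exists_pow_le_Phi {β : ℝ} (hβ : 0 < β) (p : ℕ) :
    ∃ C : ℝ, 0 < C ∧ ∀ x, 0 ≤ x → x ^ p ≤ C * (1 + Phi β x) := by
  obtain ⟨C', hC', hPsi⟩ := exists_Psi_le_Phi hβ
  obtain ⟨N, hN⟩ := exists_nat_ge (p / β)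
  have hb := xBeta_nonneg β hβ
  have hPhi : ∀ x, 0 ≤ x → 0 ≤ Phi β x := fun x hx => Phi_nonneg hβ hx
  have key : ∀ x, 0 ≤ x → x ^ p ≤ 1 + N.factorial * (1 + Psi β x) := fun x hx => by
    have h1 : x ^ p = (x ^ β) ^ ((p : ℝ) / β) := by
      rw [← Real.rpow_mul hx, mul_div_cancel₀ _ hβ.ne', Real.rpow_natCast]
    have h0 : 0 ≤ x ^ β := Real.rpow_nonneg hx _
    have h2 : (x ^ β) ^ ((p : ℝ) / β) ≤ 1 + (x ^ β) ^ N := by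
      rcases le_total (x ^ β) 1 with h | h
      · have : (x ^ β) ^ ((p : ℝ) / β) ≤ 1 := Real.rpow_le_one h0 h (by positivity)
        have : 0 ≤ (x ^ β) ^ N := by positivity
        linarith
      · have := Real.rpow_le_rpow_of_exponent_le h hN
        rw [Real.rpow_natCast] at this
        linarith
    have h3 : (x ^ β) ^ N ≤ N.factorial * Real.exp (x ^ β) := by
      have := Real.pow_div_factorial_le_exp _ h0 N
      rwa [div_le_iff₀ (by positivity), mul_comm] at this
    rw [h1]
    refine h2.trans ?_
    have : 1 + Psi β x = Real.exp (x ^ β) := by unfold Psi; ring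
    rw [this]
    linarith
  refine ⟨(1 + N.factorial * (1 + Psi β (xBeta β))) + (1 + N.factorial * (1 + C')), ?_,
    fun x hx => ?_⟩
  · have := Psi_nonneg (β := β) hb
    positivity
  have hf : (0 : ℝ) < N.factorial := by positivity
  have hPb := Psi_nonneg (β := β) hb
  have hPx := hPhi x hx
  rcases le_total x (xBeta β) with h | h
  · calc x ^ p ≤ 1 + N.factorial * (1 + Psi β x) := key x hx
      _ ≤ 1 + N.factorial * (1 + Psi β (xBeta β)) := by gcongr; exact Psi_mono hβ hx h
      _ ≤ ((1 + N.factorial * (1 + Psi β (xBeta β))) + (1 + N.factorial * (1 + C'))) * 1 := by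
          rw [mul_one]
          have : 0 ≤ 1 + N.factorial * (1 + C') := by positivity
          linarith
      _ ≤ _ := by gcongr; linarith
  · calc x ^ p ≤ 1 + N.factorial * (1 + Psi β x) := key x hx
      _ ≤ 1 + N.factorial * (1 + C' * Phi β x) := by gcongr; exact hPsi x h
      _ ≤ (1 + N.factorial * (1 + C')) * (1 + Phi β x) := by
          have : 0 ≤ N.factorial * C' := by positivity
          have : 0 ≤ N.factorial * Phi β x := by positivity
          nlinarith
      _ ≤ _ := by
          have : 0 ≤ 1 + N.factorial * (1 + Psi β (xBeta β)) := by positivity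
          exact mul_le_mul_of_nonneg_right (le_add_of_nonneg_left this) (by positivity)

/-- Iterating the halving property along `t ^ n` drives `Φ_β` to zero, without a separate continuity
argument at `0`. -/
theorem exists_Phi_le {β ε : ℝ} (hβ : 0 < β) (hε : 0 < ε) : ∃ x : ℝ, 0 < x ∧ Phi β x ≤ ε := by
  obtain ⟨t, ht, ht1, h⟩ := exists_Phi_mul_le_half hβ
  have key : ∀ n : ℕ, Phi β (t ^ n) ≤ (1 / 2) ^ n * Phi β 1 := by
    intro n
    induction n with
    | zero => simp
    | succ n ih =>
      rw [pow_succ', pow_succ', mul_assoc]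
      exact (h _ (by positivity)).trans (by gcongr)
  have hP := Phi_nonneg hβ (zero_le_one)
  obtain ⟨n, hn⟩ := exists_pow_lt_of_lt_one (show 0 < ε / (1 + Phi β 1) by positivity)
    (show (1 / 2 : ℝ) < 1 by norm_num)
  refine ⟨t ^ n, by positivity, (key n).trans ?_⟩
  rw [lt_div_iff₀ (by positivity)] at hn
  have : (0:ℝ) ≤ (1 / 2) ^ n := by positivity
  nlinarith

/-! ### The Luxemburg norm -/

section Luxemburg

variable {V V₁ V₂ : Type*} [NormedAddCommGroup V] [NormedAddCommGroup V₁] [NormedAddCommGroup V₂]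

/-- Testing only `l > a` avoids the question whether the infimum is attained; monotonicity of `Φ_β`
passes from one admissible value to all larger ones. -/
theorem luxNorm_le_ofReal_iff {β a : ℝ} (hβ : 0 < β) (ha : 0 ≤ a) {D : Set ℝ} {g : ℝ → V} :
    luxNorm β D g ≤ ENNReal.ofReal a ↔
      ∀ l, a < l → ∫⁻ r in D, ENNReal.ofReal (Phi β (‖g r‖ / l)) ≤ 1 := by
  constructor
  · intro h l hl
    have hl0 : 0 < l := ha.trans_lt hl
    have h1 : luxNorm β D g < ENNReal.ofReal l :=
      h.trans_lt ((ENNReal.ofReal_lt_ofReal_iff hl0).2 hl)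
    simp only [luxNorm, iInf_lt_iff] at h1
    obtain ⟨l', hl', hint, hlt⟩ := h1
    have hll : l' < l := (ENNReal.ofReal_lt_ofReal_iff hl0).1 hlt
    refine (lintegral_mono fun r => ENNReal.ofReal_le_ofReal ?_).trans hint
    exact Phi_mono hβ (by positivity) (by gcongr)
  · intro h
    refine ENNReal.le_of_forall_pos_le_add fun ε hε _ => ?_
    have hlt : a < a + ε := lt_add_of_pos_right a (by exact_mod_cast hε)
    have h0 : 0 < a + ε := ha.trans_lt hlt
    refine (iInf₂_le_of_le (a + ε) h0 (iInf_le_of_le (h _ hlt) ?_))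
    exact ENNReal.ofReal_add_le.trans (by rw [ENNReal.ofReal_coe_nnreal])

theorem luxNorm_le_of_norm_le_mul {β a c : ℝ} (hβ : 0 < β) (ha : 0 ≤ a) (hc : 0 ≤ c) {D : Set ℝ}
    (hD : MeasurableSet D) {g : ℝ → V} {g₁ : ℝ → V₁} (hg : ∀ r ∈ D, ‖g r‖ ≤ c * ‖g₁ r‖)
    (h : luxNorm β D g₁ ≤ ENNReal.ofReal a) : luxNorm β D g ≤ ENNReal.ofReal (c * a) := by
  rw [luxNorm_le_ofReal_iff hβ ha] at h
  rw [luxNorm_le_ofReal_iff hβ (by positivity)]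
  intro l hl
  have hl0 : 0 < l := (mul_nonneg hc ha).trans_lt hl
  rcases hc.eq_or_lt with h0 | h0
  · calc ∫⁻ r in D, ENNReal.ofReal (Phi β (‖g r‖ / l)) ≤ ∫⁻ r in D, 0 := by
          refine setLIntegral_mono' hD fun r hr => ?_
          have : ‖g r‖ = 0 := le_antisymm (by simpa [← h0] using hg r hr) (norm_nonneg _)
          simp [this, Phi_zero]
      _ ≤ 1 := by simp
  · refine (setLIntegral_mono' hD fun r hr => ENNReal.ofReal_le_ofReal ?_).trans
      (h (l / c) (by rw [lt_div_iff₀ h0]; linarith))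
    refine Phi_mono hβ (by positivity) ?_
    rw [div_div_eq_mul_div, mul_comm]
    gcongr
    exact hg r hr

theorem measurable_Phi_norm {β l : ℝ} {D : Set ℝ} {g : ℝ → V}
    (hg : AEStronglyMeasurable g (volume.restrict D)) :
    AEMeasurable (fun r => ENNReal.ofReal (Phi β (‖g r‖ / l))) (volume.restrict D) :=
  ((measurable_Phi β).comp_aemeasurable (hg.norm.aemeasurable.div_const l)).ennreal_ofReal

theorem Phi_max_le {β x y : ℝ} (hβ : 0 < β) (hx : 0 ≤ x) (hy : 0 ≤ y) :
    Phi β (max x y) ≤ Phi β x + Phi β y := by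
  rcases max_cases x y with ⟨h, _⟩ | ⟨h, _⟩ <;> rw [h]
  · linarith [Phi_nonneg hβ hy]
  · linarith [Phi_nonneg hβ hx]

theorem lintegral_half_Phi_add_le_one {β l₁ l₂ : ℝ} (hβ : 0 < β) (hl₁ : 0 < l₁) (hl₂ : 0 < l₂)
    {D : Set ℝ} {a : ℝ → V₁} {b : ℝ → V₂} (hm : AEStronglyMeasurable a (volume.restrict D))
    (h₁ : ∫⁻ r in D, ENNReal.ofReal (Phi β (‖a r‖ / l₁)) ≤ 1)
    (h₂ : ∫⁻ r in D, ENNReal.ofReal (Phi β (‖b r‖ / l₂)) ≤ 1) :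
    ∫⁻ r in D, ENNReal.ofReal (1 / 2 * (Phi β (‖a r‖ / l₁) + Phi β (‖b r‖ / l₂))) ≤ 1 := by
  have e : ∀ r, ENNReal.ofReal (1 / 2 * (Phi β (‖a r‖ / l₁) + Phi β (‖b r‖ / l₂)))
      = ENNReal.ofReal (1 / 2) * (ENNReal.ofReal (Phi β (‖a r‖ / l₁))
        + ENNReal.ofReal (Phi β (‖b r‖ / l₂))) := fun r => by
    rw [ENNReal.ofReal_mul (by norm_num), ENNReal.ofReal_add] <;>
    exact Phi_nonneg hβ (by positivity)
  simp_rw [e]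
  rw [lintegral_const_mul' _ _ ENNReal.ofReal_ne_top, lintegral_add_left' (measurable_Phi_norm hm)]
  calc _ ≤ ENNReal.ofReal (1 / 2) * (1 + 1) := by gcongr
    _ = 1 := by
      rw [one_add_one_eq_two, ← ENNReal.ofReal_ofNat, ← ENNReal.ofReal_mul (by norm_num)]
      norm_num

/-- Both summands are compared with their maximum, and the dilation by `t` supplies the factor `1/2`
that brings the sum of two modulars back below `1`. Only `a` need be measurable, since additivity of
the lower integral needs one measurable summand. -/
theorem exists_luxNorm_add_le {β : ℝ} (hβ : 0 < β) : ∃ C : ℝ, 1 ≤ C ∧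
    ∀ (D : Set ℝ), MeasurableSet D → ∀ (g : ℝ → V) (a : ℝ → V₁) (b : ℝ → V₂) (A B : ℝ),
      AEStronglyMeasurable a (volume.restrict D) → (∀ r ∈ D, ‖g r‖ ≤ ‖a r‖ + ‖b r‖) →
      0 ≤ A → 0 ≤ B → luxNorm β D a ≤ ENNReal.ofReal A → luxNorm β D b ≤ ENNReal.ofReal B →
      luxNorm β D g ≤ ENNReal.ofReal (C * (A + B)) := by
  obtain ⟨t, ht, ht1, hPhi⟩ := exists_Phi_mul_le_half hβ
  refine ⟨2 / t, by rw [le_div_iff₀ ht]; linarith, ?_⟩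
  intro D hD g a b A B hm hg hA hB ha hb
  rw [luxNorm_le_ofReal_iff hβ (by positivity)] at ha hb ⊢
  intro l hl
  have hL : A + B < t * l / 2 := by
    rw [div_mul_eq_mul_div, div_lt_iff₀ ht] at hl
    linarith
  set L := t * l / 2 with hLdef
  have hL0 : 0 < L := by linarith
  have hl0 : 0 < l := by
    by_contra hneg
    have := mul_nonpos_of_nonneg_of_nonpos ht.le (not_lt.1 hneg)
    linarith
  refine le_trans (setLIntegral_mono' hD fun r hr => ENNReal.ofReal_le_ofReal ?_)
    (lintegral_half_Phi_add_le_one hβ hL0 hL0 hm (ha L (by linarith)) (hb L (by linarith)))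
  calc Phi β (‖g r‖ / l) ≤ Phi β (t * max (‖a r‖ / L) (‖b r‖ / L)) := by
        refine Phi_mono hβ (by positivity) ?_
        have h1 : ‖a r‖ / L ≤ max (‖a r‖ / L) (‖b r‖ / L) := le_max_left _ _
        have h2 : ‖b r‖ / L ≤ max (‖a r‖ / L) (‖b r‖ / L) := le_max_right _ _
        calc ‖g r‖ / l ≤ (‖a r‖ + ‖b r‖) / l := by gcongr; exact hg r hr
          _ = t / 2 * (‖a r‖ / L + ‖b r‖ / L) := by rw [hLdef]; field_simp
          _ ≤ t / 2 * (max (‖a r‖ / L) (‖b r‖ / L) + max (‖a r‖ / L) (‖b r‖ / L)) := by gcongr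
          _ = _ := by ring
    _ ≤ 1 / 2 * Phi β (max (‖a r‖ / L) (‖b r‖ / L)) := hPhi _ (by positivity)
    _ ≤ _ := by
        gcongr
        exact Phi_max_le hβ (by positivity) (by positivity)

theorem exists_gt_gt_mul_le {A B m : ℝ} (hA : 0 ≤ A) (hB : 0 ≤ B) (h : A * B < m) :
    ∃ l₁ l₂, A < l₁ ∧ B < l₂ ∧ l₁ * l₂ ≤ m := by
  set η := min 1 ((m - A * B) / (A + B + 1))
  have hη : 0 < η := lt_min one_pos (div_pos (by linarith) (by linarith))
  have h1 : η ≤ 1 := min_le_left _ _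
  have h2 : η * (A + B + 1) ≤ m - A * B := by
    rw [← le_div_iff₀ (by linarith)]; exact min_le_right _ _
  refine ⟨A + η, B + η, by linarith, by linarith, ?_⟩
  nlinarith

/-- Hölder's inequality for exponential classes: after normalisation the product is at most the
square of the larger factor, and `exists_Phi_half_sq_le` applies. -/
theorem exists_luxNorm_mul_le {β : ℝ} (hβ : 0 < β) : ∃ C : ℝ, 1 ≤ C ∧
    ∀ (D : Set ℝ), MeasurableSet D → ∀ (g : ℝ → V) (a : ℝ → V₁) (b : ℝ → V₂) (A B : ℝ),
      AEStronglyMeasurable a (volume.restrict D) → (∀ r ∈ D, ‖g r‖ ≤ ‖a r‖ * ‖b r‖) →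
      0 ≤ A → 0 ≤ B → luxNorm β D a ≤ ENNReal.ofReal A → luxNorm β D b ≤ ENNReal.ofReal B →
      luxNorm (β / 2) D g ≤ ENNReal.ofReal (C * (A * B)) := by
  obtain ⟨t, ht, ht1, hPhi⟩ := exists_Phi_half_sq_le hβ
  have hβ2 : 0 < β / 2 := by positivity
  refine ⟨1 / t, by rw [le_div_iff₀ ht]; linarith, ?_⟩
  intro D hD g a b A B hm hg hA hB ha hb
  rw [luxNorm_le_ofReal_iff hβ (by positivity)] at ha hb
  rw [luxNorm_le_ofReal_iff hβ2 (by positivity)]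
  intro l hl
  have hL : A * B < t * l := by
    rw [div_mul_eq_mul_div, div_lt_iff₀ ht] at hl
    linarith
  obtain ⟨l₁, l₂, h₁, h₂, h₁₂⟩ := exists_gt_gt_mul_le hA hB hL
  have hl₁ : 0 < l₁ := by linarith
  have hl₂ : 0 < l₂ := by linarith
  have hl0 : 0 < l := by
    by_contra hneg
    have := mul_nonpos_of_nonneg_of_nonpos ht.le (not_lt.1 hneg)
    have := mul_nonneg hA hB
    linarith
  refine le_trans (setLIntegral_mono' hD fun r hr => ENNReal.ofReal_le_ofReal ?_)
    (lintegral_half_Phi_add_le_one hβ hl₁ hl₂ hm (ha _ h₁) (hb _ h₂))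
  set x := ‖a r‖ / l₁ with hx
  set y := ‖b r‖ / l₂ with hy
  have hx0 : 0 ≤ x := by positivity
  have hy0 : 0 ≤ y := by positivity
  have h1 : x ≤ max x y := le_max_left _ _
  have h2 : y ≤ max x y := le_max_right _ _
  calc Phi (β / 2) (‖g r‖ / l) ≤ Phi (β / 2) (t * max x y ^ 2) := by
        refine Phi_mono hβ2 (by positivity) ?_
        calc ‖g r‖ / l ≤ (‖a r‖ * ‖b r‖) / l := by gcongr; exact hg r hr
          _ = (l₁ * l₂) / l * (x * y) := by rw [hx, hy]; field_simp
          _ ≤ (t * l) / l * (max x y * max x y) := by gcongr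
          _ = _ := by field_simp
    _ ≤ 1 / 2 * Phi β (max x y) := hPhi _ (by positivity)
    _ ≤ _ := by
        gcongr
        exact Phi_max_le hβ hx0 hy0

theorem exists_luxNorm_le_of_bound {β : ℝ} (hβ : 0 < β) {T₀ : ℝ} (hT₀ : 0 < T₀) :
    ∃ C : ℝ, 0 < C ∧ ∀ (D : Set ℝ), MeasurableSet D → volume D ≤ ENNReal.ofReal T₀ →
      ∀ (g : ℝ → V) (S : ℝ), 0 ≤ S → (∀ r ∈ D, ‖g r‖ ≤ S) →
      luxNorm β D g ≤ ENNReal.ofReal (C * S) := by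
  obtain ⟨x, hx, hPhi⟩ := exists_Phi_le hβ (show 0 < 1 / T₀ by positivity)
  refine ⟨1 / x, by positivity, fun D hD hvol g S hS hg => ?_⟩
  rw [luxNorm_le_ofReal_iff hβ (by positivity)]
  intro l hl
  have hl0 : 0 < l := (show 0 ≤ 1 / x * S by positivity).trans_lt hl
  calc ∫⁻ r in D, ENNReal.ofReal (Phi β (‖g r‖ / l)) ≤ ∫⁻ r in D, ENNReal.ofReal (1 / T₀) := by
        refine setLIntegral_mono' hD fun r hr => ENNReal.ofReal_le_ofReal ?_
        refine (Phi_mono hβ (by positivity) ?_).trans hPhi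
        rw [div_le_iff₀ hl0]
        rw [div_mul_eq_mul_div, one_mul, div_lt_iff₀ hx] at hl
        linarith [hg r hr]
    _ = ENNReal.ofReal (1 / T₀) * volume D := by simp
    _ ≤ ENNReal.ofReal (1 / T₀) * ENNReal.ofReal T₀ := by gcongr
    _ = 1 := by rw [← ENNReal.ofReal_mul (by positivity)]; simp [hT₀.ne']

/-- Only the eighth moment is used, hence the loss of `h ^ (1/8)` against the trivial power `h`. The
number `8` is large enough that twice the loss stays below `α` for `α > 1/3`. -/
theorem exists_integral_le_of_luxNorm_le {β : ℝ} (hβ : 0 < β) {T₀ : ℝ} (hT₀ : 0 < T₀) :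
    ∃ C : ℝ, 0 < C ∧ ∀ (D : Set ℝ) (ξ : ℝ → ℝ) (a s h : ℝ), 0 < h → h ≤ T₀ → 0 ≤ a →
      Icc s (s + h) ⊆ D → ContinuousOn ξ (Icc s (s + h)) → (∀ r ∈ D, 0 ≤ ξ r) →
      luxNorm β D ξ ≤ ENNReal.ofReal a → ∫ r in s..(s + h), ξ r ≤ C * a * h ^ (7 / 8 : ℝ) := by
  obtain ⟨c, hc, hpow⟩ := exists_pow_le_Phi hβ 8
  refine ⟨1 + c * (T₀ + 1), by positivity, ?_⟩
  intro D ξ a s h hh hhT ha hsub hcont hpos hlux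
  rw [luxNorm_le_ofReal_iff hβ ha] at hlux
  have hsh : s ≤ s + h := by linarith
  -- The threshold in `x ≤ e + e⁻⁷ x⁸` is chosen so that integrating the constant `e` gives `h * e`,
  -- the same power of `h` as the weight `e⁻⁷`.
  set e : ℝ := h ^ (-(1 / 8) : ℝ) with he
  have he0 : 0 < e := Real.rpow_pos_of_pos hh _
  have he8 : (e ^ 7)⁻¹ = h ^ (7 / 8 : ℝ) := by
    rw [he, ← Real.rpow_natCast, ← Real.rpow_mul hh.le, ← Real.rpow_neg hh.le]
    norm_num
  have hhe : h * e = h ^ (7 / 8 : ℝ) := by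
    nth_rewrite 1 [← Real.rpow_one h]
    rw [he, ← Real.rpow_add hh]
    norm_num
  have hpt : ∀ x : ℝ, 0 ≤ x → x ≤ (e + (e ^ 7)⁻¹ * c) + (e ^ 7)⁻¹ * c * Phi β x := by
    intro x hx
    have h1 : x ≤ e + (e ^ 7)⁻¹ * x ^ 8 := by
      rcases le_total x e with h | h
      · have : 0 ≤ (e ^ 7)⁻¹ * x ^ 8 := by positivity
        linarith
      · have : x ≤ (e ^ 7)⁻¹ * x ^ 8 := by
          rw [inv_mul_eq_div, le_div_iff₀ (by positivity)]
          calc x * e ^ 7 ≤ x * x ^ 7 := by gcongr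
            _ = x ^ 8 := by ring
        linarith
    have h2 := mul_le_mul_of_nonneg_left (hpow x hx) (show 0 ≤ (e ^ 7)⁻¹ by positivity)
    linarith
  have hkey : ∀ l, a < l → ∫ r in s..(s + h), ξ r ≤ (1 + c * (T₀ + 1)) * l * h ^ (7 / 8 : ℝ) := by
    intro l hl
    have hl0 : 0 < l := by linarith
    rw [intervalIntegral.integral_of_le hsh, ← integral_Icc_eq_integral_Ioc]
    have hint : ∫⁻ r in Icc s (s + h), ENNReal.ofReal (ξ r)
        ≤ ENNReal.ofReal ((1 + c * (T₀ + 1)) * l * h ^ (7 / 8 : ℝ)) := by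
      calc ∫⁻ r in Icc s (s + h), ENNReal.ofReal (ξ r)
          ≤ ∫⁻ r in Icc s (s + h), (ENNReal.ofReal (l * (e + (e ^ 7)⁻¹ * c))
              + ENNReal.ofReal (l * ((e ^ 7)⁻¹ * c)) * ENNReal.ofReal (Phi β (‖ξ r‖ / l))) := by
            refine setLIntegral_mono' measurableSet_Icc fun r hr => ?_
            have hx0 : 0 ≤ ‖ξ r‖ / l := by positivity
            rw [← ENNReal.ofReal_mul (by positivity), ← ENNReal.ofReal_add (by positivity)
              (mul_nonneg (by positivity) (Phi_nonneg hβ hx0))]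
            refine ENNReal.ofReal_le_ofReal ?_
            have h1 := mul_le_mul_of_nonneg_left (hpt _ hx0) hl0.le
            rw [mul_div_cancel₀ _ hl0.ne'] at h1
            calc ξ r ≤ ‖ξ r‖ := Real.le_norm_self _
              _ ≤ _ := h1
              _ = _ := by ring
        _ = ENNReal.ofReal (l * (e + (e ^ 7)⁻¹ * c)) * ENNReal.ofReal h
            + ENNReal.ofReal (l * ((e ^ 7)⁻¹ * c))
              * ∫⁻ r in Icc s (s + h), ENNReal.ofReal (Phi β (‖ξ r‖ / l)) := by
            rw [lintegral_add_left measurable_const,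
              lintegral_const_mul' _ _ ENNReal.ofReal_ne_top]
            simp
        _ ≤ ENNReal.ofReal (l * (e + (e ^ 7)⁻¹ * c)) * ENNReal.ofReal h
            + ENNReal.ofReal (l * ((e ^ 7)⁻¹ * c)) * 1 := by
            gcongr
            exact (lintegral_mono_set hsub).trans (hlux l hl)
        _ = ENNReal.ofReal (l * (e + (e ^ 7)⁻¹ * c) * h + l * ((e ^ 7)⁻¹ * c)) := by
            rw [mul_one, ENNReal.ofReal_add (by positivity) (by positivity),
              ← ENNReal.ofReal_mul (by positivity)]
        _ ≤ _ := by
            refine ENNReal.ofReal_le_ofReal ?_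
            have : l * (e + (e ^ 7)⁻¹ * c) * h + l * ((e ^ 7)⁻¹ * c)
              = (1 + c * (h + 1)) * l * h ^ (7 / 8 : ℝ) := by
              rw [he8, ← hhe]; ring
            rw [this]
            gcongr
    rw [integral_eq_lintegral_of_nonneg_ae]
    · exact ENNReal.toReal_le_of_le_ofReal (by positivity) hint
    · exact (ae_restrict_mem measurableSet_Icc).mono fun r hr => hpos r (hsub hr)
    · exact hcont.aestronglyMeasurable measurableSet_Icc
  refine le_of_forall_pos_le_add fun ε hε => ?_
  have hC : 0 < (1 + c * (T₀ + 1)) * h ^ (7 / 8 : ℝ) := by positivity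
  refine (hkey (a + ε / ((1 + c * (T₀ + 1)) * h ^ (7 / 8 : ℝ))) ?_).trans (le_of_eq ?_)
  · have : 0 < ε / ((1 + c * (T₀ + 1)) * h ^ (7 / 8 : ℝ)) := by positivity
    linarith
  · field_simp

end Luxemburg

/-! ### The modulus and the Besov-Orlicz-type quasinorm -/

section Modulus

variable {V V₁ V₂ : Type*} [NormedAddCommGroup V] [NormedAddCommGroup V₁] [NormedAddCommGroup V₂]

/-- The simplex `{0 ≤ s ≤ t ≤ T}`. -/
def simplex (T : ℝ) : Set (ℝ × ℝ) := {p | 0 ≤ p.1 ∧ p.1 ≤ p.2 ∧ p.2 ≤ T}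

theorem luxNorm_zero {β : ℝ} (hβ : 0 < β) (D : Set ℝ) :
    luxNorm β D (fun _ => (0 : ℝ)) = 0 := by
  have : luxNorm β D (fun _ => (0 : ℝ)) ≤ ENNReal.ofReal 0 := by
    rw [luxNorm_le_ofReal_iff hβ le_rfl]
    intro l _
    simp [Phi_zero]
  simpa using this

theorem luxNorm_le_mul {β c : ℝ} (hβ : 0 < β) (hc : 0 ≤ c) {D : Set ℝ} (hD : MeasurableSet D)
    {g : ℝ → V} {g₁ : ℝ → V₁} (hg : ∀ r ∈ D, ‖g r‖ ≤ c * ‖g₁ r‖) :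
    luxNorm β D g ≤ ENNReal.ofReal c * luxNorm β D g₁ := by
  -- For `c = 0` the right-hand side is `0` even if the norm of `g₁` is infinite, so this case needs
  -- its own argument.
  rcases hc.eq_or_lt with h0 | h0
  · have : luxNorm β D g ≤ ENNReal.ofReal (0 * 0) := by
      refine luxNorm_le_of_norm_le_mul (g₁ := fun _ => (0 : ℝ)) hβ le_rfl le_rfl hD ?_
        (by rw [luxNorm_zero hβ]; exact zero_le)
      simpa [← h0] using hg
    simp only [mul_zero, ENNReal.ofReal_zero, nonpos_iff_eq_zero] at this
    simp [this]
  by_cases ht : luxNorm β D g₁ = ∞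
  · rw [ht, ENNReal.mul_top (by simpa using h0)]
    exact le_top
  · have := luxNorm_le_of_norm_le_mul hβ ENNReal.toReal_nonneg hc hD hg
      (ENNReal.ofReal_toReal ht).ge
    rwa [ENNReal.ofReal_mul hc, ENNReal.ofReal_toReal ht] at this

theorem modulus_mono (β T : ℝ) (Ξ : ℝ → ℝ → V) : Monotone (modulus β T Ξ) := fun _ _ h =>
  biSup_mono fun _ hr => ⟨hr.1, hr.2.trans h⟩

theorem luxNorm_le_modulus (β T : ℝ) (Ξ : ℝ → ℝ → V) {h τ : ℝ} (h0 : 0 ≤ h) (hτ : h ≤ τ) :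
    luxNorm β (Icc 0 (T - h)) (fun r => Ξ r (r + h)) ≤ modulus β T Ξ τ :=
  le_iSup₂ (f := fun h (_ : h ∈ Icc (0 : ℝ) τ) =>
    luxNorm β (Icc 0 (T - h)) (fun r => Ξ r (r + h))) h ⟨h0, hτ⟩

theorem modulus_le_mul {β c T : ℝ} (hβ : 0 < β) (hc : 0 ≤ c) {Ξ : ℝ → ℝ → V} {Ξ₁ : ℝ → ℝ → V₁}
    (hΞ : ∀ s t, 0 ≤ s → s ≤ t → t ≤ T → ‖Ξ s t‖ ≤ c * ‖Ξ₁ s t‖) (τ : ℝ) :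
    modulus β T Ξ τ ≤ ENNReal.ofReal c * modulus β T Ξ₁ τ := by
  refine iSup₂_le fun h hh => ?_
  refine (luxNorm_le_mul hβ hc measurableSet_Icc fun r hr => ?_).trans
    (mul_le_mul_right (luxNorm_le_modulus β T Ξ₁ hh.1 hh.2) _)
  exact hΞ r (r + h) hr.1 (by linarith [hh.1]) (by linarith [hr.2])

theorem continuousOn_slice {T h : ℝ} (hh : 0 ≤ h) {E : Type*} [TopologicalSpace E] {Ξ : ℝ → ℝ → E}
    (hc : ContinuousOn (fun p : ℝ × ℝ => Ξ p.1 p.2) (simplex T)) :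
    ContinuousOn (fun r => Ξ r (r + h)) (Icc 0 (T - h)) :=
  hc.comp (f := fun r => (r, r + h)) (by fun_prop)
    fun r hr => ⟨hr.1, by simpa using hh, by simpa using (by linarith [hr.2] : r + h ≤ T)⟩

theorem exists_modulus_add_le {β : ℝ} (hβ : 0 < β) : ∃ C : ℝ, 1 ≤ C ∧
    ∀ (T : ℝ) (ξ η : ℝ → ℝ → ℝ), ContinuousOn (fun p : ℝ × ℝ => ξ p.1 p.2) (simplex T) →
      ∀ τ, modulus β T (fun s t => ξ s t + η s t) τ
        ≤ ENNReal.ofReal C * (modulus β T ξ τ + modulus β T η τ) := by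
  obtain ⟨C, hC, h⟩ := exists_luxNorm_add_le (V := ℝ) (V₁ := ℝ) (V₂ := ℝ) hβ
  refine ⟨C, hC, fun T ξ η hξ τ => ?_⟩
  by_cases ht : modulus β T ξ τ + modulus β T η τ = ∞
  · rw [ht, ENNReal.mul_top (by simp; linarith)]
    exact le_top
  rw [ENNReal.add_eq_top, not_or] at ht
  refine iSup₂_le fun u hu => ?_
  have := h (Icc 0 (T - u)) measurableSet_Icc (fun r => ξ r (r + u) + η r (r + u))
    (fun r => ξ r (r + u)) (fun r => η r (r + u)) _ _
    ((continuousOn_slice hu.1 hξ).aestronglyMeasurable measurableSet_Icc)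
    (fun r _ => norm_add_le _ _) ENNReal.toReal_nonneg ENNReal.toReal_nonneg
    ((luxNorm_le_modulus β T ξ hu.1 hu.2).trans (ENNReal.ofReal_toReal ht.1).ge)
    ((luxNorm_le_modulus β T η hu.1 hu.2).trans (ENNReal.ofReal_toReal ht.2).ge)
  rwa [ENNReal.ofReal_mul (by linarith), ENNReal.ofReal_add ENNReal.toReal_nonneg
    ENNReal.toReal_nonneg, ENNReal.ofReal_toReal ht.1, ENNReal.ofReal_toReal ht.2] at this

theorem exists_modulus_mul_le {β : ℝ} (hβ : 0 < β) : ∃ C : ℝ, 1 ≤ C ∧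
    ∀ (T : ℝ) (ξ η : ℝ → ℝ → ℝ), ContinuousOn (fun p : ℝ × ℝ => ξ p.1 p.2) (simplex T) →
      ∀ τ, modulus β T ξ τ ≠ ∞ → modulus β T η τ ≠ ∞ →
      modulus (β / 2) T (fun s t => ξ s t * η s t) τ
        ≤ ENNReal.ofReal C * (modulus β T ξ τ * modulus β T η τ) := by
  obtain ⟨C, hC, h⟩ := exists_luxNorm_mul_le (V := ℝ) (V₁ := ℝ) (V₂ := ℝ) hβ
  refine ⟨C, hC, fun T ξ η hξ τ h₁ h₂ => iSup₂_le fun u hu => ?_⟩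
  have := h (Icc 0 (T - u)) measurableSet_Icc (fun r => ξ r (r + u) * η r (r + u))
    (fun r => ξ r (r + u)) (fun r => η r (r + u)) _ _
    ((continuousOn_slice hu.1 hξ).aestronglyMeasurable measurableSet_Icc)
    (fun r _ => norm_mul_le _ _) ENNReal.toReal_nonneg ENNReal.toReal_nonneg
    ((luxNorm_le_modulus β T ξ hu.1 hu.2).trans (ENNReal.ofReal_toReal h₁).ge)
    ((luxNorm_le_modulus β T η hu.1 hu.2).trans (ENNReal.ofReal_toReal h₂).ge)
  rwa [ENNReal.ofReal_mul (by linarith), ENNReal.ofReal_mul ENNReal.toReal_nonneg,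
    ENNReal.ofReal_toReal h₁, ENNReal.ofReal_toReal h₂] at this

/-! ### The scale measure -/

theorem ae_scaleMeasure_iff {T : ℝ} {p : ℝ → Prop} :
    (∀ᵐ τ ∂scaleMeasure T, p τ) ↔ ∀ᵐ τ, τ ∈ Ioc 0 T → p τ := by
  rw [scaleMeasure, ae_withDensity_iff (by fun_prop), ae_restrict_iff' measurableSet_Ioc]
  refine Filter.eventually_congr (Filter.Eventually.of_forall fun τ => ?_)
  refine forall_congr' fun hτ => ?_
  simp [hτ.1]

/-- The null endpoint `T` is discarded because finiteness of the modulus is derived only for `τ <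
T`. -/
theorem ae_scaleMeasure_mem (T : ℝ) : ∀ᵐ τ ∂scaleMeasure T, τ ∈ Ioo 0 T := by
  rw [ae_scaleMeasure_iff]
  have : ∀ᵐ τ : ℝ, τ ≠ T := by simp [ae_iff]
  exact this.mono fun τ h1 h2 => ⟨h2.1, h2.2.lt_of_ne h1⟩

theorem scaleMeasure_mono {T T₀ : ℝ} (h : T ≤ T₀) : scaleMeasure T ≤ scaleMeasure T₀ := by
  refine Measure.le_iff.2 fun s hs => ?_
  rw [scaleMeasure, scaleMeasure, withDensity_apply _ hs, withDensity_apply _ hs]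
  exact lintegral_mono' (Measure.restrict_mono le_rfl
    (Measure.restrict_mono (Ioc_subset_Ioc_right h) le_rfl)) le_rfl

theorem le_scaleMeasure_Ioc {T τ σ : ℝ} (hτ : 0 < τ) (hτσ : τ < σ) (hσ : σ ≤ T) :
    ENNReal.ofReal ((σ - τ) / σ) ≤ scaleMeasure T (Ioc τ σ) := by
  have hσ0 : 0 < σ := hτ.trans hτσ
  rw [scaleMeasure, withDensity_apply _ measurableSet_Ioc,
    Measure.restrict_restrict measurableSet_Ioc,
    inter_eq_self_of_subset_left (Ioc_subset_Ioc hτ.le hσ)]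
  calc ENNReal.ofReal ((σ - τ) / σ) = ∫⁻ _ in Ioc τ σ, ENNReal.ofReal (1 / σ) := by
        rw [setLIntegral_const, Real.volume_Ioc, ← ENNReal.ofReal_mul (by positivity)]
        congr 1
        field_simp
    _ ≤ _ := by
        refine setLIntegral_mono' measurableSet_Ioc fun r hr => ENNReal.ofReal_le_ofReal ?_
        have : 0 < r := hτ.trans hr.1
        have := hr.2
        gcongr

/-- The modulus is increasing, so its value at `τ` persists on `(τ, σ]` and is seen by the `L^q`
norm there. For `q = ∞` the exponent `1 / q.toReal` is `1 / 0 = 0`, which is the correct value. -/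
theorem modulus_mul_le_boNorm₂ {γ β T τ σ : ℝ} {q : ℝ≥0∞} (hγ : 0 ≤ γ) (hq : 0 < q)
    (Ξ : ℝ → ℝ → V) (hτ : 0 < τ) (hτσ : τ < σ) (hσ : σ ≤ T) :
    modulus β T Ξ τ * ENNReal.ofReal ((σ - τ) / σ) ^ (1 / q.toReal)
      ≤ ENNReal.ofReal (σ ^ γ) * boNorm₂ γ β q T Ξ := by
  have hσ0 : 0 < σ := hτ.trans hτσ
  have hσγ : 0 < σ ^ γ := Real.rpow_pos_of_pos hσ0 _
  have hμ := le_scaleMeasure_Ioc hτ hτσ hσ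
  have hμ0 : (scaleMeasure T).restrict (Ioc τ σ) ≠ 0 := by
    rw [Ne, Measure.restrict_eq_zero]
    intro h0
    rw [h0, nonpos_iff_eq_zero, ENNReal.ofReal_eq_zero] at hμ
    exact absurd hμ (not_le.2 (div_pos (sub_pos.2 hτσ) hσ0))
  have h1 : modulus β T Ξ τ / ENNReal.ofReal (σ ^ γ)
      * scaleMeasure T (Ioc τ σ) ^ (1 / q.toReal) ≤ boNorm₂ γ β q T Ξ := by
    calc _ = eLpNorm (fun _ : ℝ => modulus β T Ξ τ / ENNReal.ofReal (σ ^ γ)) q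
            ((scaleMeasure T).restrict (Ioc τ σ)) := by
          rw [eLpNorm_const _ hq.ne' hμ0, Measure.restrict_apply_univ]
          rfl
      _ ≤ eLpNorm (fun r => modulus β T Ξ r / ENNReal.ofReal (r ^ γ)) q
            ((scaleMeasure T).restrict (Ioc τ σ)) := by
          refine eLpNorm_mono_enorm_ae ((ae_restrict_mem measurableSet_Ioc).mono fun r hr => ?_)
          simp only [enorm_eq_self]
          have : 0 < r := hτ.trans hr.1
          have := hr.2
          gcongr
          exact modulus_mono β T Ξ hr.1.le
      _ ≤ _ := eLpNorm_restrict_le _ _ _ _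
  calc _ = ENNReal.ofReal (σ ^ γ) * (modulus β T Ξ τ / ENNReal.ofReal (σ ^ γ)
        * ENNReal.ofReal ((σ - τ) / σ) ^ (1 / q.toReal)) := by
        rw [← mul_assoc, ENNReal.mul_div_cancel (by simpa using hσγ) ENNReal.ofReal_ne_top]
    _ ≤ _ := by
        gcongr
        refine le_trans ?_ h1
        gcongr

theorem modulus_ne_top {γ β T τ : ℝ} {q : ℝ≥0∞} (hγ : 0 ≤ γ) (hq : 0 < q) {Ξ : ℝ → ℝ → V}
    (hτ : 0 < τ) (hτT : τ < T) (h : boNorm₂ γ β q T Ξ ≠ ∞) : modulus β T Ξ τ ≠ ∞ := by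
  intro ht
  have h1 := modulus_mul_le_boNorm₂ (β := β) hγ hq Ξ hτ hτT le_rfl
  have hpos : 0 < (T - τ) / T := div_pos (sub_pos.2 hτT) (hτ.trans hτT)
  rw [ht, ENNReal.top_mul] at h1
  · exact ENNReal.mul_ne_top ENNReal.ofReal_ne_top h (top_le_iff.1 h1)
  · exact (ENNReal.rpow_pos (by simpa using hpos) ENNReal.ofReal_ne_top).ne'

theorem modulus_le_of_boNorm₂_le {γ β T τ a : ℝ} {q : ℝ≥0∞} (hγ : 0 ≤ γ) (hq : 0 < q)
    {Ξ : ℝ → ℝ → V} (hτ : 0 < τ) (hτT : τ ≤ T / 2)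
    (h : boNorm₂ γ β q T Ξ ≤ ENNReal.ofReal a) :
    modulus β T Ξ τ ≤ ENNReal.ofReal (2 ^ (1 / q.toReal) * 2 ^ γ * a * τ ^ γ) := by
  -- Taking `σ = 2 * τ` makes the interval's scale mass at least `1/2`, independently of `τ`; this
  -- is why `τ ≤ T / 2` is required.
  have h1 := modulus_mul_le_boNorm₂ (β := β) (σ := 2 * τ) (T := T) hγ hq Ξ hτ (by linarith)
    (by linarith)
  have e : (2 * τ - τ) / (2 * τ) = 1 / 2 := by field_simp; ring
  rw [e, ENNReal.ofReal_rpow_of_pos (by norm_num)] at h1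
  set k : ℝ := (1 / 2 : ℝ) ^ (1 / q.toReal) with hk
  have hk0 : 0 < k := Real.rpow_pos_of_pos (by norm_num) _
  have hk' : (2 : ℝ) ^ (1 / q.toReal) = k⁻¹ := by
    rw [hk, one_div (2 : ℝ), Real.inv_rpow (by norm_num), inv_inv]
  have h2 : modulus β T Ξ τ * ENNReal.ofReal k * ENNReal.ofReal k⁻¹
      ≤ ENNReal.ofReal ((2 * τ) ^ γ) * ENNReal.ofReal a * ENNReal.ofReal k⁻¹ := by
    exact mul_le_mul' (h1.trans (mul_le_mul' le_rfl h)) le_rfl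
  rw [mul_assoc, ← ENNReal.ofReal_mul hk0.le, mul_inv_cancel₀ hk0.ne', ENNReal.ofReal_one,
    mul_one] at h2
  refine h2.trans (le_of_eq ?_)
  rw [← ENNReal.ofReal_mul (by positivity), ← ENNReal.ofReal_mul' (by positivity),
    Real.mul_rpow (by norm_num) hτ.le, hk']
  congr 1
  ring

/-! ### Calculus of bounds -/

/-- Cauchy–Schwarz for `u ^ (q/2)` and `v ^ (q/2)`. Applied after raising to the power, it needs no
lower bound on `q` beyond positivity. -/
theorem eLpNorm_mul_le_of_half {q : ℝ≥0∞} (hq : 0 < q) {μ : Measure ℝ} {u v : ℝ → ℝ≥0∞}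
    (hu : Measurable u) (hv : Measurable v) :
    eLpNorm (fun x => u x * v x) (q / 2) μ ≤ eLpNorm u q μ * eLpNorm v q μ := by
  by_cases hqt : q = ∞
  · subst hqt
    rw [ENNReal.top_div_of_ne_top (by norm_num)]
    simp only [eLpNorm_exponent_top, eLpNormEssSup, enorm_eq_self]
    exact ENNReal.essSup_mul_le u v
  have hq2 : q / 2 ≠ 0 := (ENNReal.div_pos hq.ne' (by norm_num)).ne'
  have hq2t : q / 2 ≠ ∞ := ENNReal.div_ne_top hqt (by norm_num)
  have hr : 0 < q.toReal := ENNReal.toReal_pos hq.ne' hqt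
  have e2 : (q / 2).toReal = q.toReal / 2 := by simp [ENNReal.toReal_div]
  rw [eLpNorm_eq_lintegral_rpow_enorm_toReal hq2 hq2t,
    eLpNorm_eq_lintegral_rpow_enorm_toReal hq.ne' hqt,
    eLpNorm_eq_lintegral_rpow_enorm_toReal hq.ne' hqt, e2]
  simp only [enorm_eq_self]
  have hconj : (2 : ℝ).HolderConjugate 2 := Real.HolderConjugate.two_two
  have hold := ENNReal.lintegral_mul_le_Lp_mul_Lq μ hconj
    (f := fun x => u x ^ (q.toReal / 2)) (g := fun x => v x ^ (q.toReal / 2))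
    (hu.pow_const _).aemeasurable (hv.pow_const _).aemeasurable
  simp only [Pi.mul_apply, ← ENNReal.rpow_mul, div_mul_cancel₀ _ (two_ne_zero (α := ℝ))] at hold
  calc _ = (∫⁻ x, u x ^ (q.toReal / 2) * v x ^ (q.toReal / 2) ∂μ) ^ (1 / (q.toReal / 2)) := by
        simp only [ENNReal.mul_rpow_of_nonneg _ _ (by positivity : 0 ≤ q.toReal / 2)]
    _ ≤ ((∫⁻ x, u x ^ q.toReal ∂μ) ^ (1 / 2 : ℝ)
        * (∫⁻ x, v x ^ q.toReal ∂μ) ^ (1 / 2 : ℝ)) ^ (1 / (q.toReal / 2)) := by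
        gcongr
    _ = _ := by
        rw [ENNReal.mul_rpow_of_nonneg _ _ (by positivity), ← ENNReal.rpow_mul,
          ← ENNReal.rpow_mul]
        have : (1 / 2 : ℝ) * (1 / (q.toReal / 2)) = 1 / q.toReal := by field_simp
        rw [this]

theorem measurable_modulus_div (γ β T : ℝ) (Ξ : ℝ → ℝ → V) :
    Measurable fun τ => modulus β T Ξ τ / ENNReal.ofReal (τ ^ γ) :=
  (modulus_mono β T Ξ).measurable.div (by fun_prop)

/-- `a` bounds the quasinorm of the nonnegative function `ξ`, which is continuous on the simplex. -/
structure BOBound (γ β : ℝ) (q : ℝ≥0∞) (T : ℝ) (ξ : ℝ → ℝ → ℝ) (a : ℝ) : Prop where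
  bound_nonneg : 0 ≤ a
  cont : ContinuousOn (fun p : ℝ × ℝ => ξ p.1 p.2) (simplex T)
  nonneg : ∀ s t, 0 ≤ s → s ≤ t → t ≤ T → 0 ≤ ξ s t
  norm_le : boNorm₂ γ β q T ξ ≤ ENNReal.ofReal a

theorem boNorm₂_le_mul {γ β c T : ℝ} {q : ℝ≥0∞} (hβ : 0 < β) (hc : 0 ≤ c) {Ξ : ℝ → ℝ → V}
    {Ξ₁ : ℝ → ℝ → V₁} (hΞ : ∀ s t, 0 ≤ s → s ≤ t → t ≤ T → ‖Ξ s t‖ ≤ c * ‖Ξ₁ s t‖) :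
    boNorm₂ γ β q T Ξ ≤ ENNReal.ofReal c * boNorm₂ γ β q T Ξ₁ := by
  refine eLpNorm_le_nnreal_smul_eLpNorm_of_ae_le_mul' (c := c.toNNReal)
    (Filter.Eventually.of_forall fun τ => ?_) q
  simp only [enorm_eq_self]
  rw [← mul_div_assoc]
  gcongr
  exact modulus_le_mul hβ hc hΞ τ

theorem BOBound.boNorm₂_le {γ β a T : ℝ} {q : ℝ≥0∞} (hβ : 0 < β) {ξ : ℝ → ℝ → ℝ}
    (h : BOBound γ β q T ξ a) {Ξ : ℝ → ℝ → V}
    (hΞ : ∀ s t, 0 ≤ s → s ≤ t → t ≤ T → ‖Ξ s t‖ ≤ ξ s t) :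
    boNorm₂ γ β q T Ξ ≤ ENNReal.ofReal a := by
  refine (boNorm₂_le_mul (c := 1) (Ξ₁ := ξ) hβ zero_le_one fun s t h0 hst ht => ?_).trans ?_
  · rw [one_mul]
    exact (hΞ s t h0 hst ht).trans (Real.le_norm_self _)
  · simpa using h.norm_le

theorem BOBound.const_mul {γ β a c T : ℝ} {q : ℝ≥0∞} (hβ : 0 < β) {ξ : ℝ → ℝ → ℝ}
    (h : BOBound γ β q T ξ a) (hc : 0 ≤ c) :
    BOBound γ β q T (fun s t => c * ξ s t) (c * a) where
  bound_nonneg := mul_nonneg hc h.bound_nonneg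
  cont := continuousOn_const.mul h.cont
  nonneg s t h0 hst ht := mul_nonneg hc (h.nonneg s t h0 hst ht)
  norm_le := by
    refine (boNorm₂_le_mul (c := c) (Ξ₁ := ξ) hβ hc fun s t h0 hst ht => ?_).trans ?_
    · rw [norm_mul, Real.norm_of_nonneg hc]
    · rw [ENNReal.ofReal_mul hc]
      gcongr
      exact h.norm_le

theorem BOBound.mono {γ β a b T : ℝ} {q : ℝ≥0∞} {ξ : ℝ → ℝ → ℝ}
    (h : BOBound γ β q T ξ a) (hab : a ≤ b) : BOBound γ β q T ξ b :=
  ⟨h.bound_nonneg.trans hab, h.cont, h.nonneg, h.norm_le.trans (ENNReal.ofReal_le_ofReal hab)⟩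

theorem BOBound.of_norm {γ β T : ℝ} {q : ℝ≥0∞} (hβ : 0 < β) {Ξ : ℝ → ℝ → V}
    (hc : ContinuousOn (fun p : ℝ × ℝ => Ξ p.1 p.2) (simplex T)) (h : boNorm₂ γ β q T Ξ ≠ ∞) :
    BOBound γ β q T (fun s t => ‖Ξ s t‖) (boNorm₂ γ β q T Ξ).toReal where
  bound_nonneg := ENNReal.toReal_nonneg
  cont := hc.norm
  nonneg _ _ _ _ _ := norm_nonneg _
  norm_le := by
    rw [ENNReal.ofReal_toReal h]
    simpa using boNorm₂_le_mul (γ := γ) (q := q) (c := 1) (T := T) (Ξ := fun s t => ‖Ξ s t‖)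
      (Ξ₁ := Ξ) hβ zero_le_one (by simp)

theorem exists_BOBound_add {β : ℝ} (hβ : 0 < β) (q : ℝ≥0∞) : ∃ C : ℝ, 1 ≤ C ∧
    ∀ (γ T : ℝ) (ξ η : ℝ → ℝ → ℝ) (a b : ℝ), BOBound γ β q T ξ a → BOBound γ β q T η b →
      BOBound γ β q T (fun s t => ξ s t + η s t) (C * (a + b)) := by
  obtain ⟨C, hC, hmod⟩ := exists_modulus_add_le hβ
  have hLp : ENNReal.LpAddConst q ≠ ∞ := (ENNReal.LpAddConst_lt_top q).ne
  -- `LpAddConst q` is the quasi-triangle constant of `L^q`, which may exceed `1` when `q < 1`.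
  set L : ℝ := max 1 (ENNReal.LpAddConst q).toReal
  have hL : ENNReal.LpAddConst q ≤ ENNReal.ofReal L := by
    rw [← ENNReal.ofReal_toReal hLp]
    exact ENNReal.ofReal_le_ofReal (le_max_right _ _)
  have hL1 : 1 ≤ L := le_max_left _ _
  refine ⟨C * L, one_le_mul_of_one_le_of_one_le hC hL1, fun γ T ξ η a b hξ hη => ?_⟩
  have ha := hξ.bound_nonneg
  have hb := hη.bound_nonneg
  refine ⟨by positivity, hξ.cont.add hη.cont,
    fun s t h0 hst ht => add_nonneg (hξ.nonneg s t h0 hst ht) (hη.nonneg s t h0 hst ht), ?_⟩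
  calc boNorm₂ γ β q T (fun s t => ξ s t + η s t)
      ≤ C.toNNReal • eLpNorm ((fun τ => modulus β T ξ τ / ENNReal.ofReal (τ ^ γ))
          + (fun τ => modulus β T η τ / ENNReal.ofReal (τ ^ γ))) q (scaleMeasure T) := by
        refine eLpNorm_le_nnreal_smul_eLpNorm_of_ae_le_mul'
          (Filter.Eventually.of_forall fun τ => ?_) q
        simp only [enorm_eq_self, Pi.add_apply]
        rw [← ENNReal.add_div, ← mul_div_assoc]
        gcongr
        exact hmod T ξ η hξ.cont τ
    _ ≤ ENNReal.ofReal C * (ENNReal.LpAddConst q * (boNorm₂ γ β q T ξ + boNorm₂ γ β q T η)) := by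
        have := eLpNorm_add_le' (μ := scaleMeasure T)
          (measurable_modulus_div γ β T ξ).aestronglyMeasurable
          (measurable_modulus_div γ β T η).aestronglyMeasurable q
        exact mul_le_mul_right this _
    _ ≤ ENNReal.ofReal C * (ENNReal.ofReal L * (ENNReal.ofReal a + ENNReal.ofReal b)) := by
        gcongr
        · exact hξ.norm_le
        · exact hη.norm_le
    _ = _ := by
        rw [← ENNReal.ofReal_add ha hb, ← ENNReal.ofReal_mul (by positivity),
          ← ENNReal.ofReal_mul (by positivity), mul_assoc]

theorem exists_BOBound_mul {β : ℝ} (hβ : 0 < β) {q : ℝ≥0∞} (hq : 0 < q) : ∃ C : ℝ, 1 ≤ C ∧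
    ∀ (γ T : ℝ) (ξ η : ℝ → ℝ → ℝ) (a b : ℝ), 0 ≤ γ → BOBound γ β q T ξ a → BOBound γ β q T η b →
      BOBound (2 * γ) (β / 2) (q / 2) T (fun s t => ξ s t * η s t) (C * (a * b)) := by
  obtain ⟨C, hC, hmod⟩ := exists_modulus_mul_le hβ
  refine ⟨C, hC, fun γ T ξ η a b hγ hξ hη => ?_⟩
  have ha := hξ.bound_nonneg
  have hb := hη.bound_nonneg
  refine ⟨by positivity, hξ.cont.mul hη.cont,
    fun s t h0 hst ht => mul_nonneg (hξ.nonneg s t h0 hst ht) (hη.nonneg s t h0 hst ht), ?_⟩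
  have hξt : boNorm₂ γ β q T ξ ≠ ∞ := (hξ.norm_le.trans_lt ENNReal.ofReal_lt_top).ne
  have hηt : boNorm₂ γ β q T η ≠ ∞ := (hη.norm_le.trans_lt ENNReal.ofReal_lt_top).ne
  calc boNorm₂ (2 * γ) (β / 2) (q / 2) T (fun s t => ξ s t * η s t)
      ≤ C.toNNReal • eLpNorm (fun τ => modulus β T ξ τ / ENNReal.ofReal (τ ^ γ)
          * (modulus β T η τ / ENNReal.ofReal (τ ^ γ))) (q / 2) (scaleMeasure T) := by
        refine eLpNorm_le_nnreal_smul_eLpNorm_of_ae_le_mul'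
          -- Restricting to `0 < τ < T` makes both moduli finite, which excludes a product `0 * ∞`,
          -- and allows `τ ^ (2 * γ)` to be split.
          ((ae_scaleMeasure_mem T).mono fun τ hτ => ?_) (q / 2)
        simp only [enorm_eq_self]
        have hpos : 0 < τ ^ γ := Real.rpow_pos_of_pos hτ.1 _
        have h0 : ENNReal.ofReal (τ ^ γ) ≠ 0 := by simpa using hpos
        have e : τ ^ (2 * γ) = τ ^ γ * τ ^ γ := by
          rw [← Real.rpow_add hτ.1]; ring_nf
        rw [e, ENNReal.ofReal_mul hpos.le]
        refine (ENNReal.div_le_div_right (hmod T ξ η hξ.cont τ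
          (modulus_ne_top hγ hq hτ.1 hτ.2 hξt) (modulus_ne_top hγ hq hτ.1 hτ.2 hηt)) _).trans
          (le_of_eq ?_)
        simp only [div_eq_mul_inv]
        rw [ENNReal.mul_inv (Or.inl h0) (Or.inl ENNReal.ofReal_ne_top)]
        change ENNReal.ofReal C * _ * _ = ENNReal.ofReal C * _
        ring
    _ ≤ ENNReal.ofReal C * (boNorm₂ γ β q T ξ * boNorm₂ γ β q T η) :=
        mul_le_mul_right (eLpNorm_mul_le_of_half hq (measurable_modulus_div γ β T ξ)
          (measurable_modulus_div γ β T η)) _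
    _ ≤ ENNReal.ofReal C * (ENNReal.ofReal a * ENNReal.ofReal b) := by
        gcongr
        · exact hξ.norm_le
        · exact hη.norm_le
    _ = _ := by rw [← ENNReal.ofReal_mul ha, ← ENNReal.ofReal_mul (by positivity)]

theorem eLpNorm_rpow_scaleMeasure_lt_top {κ : ℝ} (hκ : 0 < κ) {q : ℝ≥0∞} (hq : 0 < q) (T : ℝ) :
    eLpNorm (fun τ : ℝ => ENNReal.ofReal (τ ^ κ)) q (scaleMeasure T) < ∞ := by
  by_cases hqt : q = ∞
  · subst hqt
    rw [eLpNorm_exponent_top]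
    refine lt_of_le_of_lt (b := ENNReal.ofReal (T ^ κ)) ?_ ENNReal.ofReal_lt_top
    refine essSup_le_of_ae_le _ ((ae_scaleMeasure_mem T).mono fun τ hτ => ?_)
    simp only [enorm_eq_self]
    exact ENNReal.ofReal_le_ofReal (Real.rpow_le_rpow hτ.1.le hτ.2.le hκ.le)
  rw [eLpNorm_lt_top_iff_lintegral_rpow_enorm_lt_top hq.ne' hqt]
  have hr : 0 < q.toReal := ENNReal.toReal_pos hq.ne' hqt
  simp only [enorm_eq_self]
  rw [scaleMeasure, lintegral_withDensity_eq_lintegral_mul _ (by fun_prop) (by fun_prop)]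
  have hint : IntegrableOn (fun τ : ℝ => τ ^ (κ * q.toReal - 1)) (Ioc 0 T) := by
    have := intervalIntegral.intervalIntegrable_rpow' (a := 0) (b := T)
      (show -1 < κ * q.toReal - 1 by have := mul_pos hκ hr; linarith)
    exact this.1
  refine lt_of_le_of_lt (setLIntegral_mono' measurableSet_Ioc fun τ hτ => ?_)
    hint.lintegral_lt_top
  simp only [Pi.mul_apply]
  rw [ENNReal.ofReal_rpow_of_nonneg (Real.rpow_nonneg hτ.1.le _) hr.le,
    ← ENNReal.ofReal_mul (by have := hτ.1; positivity), ← Real.rpow_mul hτ.1.le,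
    Real.rpow_sub hτ.1, Real.rpow_one, one_div_mul_eq_div]

/-- The surplus power `τ ^ (θ - γ)` is in `L^q(dτ/τ)` near `0`, and bounded functions lie in every
exponential class. Thus pointwise smoothness above `γ` forgets both `β` and `q`. Comparison with the
scale measure on `(0, T₀]` makes the constant uniform in `T ≤ T₀`. -/
theorem exists_BOBound_of_rpow {β : ℝ} (hβ : 0 < β) {q : ℝ≥0∞} (hq : 0 < q) {γ θ : ℝ}
    (hγ : 0 < γ) (hγθ : γ < θ) {T₀ : ℝ} (hT₀ : 0 < T₀) : ∃ C : ℝ, 1 ≤ C ∧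
    ∀ (T : ℝ) (ξ : ℝ → ℝ → ℝ) (K : ℝ), T ≤ T₀ → 0 ≤ K →
      ContinuousOn (fun p : ℝ × ℝ => ξ p.1 p.2) (simplex T) →
      (∀ s t, 0 ≤ s → s ≤ t → t ≤ T → 0 ≤ ξ s t) →
      (∀ s t, 0 ≤ s → s ≤ t → t ≤ T → ξ s t ≤ K * (t - s) ^ θ) →
      BOBound γ β q T ξ (C * K) := by
  obtain ⟨C, hC, hlux⟩ := exists_luxNorm_le_of_bound (V := ℝ) hβ hT₀
  have hfin := eLpNorm_rpow_scaleMeasure_lt_top (sub_pos.2 hγθ) hq T₀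
  set N := eLpNorm (fun τ : ℝ => ENNReal.ofReal (τ ^ (θ - γ))) q (scaleMeasure T₀)
  refine ⟨max 1 (C * N.toReal), le_max_left _ _, fun T ξ K hT hK hc hn hb =>
    ⟨by positivity, hc, hn, ?_⟩⟩
  calc boNorm₂ γ β q T ξ
      ≤ (C * K).toNNReal • eLpNorm (fun τ : ℝ => ENNReal.ofReal (τ ^ (θ - γ))) q
          (scaleMeasure T) := by
        refine eLpNorm_le_nnreal_smul_eLpNorm_of_ae_le_mul'
          ((ae_scaleMeasure_mem T).mono fun τ hτ => ?_) q
        simp only [enorm_eq_self]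
        have hpos : 0 < τ ^ γ := Real.rpow_pos_of_pos hτ.1 _
        have hm : modulus β T ξ τ ≤ ENNReal.ofReal (C * (K * τ ^ θ)) := by
          refine iSup₂_le fun h hh => ?_
          refine hlux _ measurableSet_Icc ?_ _ _
            (mul_nonneg hK (Real.rpow_nonneg hτ.1.le _)) fun r hr => ?_
          · rw [Real.volume_Icc]
            exact ENNReal.ofReal_le_ofReal (by linarith [hh.1])
          · have h1 := hr.1
            have h2 : r ≤ r + h := by linarith [hh.1]
            have h3 : r + h ≤ T := by linarith [hr.2]
            rw [Real.norm_of_nonneg (hn _ _ h1 h2 h3)]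
            refine (hb _ _ h1 h2 h3).trans ?_
            rw [add_sub_cancel_left]
            have := hh.1
            have := hh.2
            gcongr
            linarith
        calc _ ≤ ENNReal.ofReal (C * (K * τ ^ θ)) / ENNReal.ofReal (τ ^ γ) := by gcongr
          _ = ENNReal.ofReal (C * K) * ENNReal.ofReal (τ ^ (θ - γ)) := by
            rw [← ENNReal.ofReal_div_of_pos hpos, ← ENNReal.ofReal_mul (by positivity),
              Real.rpow_sub hτ.1]
            congr 1
            ring
    _ ≤ ENNReal.ofReal (C * K) * N :=
        mul_le_mul_right (eLpNorm_mono_measure _ (scaleMeasure_mono hT)) _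
    _ = ENNReal.ofReal (C * N.toReal * K) := by
        rw [← ENNReal.ofReal_toReal hfin.ne, ← ENNReal.ofReal_mul (by positivity),
          ENNReal.toReal_ofReal ENNReal.toReal_nonneg]
        congr 1
        ring
    _ ≤ _ := by
        refine ENNReal.ofReal_le_ofReal ?_
        gcongr
        exact le_max_right _ _

end Modulus

/-! ### Pointwise bounds from averaged bounds -/

/-- A function of two variables which is almost subadditive, and whose averages along the lines
`t = s + h` are controlled, both up to an error governed by `D`. -/
structure AlmostAdditive (T ρ : ℝ) (D : ℝ → ℝ) (ξ : ℝ → ℝ → ℝ) : Prop where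
  rho_nonneg : 0 ≤ ρ
  rho_lt_one : ρ < 1
  err_nonneg : ∀ h, 0 ≤ h → 0 ≤ D h
  err_mono : ∀ h h', 0 ≤ h → h ≤ h' → D h ≤ D h'
  err_half : ∀ h, 0 < h → D (h / 2) ≤ ρ * D h
  cont : ContinuousOn (fun p : ℝ × ℝ => ξ p.1 p.2) (simplex T)
  diag : ∀ s, 0 ≤ s → s ≤ T → ξ s s = 0
  tri : ∀ s u t, 0 ≤ s → s ≤ u → u ≤ t → t ≤ T → ξ s t ≤ ξ s u + ξ u t + D (t - s)
  avg : ∀ s h, 0 ≤ s → 0 < h → s + 2 * h ≤ T → ∫ r in s..(s + h), ξ r (r + h) ≤ h * D h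

namespace AlmostAdditive

variable {T ρ : ℝ} {D : ℝ → ℝ} {ξ : ℝ → ℝ → ℝ}

theorem intervalIntegrable_comp (H : AlmostAdditive T ρ D ξ) {a b : ℝ} (hab : a ≤ b) {f g : ℝ → ℝ}
    (hf : Continuous f) (hg : Continuous g) (h : ∀ r ∈ Icc a b, (f r, g r) ∈ simplex T) :
    IntervalIntegrable (fun r => ξ (f r) (g r)) volume a b := by
  refine ContinuousOn.intervalIntegrable ?_
  rw [uIcc_of_le hab]
  exact H.cont.comp (f := fun r => (f r, g r)) (by fun_prop) h

/-- The second half of the interval is shifted onto the first, and `(s, r + h/2)` is split at `r`: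
one part is again an average from `s`, the other an average along a line of fixed increment. -/
theorem avg_halving (H : AlmostAdditive T ρ D ξ) {s h : ℝ} (hs : 0 ≤ s) (hh : 0 < h)
    (hT : s + h ≤ T) :
    ∫ r in s..(s + h), ξ s r ≤ 2 * (∫ r in s..(s + h / 2), ξ s r) + h * D h := by
  have i1 : IntervalIntegrable (fun r => ξ s r) volume s (s + h / 2) :=
    H.intervalIntegrable_comp (by linarith) continuous_const continuous_id fun r hr =>
      ⟨hs, hr.1, by have := hr.2; simp only; linarith⟩
  have i2 : IntervalIntegrable (fun r => ξ s r) volume (s + h / 2) (s + h) :=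
    H.intervalIntegrable_comp (by linarith) continuous_const continuous_id fun r hr =>
      ⟨hs, by have := hr.1; simp only; linarith, by have := hr.2; simp only; linarith⟩
  have i3 : IntervalIntegrable (fun r => ξ r (r + h / 2)) volume s (s + h / 2) :=
    H.intervalIntegrable_comp (f := fun r => r) (g := fun r => r + h / 2) (by linarith)
      (by fun_prop) (by fun_prop) fun r hr =>
      ⟨by have := hr.1; simp only; linarith, by simp only; linarith,
        by have := hr.2; simp only; linarith⟩
  have i4 : IntervalIntegrable (fun r => ξ s (r + h / 2)) volume s (s + h / 2) :=
    H.intervalIntegrable_comp (g := fun r => r + h / 2) (by linarith)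
      continuous_const (by fun_prop) fun r hr =>
      ⟨hs, by have := hr.1; simp only; linarith, by have := hr.2; simp only; linarith⟩
  rw [← intervalIntegral.integral_add_adjacent_intervals i1 i2]
  have e : ∫ r in (s + h / 2)..(s + h), ξ s r = ∫ r in s..(s + h / 2), ξ s (r + h / 2) := by
    rw [intervalIntegral.integral_comp_add_right (fun r => ξ s r)]
    congr 1
    ring
  have h1 : ∫ r in s..(s + h / 2), ξ s (r + h / 2)
      ≤ ∫ r in s..(s + h / 2), (ξ s r + ξ r (r + h / 2) + D h) := by
    refine intervalIntegral.integral_mono_on (by linarith) i4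
      ((i1.add i3).add intervalIntegrable_const) fun r hr => ?_
    have := H.tri s r (r + h / 2) hs hr.1 (by linarith) (by linarith [hr.2])
    have := H.err_mono (r + h / 2 - s) h (by linarith [hr.1]) (by linarith [hr.2])
    linarith
  have h2 := H.avg s (h / 2) hs (by linarith) (by linarith)
  rw [intervalIntegral.integral_add (i1.add i3) intervalIntegrable_const,
    intervalIntegral.integral_add i1 i3, intervalIntegral.integral_const] at h1
  have h3 := H.err_mono (h / 2) h (by linarith) (by linarith)
  have h4 : h / 2 * D (h / 2) ≤ h / 2 * D h := by gcongr
  simp only [add_sub_cancel_left, smul_eq_mul] at h1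
  rw [e]
  linarith

theorem avg_iterate (H : AlmostAdditive T ρ D ξ) (n : ℕ) {s h : ℝ} (hs : 0 ≤ s) (hh : 0 < h)
    (hT : s + h ≤ T) :
    ∫ r in s..(s + h), ξ s r
      ≤ 2 ^ n * (∫ r in s..(s + h / 2 ^ n), ξ s r) + h * (D h / (1 - ρ)) := by
  have hρ : 0 < 1 - ρ := sub_pos.2 H.rho_lt_one
  induction n generalizing h with
  | zero =>
    have := H.err_nonneg h hh.le
    have : 0 ≤ h * (D h / (1 - ρ)) := by positivity
    simpa using this
  | succ n ih =>
    have h1 := H.avg_halving hs hh hT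
    have h2 := ih (h := h / 2) (by linarith) (by linarith)
    have h3 : D (h / 2) / (1 - ρ) ≤ ρ * D h / (1 - ρ) := by
      gcongr
      exact H.err_half h hh
    -- The geometric series in closed form: `D / (1 - ρ)` reproduces itself under one halving.
    have h4 : h * (ρ * D h / (1 - ρ)) + h * D h = h * (D h / (1 - ρ)) := by
      field_simp
      ring
    have h5 : h / 2 * (D (h / 2) / (1 - ρ)) ≤ h / 2 * (ρ * D h / (1 - ρ)) := by gcongr
    have e : h / 2 / 2 ^ n = h / 2 ^ (n + 1) := by rw [pow_succ]; field_simp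
    rw [e] at h2
    rw [pow_succ]
    rw [pow_succ] at h2
    linarith

/-- As the interval shrinks, the mean of `ξ s ·` tends to `ξ s s = 0` by continuity, so only the
accumulated error of the halvings survives. -/
theorem avg_start_le (H : AlmostAdditive T ρ D ξ) {s h : ℝ} (hs : 0 ≤ s) (hh : 0 < h)
    (hT : s + h ≤ T) : ∫ r in s..(s + h), ξ s r ≤ h * (D h / (1 - ρ)) := by
  refine le_of_forall_pos_le_add fun ε hε => ?_
  have hcont : ContinuousWithinAt (fun r => ξ s r) (Icc s T) s := by
    have : ContinuousOn (fun r => ξ s r) (Icc s T) :=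
      H.cont.comp (f := fun r => (s, r)) (by fun_prop) fun r hr => ⟨hs, hr.1, hr.2⟩
    exact this s ⟨le_rfl, by linarith⟩
  have hev : ∀ᶠ r in nhdsWithin s (Icc s T), ξ s r < ε / h := by
    have := hcont.tendsto.eventually_lt_const
      (show ξ s s < ε / h by rw [H.diag s hs (by linarith)]; positivity)
    exact this
  obtain ⟨δ, hδ, hball⟩ := Metric.mem_nhdsWithin_iff.1 hev
  obtain ⟨n, hn⟩ := exists_pow_lt_of_lt_one (show 0 < δ / h by positivity)
    (show (1 / 2 : ℝ) < 1 by norm_num)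
  have hn' : h / 2 ^ n < δ := by
    rw [lt_div_iff₀ hh, one_div, inv_pow, inv_mul_eq_div] at hn
    exact hn
  have hle : h / 2 ^ n ≤ h := div_le_self hh.le (one_le_pow₀ (by norm_num))
  have hp : 0 < h / 2 ^ n := by positivity
  have h1 : ∫ r in s..(s + h / 2 ^ n), ξ s r ≤ ∫ r in s..(s + h / 2 ^ n), ε / h := by
    refine intervalIntegral.integral_mono_on (by linarith) ?_ intervalIntegrable_const
      fun r hr => ?_
    · exact H.intervalIntegrable_comp (by linarith) continuous_const continuous_id fun r hr =>
        ⟨hs, hr.1, by have := hr.2; simp only; linarith⟩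
    · have : r ∈ Metric.ball s δ ∩ Icc s T := by
        refine ⟨?_, hr.1, by linarith [hr.2]⟩
        rw [Metric.mem_ball, Real.dist_eq, abs_of_nonneg (by linarith [hr.1])]
        linarith [hr.2]
      exact (hball this).le
  rw [intervalIntegral.integral_const, add_sub_cancel_left, smul_eq_mul] at h1
  have h2 := H.avg_iterate n hs hh hT
  have h3 : (2 : ℝ) ^ n * (∫ r in s..(s + h / 2 ^ n), ξ s r) ≤ 2 ^ n * (h / 2 ^ n * (ε / h)) := by
    gcongr
  have e : (2 : ℝ) ^ n * (h / 2 ^ n * (ε / h)) = ε := by field_simp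
  linarith

/-- Time reversal preserves the whole structure, so averages ending at `t` need no second dyadic
argument. -/
theorem reverse (H : AlmostAdditive T ρ D ξ) :
    AlmostAdditive T ρ D (fun s t => ξ (T - t) (T - s)) where
  rho_nonneg := H.rho_nonneg
  rho_lt_one := H.rho_lt_one
  err_nonneg := H.err_nonneg
  err_mono := H.err_mono
  err_half := H.err_half
  cont := H.cont.comp (f := fun p : ℝ × ℝ => (T - p.2, T - p.1)) (by fun_prop)
    fun p hp => ⟨by simpa using hp.2.2, sub_le_sub_left hp.2.1 T, by simpa using hp.1⟩
  diag s h0 hT := H.diag _ (by linarith) (by linarith)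
  tri s u t h0 hsu hut ht := by
    have := H.tri (T - t) (T - u) (T - s) (by linarith) (by linarith) (by linarith) (by linarith)
    rw [show T - s - (T - t) = t - s by ring] at this
    linarith
  avg s h h0 hh hT := by
    -- The substitution `r ↦ T - h - r` maps `[s, s + h]` onto the interval of length `h` starting
    -- at `T - s - 2 * h`.
    have := H.avg (T - s - 2 * h) h (by linarith) hh (by linarith)
    refine le_trans (le_of_eq ?_) this
    have e := intervalIntegral.integral_comp_sub_left (a := s) (b := s + h)
      (fun r => ξ r (r + h)) (T - h)
    rw [show T - h - (s + h) = T - s - 2 * h by ring,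
      show T - h - s = T - s - 2 * h + h by ring] at e
    rw [← e]
    refine intervalIntegral.integral_congr fun r _ => ?_
    congr 1 <;> ring

theorem avg_end_le (H : AlmostAdditive T ρ D ξ) {t h : ℝ} (ht : t ≤ T) (hh : 0 < h)
    (h0 : 0 ≤ t - h) : ∫ r in (t - h)..t, ξ r t ≤ h * (D h / (1 - ρ)) := by
  have := H.reverse.avg_start_le (s := T - t) (h := h) (by linarith) hh (by linarith)
  refine le_trans (le_of_eq ?_) this
  have e := intervalIntegral.integral_comp_sub_left (a := T - t) (b := T - t + h)
    (fun r => ξ r t) T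
  rw [show T - (T - t + h) = t - h by ring, sub_sub_cancel] at e
  rw [← e, sub_sub_cancel]

/-- The pointwise bound. -/
theorem le (H : AlmostAdditive T ρ D ξ) {s t : ℝ} (hs : 0 ≤ s) (hst : s ≤ t) (ht : t ≤ T) :
    ξ s t ≤ (3 + 2 / (1 - ρ)) * D (t - s) := by
  have hρ : 0 < 1 - ρ := sub_pos.2 H.rho_lt_one
  rcases hst.eq_or_lt with rfl | hlt
  · rw [H.diag s hs ht]
    have := H.err_nonneg (s - s) (by simp)
    positivity
  -- The increment is averaged over the chains `s → r → r + h → t` with `r ∈ [s, s + h]`. The outer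
  -- links contribute `1 / (1 - ρ)` each, the middle link `1`, and the two subdivisions `2`.
  set h := (t - s) / 2 with hh
  have h0 : 0 < h := by linarith
  have i1 : IntervalIntegrable (fun r => ξ s r) volume s (s + h) :=
    H.intervalIntegrable_comp (by linarith) continuous_const continuous_id fun r hr =>
      ⟨hs, hr.1, by have := hr.2; simp only; linarith⟩
  have i2 : IntervalIntegrable (fun r => ξ r (r + h)) volume s (s + h) :=
    H.intervalIntegrable_comp (f := fun r => r) (g := fun r => r + h) (by linarith)
      (by fun_prop) (by fun_prop) fun r hr =>
      ⟨by have := hr.1; simp only; linarith, by simp only; linarith,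
        by have := hr.2; simp only; linarith⟩
  have i3 : IntervalIntegrable (fun r => ξ (r + h) t) volume s (s + h) :=
    H.intervalIntegrable_comp (f := fun r => r + h) (by linarith)
      (by fun_prop) continuous_const fun r hr =>
      ⟨by have := hr.1; simp only; linarith, by have := hr.2; simp only; linarith, ht⟩
  have h1 : ∫ r in s..(s + h), ξ s t
      ≤ ∫ r in s..(s + h), (ξ s r + ξ r (r + h) + ξ (r + h) t + 2 * D (t - s)) := by
    refine intervalIntegral.integral_mono_on (by linarith) intervalIntegrable_const
      (((i1.add i2).add i3).add intervalIntegrable_const) fun r hr => ?_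
    have a1 := H.tri s r t hs hr.1 (by linarith [hr.2]) ht
    have a2 := H.tri r (r + h) t (by linarith [hr.1]) (by linarith) (by linarith [hr.2]) ht
    have a3 := H.err_mono (t - r) (t - s) (by linarith [hr.2]) (by linarith [hr.1])
    linarith
  rw [intervalIntegral.integral_add ((i1.add i2).add i3) intervalIntegrable_const,
    intervalIntegral.integral_add (i1.add i2) i3, intervalIntegral.integral_add i1 i2,
    intervalIntegral.integral_const, intervalIntegral.integral_const] at h1
  simp only [add_sub_cancel_left, smul_eq_mul] at h1
  have b1 := H.avg_start_le (h := h) hs h0 (by linarith)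
  have b2 := H.avg s h hs h0 (by linarith)
  have b3 := H.avg_end_le (h := h) ht h0 (by linarith)
  have e : ∫ r in s..(s + h), ξ (r + h) t = ∫ r in (t - h)..t, ξ r t := by
    rw [intervalIntegral.integral_comp_add_right (fun r => ξ r t)]
    congr 1 <;> rw [hh] <;> ring
  rw [e] at h1
  have hD : D h ≤ D (t - s) := H.err_mono _ _ h0.le (by linarith)
  have c1 : D h / (1 - ρ) ≤ D (t - s) / (1 - ρ) := by gcongr
  have c2 : h * (D h / (1 - ρ)) ≤ h * (D (t - s) / (1 - ρ)) := by gcongr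
  have c3 : h * D h ≤ h * D (t - s) := by gcongr
  have key : h * ξ s t ≤ h * ((3 + 2 / (1 - ρ)) * D (t - s)) := by
    have : h * ((3 + 2 / (1 - ρ)) * D (t - s))
      = 3 * (h * D (t - s)) + 2 * (h * (D (t - s) / (1 - ρ))) := by ring
    linarith
  exact le_of_mul_le_mul_left key h0

end AlmostAdditive

/-! ### Embedding into Hölder spaces -/

/-- The norm bounds the modulus by a multiple of `a * h ^ γ`, and averaging loses `1/8`, so the
dyadic argument applies with an error of the form `a * h ^ (γ - 1/8) + L * h ^ θ`. The last term
allows for a defect in the triangle inequality. -/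
theorem exists_pointwise_le {β : ℝ} (hβ : 0 < β) {q : ℝ≥0∞} (hq : 0 < q) {γ θ : ℝ}
    (hγ : 1 / 8 < γ) (hθ : 0 < θ) {T₀ : ℝ} (hT₀ : 0 < T₀) : ∃ C : ℝ, 1 ≤ C ∧
    ∀ (T : ℝ) (ξ : ℝ → ℝ → ℝ) (a L : ℝ), T ≤ T₀ → BOBound γ β q T ξ a → 0 ≤ L →
      (∀ s, 0 ≤ s → s ≤ T → ξ s s = 0) →
      (∀ s u t, 0 ≤ s → s ≤ u → u ≤ t → t ≤ T →
        ξ s t ≤ ξ s u + ξ u t + L * (t - s) ^ θ) →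
      ∀ s t, 0 ≤ s → s ≤ t → t ≤ T →
        ξ s t ≤ C * (a * (t - s) ^ (γ - 1 / 8) + L * (t - s) ^ θ) := by
  obtain ⟨C₁, hC₁, hint⟩ := exists_integral_le_of_luxNorm_le hβ hT₀
  set c : ℝ := 2 ^ (1 / q.toReal) * 2 ^ γ
  have hc : 0 < c := by positivity
  set κ : ℝ := γ - 1 / 8 with hκdef
  have hκ : 0 < κ := by linarith
  set ρ : ℝ := max ((1 / 2) ^ κ) ((1 / 2) ^ θ)
  have hρ0 : 0 ≤ ρ := by positivity
  have hρ1 : ρ < 1 := max_lt (Real.rpow_lt_one (by norm_num) (by norm_num) hκ)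
    (Real.rpow_lt_one (by norm_num) (by norm_num) hθ)
  have hρ : 0 < 1 - ρ := sub_pos.2 hρ1
  set m : ℝ := max 1 (C₁ * c)
  have hm : 1 ≤ m := le_max_left _ _
  have hG : 1 ≤ 3 + 2 / (1 - ρ) := by
    have : 0 ≤ 2 / (1 - ρ) := by positivity
    linarith
  refine ⟨(3 + 2 / (1 - ρ)) * m, one_le_mul_of_one_le_of_one_le hG hm, ?_⟩
  intro T ξ a L hTT hξ hL hdiag htri s t hs hst ht
  have ha := hξ.bound_nonneg
  have H : AlmostAdditive T ρ (fun h => C₁ * c * a * h ^ κ + L * h ^ θ) ξ :=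
    { rho_nonneg := hρ0
      rho_lt_one := hρ1
      err_nonneg := fun h hh => by positivity
      err_mono := fun h h' hh hhh => by
        gcongr
      err_half := fun h hh => by
        have e1 : (h / 2) ^ κ ≤ ρ * h ^ κ := by
          rw [div_eq_mul_one_div, Real.mul_rpow hh.le (by norm_num), mul_comm]
          gcongr
          exact le_max_left _ _
        have e2 : (h / 2) ^ θ ≤ ρ * h ^ θ := by
          rw [div_eq_mul_one_div, Real.mul_rpow hh.le (by norm_num), mul_comm]
          gcongr
          exact le_max_right _ _
        calc _ ≤ C₁ * c * a * (ρ * h ^ κ) + L * (ρ * h ^ θ) := by gcongr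
          _ = _ := by ring
      cont := hξ.cont
      diag := hdiag
      tri := fun s u t hs hsu hut ht => by
        refine (htri s u t hs hsu hut ht).trans ?_
        have : 0 ≤ C₁ * c * a * (t - s) ^ κ := by
          have : 0 ≤ t - s := by linarith
          positivity
        linarith
      avg := fun s h hs hh hsT => by
        -- The requirement `s + 2 * h ≤ T` with `s ≥ 0` is what makes `h ≤ T / 2`.
        have hmod := modulus_le_of_boNorm₂_le (β := β) (by linarith : 0 ≤ γ) hq hh
          (by linarith : h ≤ T / 2) hξ.norm_le
        have hlux := (luxNorm_le_modulus β T ξ hh.le le_rfl).trans hmod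
        have := hint (Icc 0 (T - h)) (fun r => ξ r (r + h)) _ s h hh (by linarith)
          (by positivity) (Icc_subset_Icc hs (by linarith))
          ((continuousOn_slice hh.le hξ.cont).mono (Icc_subset_Icc hs (by linarith)))
          (fun r hr => hξ.nonneg _ _ hr.1 (by linarith) (by linarith [hr.2])) hlux
        have e : h ^ γ * h ^ (7 / 8 : ℝ) = h * h ^ κ := by
          nth_rewrite 3 [← Real.rpow_one h]
          rw [← Real.rpow_add hh, ← Real.rpow_add hh]
          congr 1
          rw [hκdef]
          ring
        calc _ ≤ _ := this
          _ = C₁ * c * a * (h ^ γ * h ^ (7 / 8 : ℝ)) := by ring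
          _ = h * (C₁ * c * a * h ^ κ) := by rw [e]; ring
          _ ≤ _ := by
            gcongr
            have : 0 ≤ L * h ^ θ := by positivity
            linarith }
  refine (H.le hs hst ht).trans ?_
  have hts : 0 ≤ t - s := by linarith
  rw [mul_assoc (3 + 2 / (1 - ρ))]
  refine mul_le_mul_of_nonneg_left ?_ (by linarith)
  rw [mul_add, mul_assoc (C₁ * c), ← mul_assoc m a, ← mul_assoc (C₁ * c) a]
  refine add_le_add ?_ (le_mul_of_one_le_left (by positivity) hm)
  gcongr
  exact le_max_right _ _

section Paths

variable {V W : Type*} [NormedAddCommGroup V] [NormedSpace ℝ V]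
  [NormedAddCommGroup W] [NormedSpace ℝ W]

/-- `a` bounds the Besov-Orlicz seminorm of the continuous path `g`. -/
def PathBound (α β : ℝ) (q : ℝ≥0∞) (T : ℝ) {V : Type*} [NormedAddCommGroup V] (g : ℝ → V)
    (a : ℝ) : Prop :=
  ContinuousOn g (Icc 0 T) ∧ BOBound α β q T (fun s t => ‖g t - g s‖) a

theorem continuousOn_comp_fst {T : ℝ} {E : Type*} [TopologicalSpace E] {g : ℝ → E}
    (hg : ContinuousOn g (Icc 0 T)) : ContinuousOn (fun p : ℝ × ℝ => g p.1) (simplex T) :=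
  hg.comp continuousOn_fst fun _ hp => ⟨hp.1, hp.2.1.trans hp.2.2⟩

theorem continuousOn_comp_snd {T : ℝ} {E : Type*} [TopologicalSpace E] {g : ℝ → E}
    (hg : ContinuousOn g (Icc 0 T)) : ContinuousOn (fun p : ℝ × ℝ => g p.2) (simplex T) :=
  hg.comp continuousOn_snd fun _ hp => ⟨hp.1.trans hp.2.1, hp.2.2⟩

theorem continuousOn_increment {T : ℝ} {V : Type*} [NormedAddCommGroup V] {g : ℝ → V}
    (hg : ContinuousOn g (Icc 0 T)) :
    ContinuousOn (fun p : ℝ × ℝ => g p.2 - g p.1) (simplex T) :=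
  (continuousOn_comp_snd hg).sub (continuousOn_comp_fst hg)

theorem continuousOn_remainder {T : ℝ} {X : ℝ → V} {Y : ℝ → W} {Y' : ℝ → V →L[ℝ] W}
    (hX : ContinuousOn X (Icc 0 T)) (hY : ContinuousOn Y (Icc 0 T))
    (hY' : ContinuousOn Y' (Icc 0 T)) :
    ContinuousOn (fun p : ℝ × ℝ => remainder X Y Y' p.1 p.2) (simplex T) :=
  (continuousOn_increment hY).sub ((continuousOn_comp_fst hY').clm_apply
    (continuousOn_increment hX))

theorem PathBound.of_finite {V : Type*} [NormedAddCommGroup V] {α β T : ℝ} {q : ℝ≥0∞} (hβ : 0 < β)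
    {g : ℝ → V} (hg : ContinuousOn g (Icc 0 T)) (h : boSeminorm α β q T g ≠ ∞) :
    PathBound α β q T g (boSeminorm α β q T g).toReal :=
  ⟨hg, BOBound.of_norm hβ (continuousOn_increment hg) h⟩

/-- The Hölder embedding, with the resulting bound of the supremum. -/
theorem exists_path_le {β : ℝ} (hβ : 0 < β) {q : ℝ≥0∞} (hq : 0 < q) {α : ℝ}
    (hα : 1 / 8 < α) {T₀ : ℝ} (hT₀ : 0 < T₀) : ∃ C : ℝ, 1 ≤ C ∧
    ∀ (V : Type) [NormedAddCommGroup V] (T : ℝ) (g : ℝ → V) (a : ℝ), T ≤ T₀ →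
      PathBound α β q T g a →
      (∀ s t, 0 ≤ s → s ≤ t → t ≤ T → ‖g t - g s‖ ≤ C * a * (t - s) ^ (α - 1 / 8)) ∧
      ∀ t, 0 ≤ t → t ≤ T → ‖g t‖ ≤ C * (‖g 0‖ + a) := by
  -- The exponent `θ = 1` is arbitrary: increments of a path satisfy the exact triangle inequality,
  -- so `L = 0`.
  obtain ⟨C, hC, h⟩ := exists_pointwise_le hβ hq hα one_pos hT₀
  set D : ℝ := max 1 (T₀ ^ (α - 1 / 8))
  have hD : 1 ≤ D := le_max_left _ _
  refine ⟨C * D, one_le_mul_of_one_le_of_one_le hC hD, fun V _ T g a hT hg => ?_⟩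
  have ha := hg.2.bound_nonneg
  have hα0 : 0 ≤ α - 1 / 8 := by linarith
  have key : ∀ s t, 0 ≤ s → s ≤ t → t ≤ T → ‖g t - g s‖ ≤ C * a * (t - s) ^ (α - 1 / 8) := by
    intro s t hs hst ht
    have := h T _ a 0 hT hg.2 le_rfl (by simp) (fun s u t _ _ _ _ => by
      rw [zero_mul, add_zero, add_comm]
      exact norm_sub_le_norm_sub_add_norm_sub _ _ _) s t hs hst ht
    linarith
  refine ⟨fun s t hs hst ht => (key s t hs hst ht).trans ?_, fun t h0 ht => ?_⟩
  · have : 0 ≤ t - s := by linarith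
    gcongr
    exact le_mul_of_one_le_right (by linarith) hD
  · have h1 := key 0 t le_rfl h0 ht
    have h2 : ‖g t‖ ≤ ‖g 0‖ + ‖g t - g 0‖ := by
      simpa using norm_add_le (g 0) (g t - g 0)
    have h3 : (t - 0) ^ (α - 1 / 8) ≤ D := by
      rw [sub_zero]
      exact (Real.rpow_le_rpow h0 (ht.trans hT) hα0).trans (le_max_right _ _)
    have h4 : C * a * (t - 0) ^ (α - 1 / 8) ≤ C * a * D := by gcongr
    have h5 : ‖g 0‖ ≤ C * D * ‖g 0‖ :=
      le_mul_of_one_le_left (norm_nonneg _) (one_le_mul_of_one_le_of_one_le hC hD)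
    linarith

/-- A remainder-like two-parameter function is smoother than a path of smoothness `α`. -/
theorem exists_BOBound_of_remainder {β : ℝ} (hβ : 0 < β) {q : ℝ≥0∞} (hq : 0 < q) {α : ℝ}
    (hα : 1 / 3 < α) {T₀ : ℝ} (hT₀ : 0 < T₀) : ∃ C : ℝ, 1 ≤ C ∧
    ∀ (T : ℝ) (ξ : ℝ → ℝ → ℝ) (a L : ℝ), T ≤ T₀ →
      BOBound (2 * α) (β / 2) (q / 2) T ξ a → 0 ≤ L →
      (∀ s, 0 ≤ s → s ≤ T → ξ s s = 0) →
      (∀ s u t, 0 ≤ s → s ≤ u → u ≤ t → t ≤ T →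
        ξ s t ≤ ξ s u + ξ u t + L * (t - s) ^ (2 * (α - 1 / 8))) →
      BOBound α β q T ξ (C * (a + L)) := by
  have hq2 : 0 < q / 2 := ENNReal.div_pos hq.ne' (by norm_num)
  obtain ⟨C, hC, h⟩ := exists_pointwise_le (θ := 2 * (α - 1 / 8)) (by positivity : 0 < β / 2) hq2
    (by linarith : 1 / 8 < 2 * α) (by linarith) hT₀
  -- The condition `α < 2 * (α - 1 / 8)` amounts to `α > 1/4`, which `α > 1/3` provides. This is
  -- where integrability `β` and exponent `q` are regained from `β / 2` and `q / 2`.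
  obtain ⟨C₂, hC₂, h₂⟩ := exists_BOBound_of_rpow (γ := α) (θ := 2 * (α - 1 / 8)) hβ hq
    (by linarith) (by linarith) hT₀
  set D : ℝ := max 1 (T₀ ^ (1 / 8 : ℝ))
  have hD : 1 ≤ D := le_max_left _ _
  refine ⟨C₂ * (C * D), one_le_mul_of_one_le_of_one_le hC₂
    (one_le_mul_of_one_le_of_one_le hC hD), fun T ξ a L hT hξ hL hdiag htri => ?_⟩
  have ha := hξ.bound_nonneg
  rw [mul_assoc]
  refine h₂ T ξ _ hT (by positivity) hξ.cont hξ.nonneg fun s t hs hst ht => ?_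
  refine (h T ξ a L hT hξ hL hdiag htri s t hs hst ht).trans ?_
  have hts : 0 ≤ t - s := by linarith
  -- The two exponents supplied by the pointwise bound differ by `1/8`; the better one is lowered at
  -- the cost of `T₀ ^ (1/8)`.
  have e : (t - s) ^ (2 * α - 1 / 8) = (t - s) ^ (1 / 8 : ℝ) * (t - s) ^ (2 * (α - 1 / 8)) := by
    rw [← Real.rpow_add_of_nonneg hts (by norm_num) (by linarith)]
    congr 1
    ring
  have h3 : (t - s) ^ (1 / 8 : ℝ) ≤ D :=
    (Real.rpow_le_rpow hts (by linarith) (by norm_num)).trans (le_max_right _ _)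
  set y := (t - s) ^ (2 * (α - 1 / 8))
  have hy : 0 ≤ y := Real.rpow_nonneg hts _
  calc C * (a * (t - s) ^ (2 * α - 1 / 8) + L * y) ≤ C * (a * (D * y) + L * (D * y)) := by
        rw [e]
        gcongr
        exact le_mul_of_one_le_left hy hD
    _ = C * D * (a + L) * y := by ring

end Paths

/-! ### Smooth functions with bounded derivatives -/

section Smooth

set_option maxSynthPendingDepth 3

variable {W U : Type*} [NormedAddCommGroup W] [NormedSpace ℝ W] [NormedAddCommGroup U]
  [NormedSpace ℝ U]

theorem MemCb.norm_iteratedFDeriv_le {j i : ℕ} {f : W → U} (hf : MemCb j f) (hi : i ≤ j) (x : W) :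
    ‖iteratedFDeriv ℝ i f x‖ ≤ (cbNorm j f).toReal := by
  have h : ‖iteratedFDeriv ℝ i f x‖ₑ ≤ cbNorm j f :=
    (le_iSup (fun x => ‖iteratedFDeriv ℝ i f x‖ₑ) x).trans
      (Finset.single_le_sum (f := fun i => ⨆ x, ‖iteratedFDeriv ℝ i f x‖ₑ)
        (fun _ _ => zero_le) (Finset.mem_range.2 (by omega)))
  rw [← toReal_enorm]
  exact ENNReal.toReal_mono hf.2.ne h

theorem MemCb.norm_fderiv_le {j : ℕ} {f : W → U} (hf : MemCb j f) (hj : 1 ≤ j) (x : W) :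
    ‖fderiv ℝ f x‖ ≤ (cbNorm j f).toReal := by
  rw [← norm_iteratedFDeriv_one]
  exact hf.norm_iteratedFDeriv_le hj x

theorem MemCb.norm_fderiv_fderiv_le {j : ℕ} {f : W → U} (hf : MemCb j f) (hj : 2 ≤ j) (x : W) :
    ‖fderiv ℝ (fderiv ℝ f) x‖ ≤ (cbNorm j f).toReal := by
  rw [← norm_iteratedFDeriv_one, norm_iteratedFDeriv_fderiv]
  exact hf.norm_iteratedFDeriv_le hj x

theorem MemCb.norm_fderiv_fderiv_fderiv_le {j : ℕ} {f : W → U} (hf : MemCb j f) (hj : 3 ≤ j)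
    (x : W) : ‖fderiv ℝ (fderiv ℝ (fderiv ℝ f)) x‖ ≤ (cbNorm j f).toReal := by
  rw [← norm_iteratedFDeriv_one, norm_iteratedFDeriv_fderiv, norm_iteratedFDeriv_fderiv]
  exact hf.norm_iteratedFDeriv_le hj x

theorem norm_sub_le_of_norm_fderiv_le {f : W → U} (hf : Differentiable ℝ f) {F : ℝ}
    (hF : ∀ x, ‖fderiv ℝ f x‖ ≤ F) (a b : W) : ‖f b - f a‖ ≤ F * ‖b - a‖ :=
  convex_univ.norm_image_sub_le_of_norm_fderiv_le (fun x _ => hf x) (fun x _ => hF x)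
    (mem_univ a) (mem_univ b)

theorem MemCb.differentiable_fderiv {j : ℕ} {f : W → U} (hf : MemCb j f) (hj : 2 ≤ j) :
    Differentiable ℝ (fderiv ℝ f) := by
  have h2 : ContDiff ℝ 2 f := hf.1.of_le (by exact_mod_cast hj)
  exact (h2.fderiv_right (m := 1) (by norm_num)).differentiable (by norm_num)

theorem MemCb.norm_fderiv_sub_le {j : ℕ} {f : W → U} (hf : MemCb j f) (hj : 2 ≤ j) (a b : W) :
    ‖fderiv ℝ f b - fderiv ℝ f a‖ ≤ (cbNorm j f).toReal * ‖b - a‖ :=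
  norm_sub_le_of_norm_fderiv_le (hf.differentiable_fderiv hj) (hf.norm_fderiv_fderiv_le hj) a b

theorem MemCb.norm_fderiv_fderiv_sub_le {j : ℕ} {f : W → U} (hf : MemCb j f) (hj : 3 ≤ j)
    (a b : W) :
    ‖fderiv ℝ (fderiv ℝ f) b - fderiv ℝ (fderiv ℝ f) a‖ ≤ (cbNorm j f).toReal * ‖b - a‖ := by
  have h3 : ContDiff ℝ 3 f := hf.1.of_le (by exact_mod_cast hj)
  have h2 : ContDiff ℝ 2 (fderiv ℝ f) := h3.fderiv_right (m := 2) (by norm_num)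
  exact norm_sub_le_of_norm_fderiv_le ((h2.fderiv_right (m := 1) (by norm_num)).differentiable
    (by norm_num)) (hf.norm_fderiv_fderiv_fderiv_le hj) a b

/-- The error of the linear approximation. -/
def taylorError (f : W → U) (a u : W) : U := f (a + u) - f a - fderiv ℝ f a u

theorem hasFDerivAt_taylorError {f : W → U} (hf : Differentiable ℝ f) (a u : W) :
    HasFDerivAt (taylorError f a) (fderiv ℝ f (a + u) - fderiv ℝ f a) u := by
  unfold taylorError
  refine HasFDerivAt.sub ?_ (fderiv ℝ f a).hasFDerivAt
  have h : HasFDerivAt (fun u => f (a + u)) (fderiv ℝ f (a + u)) u :=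
    (hasFDerivAt_comp_add_left a).2 (hf (a + u)).hasFDerivAt
  exact h.sub_const _

/-- The mean value inequality on a ball of radius `‖u‖ + ‖v‖`: the derivative of the Taylor error at
`z` is `Df(a + z) - Df(a)`, of size `F * ‖z‖`. -/
theorem norm_taylorError_sub_le {f : W → U} (hf : Differentiable ℝ f) {F : ℝ} (hF0 : 0 ≤ F)
    (hF : ∀ a b, ‖fderiv ℝ f b - fderiv ℝ f a‖ ≤ F * ‖b - a‖) (a u v : W) :
    ‖taylorError f a u - taylorError f a v‖ ≤ F * (‖u‖ + ‖v‖) * ‖u - v‖ := by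
  refine (convex_closedBall (0 : W) (‖u‖ + ‖v‖)).norm_image_sub_le_of_norm_hasFDerivWithin_le
    (fun x _ => (hasFDerivAt_taylorError hf a x).hasFDerivWithinAt) (fun x hx => ?_)
    (by simp) (by simp)
  refine (hF _ _).trans ?_
  rw [add_sub_cancel_left]
  gcongr
  simpa using hx

theorem norm_taylorError_le {f : W → U} (hf : Differentiable ℝ f) {F : ℝ} (hF0 : 0 ≤ F)
    (hF : ∀ a b, ‖fderiv ℝ f b - fderiv ℝ f a‖ ≤ F * ‖b - a‖) (a u : W) :
    ‖taylorError f a u‖ ≤ F * (‖u‖ * ‖u‖) := by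
  have := norm_taylorError_sub_le hf hF0 hF a u 0
  simpa [taylorError, mul_assoc] using this

/-- The base point is moved first with the increment `u` fixed, which uses the Lipschitz bound on
`Df`; then the increment is changed at the base point `b`. -/
theorem norm_second_difference_le {f : W → U} (hf : Differentiable ℝ f) {F : ℝ}
    (hF1 : ∀ x, ‖fderiv ℝ f x‖ ≤ F)
    (hF2 : ∀ a b, ‖fderiv ℝ f b - fderiv ℝ f a‖ ≤ F * ‖b - a‖) (a b u v : W) :
    ‖(f (a + u) - f a) - (f (b + v) - f b)‖ ≤ F * (‖u - v‖ + ‖a - b‖ * ‖u‖) := by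
  have h1 : ‖(f (a + u) - f a) - (f (b + u) - f b)‖ ≤ F * ‖u‖ * ‖a - b‖ := by
    refine convex_univ.norm_image_sub_le_of_norm_hasFDerivWithin_le
      (f := fun z => f (z + u) - f z) (f' := fun z => fderiv ℝ f (z + u) - fderiv ℝ f z)
      (fun z _ => HasFDerivAt.hasFDerivWithinAt ?_) (fun z _ => ?_) (mem_univ b) (mem_univ a)
    · have h : HasFDerivAt (fun z => f (z + u)) (fderiv ℝ f (z + u)) z :=
        (hasFDerivAt_comp_add_right u).2 (hf (z + u)).hasFDerivAt
      exact h.sub (hf z).hasFDerivAt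
    · simpa using hF2 z (z + u)
  have h2 : ‖f (b + u) - f (b + v)‖ ≤ F * ‖u - v‖ := by
    simpa using norm_sub_le_of_norm_fderiv_le hf hF1 (b + v) (b + u)
  calc _ = ‖((f (a + u) - f a) - (f (b + u) - f b)) + (f (b + u) - f (b + v))‖ := by
        congr 1; abel
    _ ≤ _ := norm_add_le _ _
    _ ≤ F * ‖u‖ * ‖a - b‖ + F * ‖u - v‖ := add_le_add h1 h2
    _ = _ := by ring

/-- Moving the base point at fixed increment, the derivative in `z` is a second difference of `Df`
with equal increments, hence at most `F * ‖a - b‖ * ‖z‖`. This is the step that needs a Lipschitz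
second derivative. -/
theorem norm_taylorError_sub_taylorError_le {f : W → U} (hf : Differentiable ℝ f)
    (hf' : Differentiable ℝ (fderiv ℝ f)) {F : ℝ} (hF0 : 0 ≤ F)
    (hF1 : ∀ x, ‖fderiv ℝ (fderiv ℝ f) x‖ ≤ F)
    (hF2 : ∀ a b, ‖fderiv ℝ (fderiv ℝ f) b - fderiv ℝ (fderiv ℝ f) a‖ ≤ F * ‖b - a‖)
    (a b u v : W) :
    ‖taylorError f a u - taylorError f b v‖
      ≤ F * (‖a - b‖ * (‖u‖ * ‖u‖) + (‖u‖ + ‖v‖) * ‖u - v‖) := by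
  have h1 : ‖taylorError f a u - taylorError f b u‖ ≤ F * (‖a - b‖ * ‖u‖) * ‖u‖ := by
    have := (convex_closedBall (0 : W) ‖u‖).norm_image_sub_le_of_norm_hasFDerivWithin_le
      (f := fun z => taylorError f a z - taylorError f b z) (x := 0) (y := u)
      (C := F * (‖a - b‖ * ‖u‖))
      (fun z _ => ((hasFDerivAt_taylorError hf a z).sub
        (hasFDerivAt_taylorError hf b z)).hasFDerivWithinAt) (fun z hz => ?_)
      (by simp) (by simp)
    · simpa [taylorError] using this
    · refine (norm_second_difference_le hf' hF1 hF2 a b z z).trans ?_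
      rw [sub_self, norm_zero, zero_add]
      gcongr
      simpa using hz
  have h2 := norm_taylorError_sub_le hf hF0 (norm_sub_le_of_norm_fderiv_le hf' hF1) b u v
  calc _ = ‖(taylorError f a u - taylorError f b u)
          + (taylorError f b u - taylorError f b v)‖ := by
        congr 1; abel
    _ ≤ _ := norm_add_le _ _
    _ ≤ _ := add_le_add h1 h2
    _ = _ := by ring

end Smooth

/-! ### Estimates for controlled paths -/

theorem BOBound.of_le {V : Type*} [NormedAddCommGroup V] {γ β a T : ℝ} {q : ℝ≥0∞} (hβ : 0 < β)
    {ξ : ℝ → ℝ → ℝ} (h : BOBound γ β q T ξ a) {Ξ : ℝ → ℝ → V}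
    (hc : ContinuousOn (fun p : ℝ × ℝ => Ξ p.1 p.2) (simplex T))
    (hΞ : ∀ s t, 0 ≤ s → s ≤ t → t ≤ T → ‖Ξ s t‖ ≤ ξ s t) :
    BOBound γ β q T (fun s t => ‖Ξ s t‖) a :=
  ⟨h.bound_nonneg, hc.norm, fun _ _ _ _ _ => norm_nonneg _,
    h.boNorm₂_le hβ fun s t h0 hst ht => by rw [norm_norm]; exact hΞ s t h0 hst ht⟩

theorem PathBound.mono {V : Type*} [NormedAddCommGroup V] {α β a b T : ℝ} {q : ℝ≥0∞} {g : ℝ → V}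
    (h : PathBound α β q T g a) (hab : a ≤ b) : PathBound α β q T g b :=
  ⟨h.1, h.2.mono hab⟩

theorem PathBound.boSeminorm_le {V : Type*} [NormedAddCommGroup V] {α β a T : ℝ} {q : ℝ≥0∞}
    (hβ : 0 < β) {g : ℝ → V} (h : PathBound α β q T g a) :
    boSeminorm α β q T g ≤ ENNReal.ofReal a :=
  h.2.boNorm₂_le hβ fun _ _ _ _ _ => le_rfl

theorem PathBound.zero {V : Type*} [NormedAddCommGroup V] {α β T : ℝ} {q : ℝ≥0∞} (hβ : 0 < β) :
    PathBound α β q T (fun _ => (0 : V)) 0 := by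
  refine ⟨continuousOn_const, le_rfl, by simpa using continuousOn_const,
    fun _ _ _ _ _ => norm_nonneg _, ?_⟩
  have : boNorm₂ α β q T (fun _ _ => (0 : ℝ)) = 0 := by
    unfold boNorm₂ modulus
    simp [luxNorm_zero hβ]
  simp [this]

/-- The increments of a path whose remainder is known, for the difference of two pairs. -/
theorem exists_PathBound_sub {β : ℝ} (hβ : 0 < β) {q : ℝ≥0∞} (hq : 0 < q) {α : ℝ}
    (hα : 1 / 3 < α) {T₀ : ℝ} (hT₀ : 0 < T₀) : ∃ C : ℝ, 1 ≤ C ∧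
    ∀ (V W : Type) [NormedAddCommGroup V] [NormedSpace ℝ V] [NormedAddCommGroup W]
      [NormedSpace ℝ W] (T : ℝ) (X X₁ : ℝ → V) (Y Y₁ : ℝ → W) (Y' Y₁' : ℝ → V →L[ℝ] W)
      (x dx y₁' dy' dr : ℝ), 0 ≤ T → T ≤ T₀ →
      ContinuousOn Y (Icc 0 T) → ContinuousOn Y₁ (Icc 0 T) →
      PathBound α β q T X x → PathBound α β q T (fun t => X t - X₁ t) dx →
      PathBound α β q T Y₁' y₁' → PathBound α β q T (fun t => Y' t - Y₁' t) dy' →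
      BOBound (2 * α) (β / 2) (q / 2) T
        (fun s t => ‖remainder X Y Y' s t - remainder X₁ Y₁ Y₁' s t‖) dr →
      PathBound α β q T (fun t => Y t - Y₁ t)
        (C * ((‖Y' 0 - Y₁' 0‖ + dy') * x + (‖Y₁' 0‖ + y₁') * dx + dr)) := by
  obtain ⟨C, hC, hpath⟩ := exists_path_le hβ hq (by linarith : 1 / 8 < α) hT₀
  obtain ⟨E, hE, hrem⟩ := exists_BOBound_of_remainder hβ hq hα hT₀
  obtain ⟨K, hK, hadd⟩ := exists_BOBound_add hβ q
  have hκ : 0 ≤ α - 1 / 8 := by linarith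
  refine ⟨K * (K + E) * (C * C), ?_, ?_⟩
  · have : 1 ≤ K + E := by linarith
    exact one_le_mul_of_one_le_of_one_le (one_le_mul_of_one_le_of_one_le hK this)
      (one_le_mul_of_one_le_of_one_le hC hC)
  intro V W _ _ _ _ T X X₁ Y Y₁ Y' Y₁' x dx y₁' dy' dr hT0 hT hY hY₁ hX hdX hY₁' hdY' hdR
  obtain ⟨hXh, -⟩ := hpath V T X x hT hX
  obtain ⟨hdXh, -⟩ := hpath V T _ dx hT hdX
  obtain ⟨hY₁'h, hY₁'s⟩ := hpath _ T _ y₁' hT hY₁'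
  obtain ⟨hdY'h, hdY's⟩ := hpath _ T _ dy' hT hdY'
  have hx := hX.2.bound_nonneg
  have hdx := hdX.2.bound_nonneg
  have hy₁' := hY₁'.2.bound_nonneg
  have hdy' := hdY'.2.bound_nonneg
  have hdr := hdR.bound_nonneg
  have hR := hrem T _ dr (C * C * (dy' * x + y₁' * dx)) hT hdR (by positivity)
    (by simp [remainder]) (fun s u t hs hsu hut ht => by
      -- The additivity defect of a remainder is `(Y'_u - Y'_s)(X_t - X_u)`. The difference of two
      -- such products is split so that each part contains one difference of the pairs.
      have e : remainder X Y Y' s t - remainder X₁ Y₁ Y₁' s t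
          = (remainder X Y Y' s u - remainder X₁ Y₁ Y₁' s u)
            + (remainder X Y Y' u t - remainder X₁ Y₁ Y₁' u t)
            + (((Y' u - Y₁' u) - (Y' s - Y₁' s)) (X t - X u)
              + (Y₁' u - Y₁' s) ((X t - X₁ t) - (X u - X₁ u))) := by
        simp only [remainder, map_sub, FunLike.coe_sub, Pi.sub_apply]
        abel
      rw [e]
      refine (norm_add₃_le).trans (add_le_add_right ?_ _)
      have hus : 0 ≤ u - s := by linarith
      have htu : 0 ≤ t - u := by linarith
      have hts : 0 ≤ t - s := by linarith
      have p1 : (u - s) ^ (α - 1 / 8) ≤ (t - s) ^ (α - 1 / 8) := by gcongr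
      have p2 : (t - u) ^ (α - 1 / 8) ≤ (t - s) ^ (α - 1 / 8) := by gcongr
      have e2 : (t - s) ^ (2 * (α - 1 / 8)) = (t - s) ^ (α - 1 / 8) * (t - s) ^ (α - 1 / 8) := by
        rw [← Real.rpow_add_of_nonneg hts hκ hκ]
        congr 1
        ring
      set P := (t - s) ^ (α - 1 / 8)
      have hP : 0 ≤ P := Real.rpow_nonneg hts _
      have b1 := (hdY'h s u hs hsu (hut.trans ht)).trans
        (mul_le_mul_of_nonneg_left p1 (by positivity))
      have b2 := (hXh u t (hs.trans hsu) hut ht).trans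
        (mul_le_mul_of_nonneg_left p2 (by positivity))
      have b3 := (hY₁'h s u hs hsu (hut.trans ht)).trans
        (mul_le_mul_of_nonneg_left p1 (by positivity))
      have b4 := (hdXh u t (hs.trans hsu) hut ht).trans
        (mul_le_mul_of_nonneg_left p2 (by positivity))
      calc _ ≤ _ := norm_add_le _ _
        _ ≤ ‖(Y' u - Y₁' u) - (Y' s - Y₁' s)‖ * ‖X t - X u‖
            + ‖Y₁' u - Y₁' s‖ * ‖(X t - X₁ t) - (X u - X₁ u)‖ :=
          add_le_add (ContinuousLinearMap.le_opNorm _ _) (ContinuousLinearMap.le_opNorm _ _)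
        _ ≤ (C * dy' * P) * (C * x * P) + (C * y₁' * P) * (C * dx * P) := by gcongr
        _ = _ := by rw [e2]; ring)
  set p := C * (‖Y' 0 - Y₁' 0‖ + dy') with hp
  set p₁ := C * (‖Y₁' 0‖ + y₁') with hp₁
  have hp0 : 0 ≤ p := by positivity
  have hp₁0 : 0 ≤ p₁ := by positivity
  have hsum := hadd α T _ _ _ _ (hadd α T _ _ _ _ (hX.2.const_mul hβ hp0)
    (hdX.2.const_mul hβ hp₁0)) hR
  refine ⟨hY.sub hY₁, (hsum.of_le hβ (continuousOn_increment (hY.sub hY₁)) ?_).mono ?_⟩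
  · intro s t hs hst ht
    have e : (Y t - Y₁ t) - (Y s - Y₁ s) = (Y' s - Y₁' s) (X t - X s)
        + Y₁' s ((X t - X₁ t) - (X s - X₁ s))
        + (remainder X Y Y' s t - remainder X₁ Y₁ Y₁' s t) := by
      simp only [remainder, map_sub, FunLike.coe_sub, Pi.sub_apply]
      abel
    rw [e]
    refine norm_add₃_le.trans ?_
    gcongr
    · exact (ContinuousLinearMap.le_opNorm _ _).trans
        (mul_le_mul_of_nonneg_right (hdY's s hs (hst.trans ht)) (norm_nonneg _))
    · exact (ContinuousLinearMap.le_opNorm _ _).trans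
        (mul_le_mul_of_nonneg_right (hY₁'s s hs (hst.trans ht)) (norm_nonneg _))
  · set a := (‖Y' 0 - Y₁' 0‖ + dy') * x + (‖Y₁' 0‖ + y₁') * dx with ha
    have ha0 : 0 ≤ a := by positivity
    have h1 : p * x + p₁ * dx = C * a := by rw [hp, hp₁, ha]; ring
    have h2 : dy' * x + y₁' * dx ≤ a := by
      have : 0 ≤ ‖Y' 0 - Y₁' 0‖ * x := by positivity
      have : 0 ≤ ‖Y₁' 0‖ * dx := by positivity
      rw [ha]; linarith
    have h3 : C ≤ C * C := le_mul_of_one_le_left (by linarith) hC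
    have h4 : 1 ≤ C * C := one_le_mul_of_one_le_of_one_le hC hC
    calc K * (K * (p * x + p₁ * dx) + E * (dr + C * C * (dy' * x + y₁' * dx)))
        ≤ K * (K * (C * C * a) + E * (C * C * dr + C * C * a)) := by
          rw [h1]
          gcongr
          exact le_mul_of_one_le_left hdr h4
      _ ≤ K * (K * (C * C * (a + dr)) + E * (C * C * dr + C * C * a)) := by
          gcongr
          linarith
      _ = _ := by ring

/-- The increments of a controlled path. -/
theorem exists_PathBound_controlled {β : ℝ} (hβ : 0 < β) {q : ℝ≥0∞} (hq : 0 < q) {α : ℝ}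
    (hα : 1 / 3 < α) {T₀ : ℝ} (hT₀ : 0 < T₀) : ∃ C : ℝ, 1 ≤ C ∧
    ∀ (V W : Type) [NormedAddCommGroup V] [NormedSpace ℝ V] [NormedAddCommGroup W]
      [NormedSpace ℝ W] (T : ℝ) (X : ℝ → V) (Y : ℝ → W) (Y' : ℝ → V →L[ℝ] W)
      (x y' r : ℝ), 0 ≤ T → T ≤ T₀ → ContinuousOn Y (Icc 0 T) →
      PathBound α β q T X x → PathBound α β q T Y' y' →
      BOBound (2 * α) (β / 2) (q / 2) T (fun s t => ‖remainder X Y Y' s t‖) r →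
      PathBound α β q T Y (C * ((‖Y' 0‖ + y' + r) * (1 + x))) := by
  obtain ⟨C, hC, h⟩ := exists_PathBound_sub hβ hq hα hT₀
  refine ⟨C, hC, fun V W _ _ _ _ T X Y Y' x y' r hT0 hT hY hX hY' hR => ?_⟩
  -- The comparison pair is zero, driven by the zero path; the distance of the drivers is then `x`
  -- itself.
  have := h V W T X (fun _ => 0) Y (fun _ => 0) Y' (fun _ => 0) x x 0 y' r hT0 hT hY
    continuousOn_const hX (by simpa using hX) (PathBound.zero hβ) (by simpa using hY')
    (by simpa [remainder] using hR)
  simp only [sub_zero, norm_zero, add_zero, zero_mul] at this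
  refine this.mono ?_
  have hx := hX.2.bound_nonneg
  have hy' := hY'.2.bound_nonneg
  have hr := hR.bound_nonneg
  gcongr
  have : 0 ≤ ‖Y' 0‖ + y' + r * x := by positivity
  linarith

/-! ### Composition with smooth functions -/

section Pointwise

variable {V W U : Type*} [NormedAddCommGroup V] [NormedSpace ℝ V] [NormedAddCommGroup W]
  [NormedSpace ℝ W] [NormedAddCommGroup U] [NormedSpace ℝ U]

/-- Since `Y'_s δX = δY - R^Y`, the first-order term `Df(Y_s) Y'_s δX` differs from the linear part
of the Taylor expansion by exactly `Df(Y_s) R^Y`. -/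
theorem remainder_comp (f : W → U) (X : ℝ → V) (Y : ℝ → W) (Y' : ℝ → V →L[ℝ] W) (s t : ℝ) :
    remainder X (fun r => f (Y r)) (compDeriv f Y Y') s t
      = taylorError f (Y s) (Y t - Y s) + fderiv ℝ f (Y s) (remainder X Y Y' s t) := by
  simp only [remainder, taylorError, compDeriv, ContinuousLinearMap.comp_apply, map_sub,
    add_sub_cancel]
  abel

theorem continuousOn_compDeriv {f : W → U} (hf : Continuous (fderiv ℝ f)) {Y : ℝ → W}
    {Y' : ℝ → V →L[ℝ] W} {D : Set ℝ} (hY : ContinuousOn Y D) (hY' : ContinuousOn Y' D) :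
    ContinuousOn (compDeriv f Y Y') D :=
  (hf.comp_continuousOn hY).clm_comp hY'

theorem norm_compDeriv_sub_le {f : W → U} {F : ℝ} (hF1 : ∀ x, ‖fderiv ℝ f x‖ ≤ F)
    (hF2 : ∀ a b, ‖fderiv ℝ f b - fderiv ℝ f a‖ ≤ F * ‖b - a‖) (Y : ℝ → W)
    (Y' : ℝ → V →L[ℝ] W) (s t : ℝ) :
    ‖compDeriv f Y Y' t - compDeriv f Y Y' s‖
      ≤ F * ‖Y' t‖ * ‖Y t - Y s‖ + F * ‖Y' t - Y' s‖ := by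
  have e : compDeriv f Y Y' t - compDeriv f Y Y' s
      = (fderiv ℝ f (Y t) - fderiv ℝ f (Y s)).comp (Y' t)
        + (fderiv ℝ f (Y s)).comp (Y' t - Y' s) := by
    simp only [compDeriv, ContinuousLinearMap.sub_comp, ContinuousLinearMap.comp_sub]
    abel
  rw [e]
  calc _ ≤ _ := norm_add_le _ _
    _ ≤ ‖fderiv ℝ f (Y t) - fderiv ℝ f (Y s)‖ * ‖Y' t‖ + ‖fderiv ℝ f (Y s)‖ * ‖Y' t - Y' s‖ :=
      add_le_add (ContinuousLinearMap.opNorm_comp_le _ _)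
        (ContinuousLinearMap.opNorm_comp_le _ _)
    _ ≤ (F * ‖Y t - Y s‖) * ‖Y' t‖ + F * ‖Y' t - Y' s‖ := by
      gcongr
      · exact hF2 _ _
      · exact hF1 _
    _ = _ := by ring

theorem norm_compDeriv_sub_compDeriv_le {f : W → U} {F : ℝ} (hf' : Differentiable ℝ (fderiv ℝ f))
    (hF1 : ∀ x, ‖fderiv ℝ f x‖ ≤ F) (hF2 : ∀ x, ‖fderiv ℝ (fderiv ℝ f) x‖ ≤ F)
    (hF3 : ∀ a b, ‖fderiv ℝ (fderiv ℝ f) b - fderiv ℝ (fderiv ℝ f) a‖ ≤ F * ‖b - a‖)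
    (Y Y₁ : ℝ → W) (Y' Y₁' : ℝ → V →L[ℝ] W) (s t : ℝ) :
    ‖(compDeriv f Y Y' t - compDeriv f Y₁ Y₁' t) - (compDeriv f Y Y' s - compDeriv f Y₁ Y₁' s)‖
      ≤ F * ‖Y' t‖ * ‖(Y t - Y₁ t) - (Y s - Y₁ s)‖ + F * ‖Y' t‖ * ‖Y s - Y₁ s‖ * ‖Y t - Y s‖
        + F * ‖Y' t - Y₁' t‖ * ‖Y₁ t - Y₁ s‖ + F * ‖Y s - Y₁ s‖ * ‖Y' t - Y' s‖
        + F * ‖(Y' t - Y₁' t) - (Y' s - Y₁' s)‖ := by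
  set G := fderiv ℝ f with hG
  -- A product rule in two variables, the time and the pair: each summand carries both a time
  -- increment and a difference of the two pairs.
  have e : (compDeriv f Y Y' t - compDeriv f Y₁ Y₁' t)
        - (compDeriv f Y Y' s - compDeriv f Y₁ Y₁' s)
      = ((G (Y t) - G (Y s)) - (G (Y₁ t) - G (Y₁ s))).comp (Y' t)
        + (G (Y₁ t) - G (Y₁ s)).comp (Y' t - Y₁' t)
        + (G (Y s) - G (Y₁ s)).comp (Y' t - Y' s)
        + (G (Y₁ s)).comp ((Y' t - Y₁' t) - (Y' s - Y₁' s)) := by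
    simp only [compDeriv, ← hG, ContinuousLinearMap.sub_comp, ContinuousLinearMap.comp_sub]
    abel
  have h1 : ‖(G (Y t) - G (Y s)) - (G (Y₁ t) - G (Y₁ s))‖
      ≤ F * (‖(Y t - Y₁ t) - (Y s - Y₁ s)‖ + ‖Y s - Y₁ s‖ * ‖Y t - Y s‖) := by
    have := norm_second_difference_le hf' hF2 hF3 (Y s) (Y₁ s) (Y t - Y s) (Y₁ t - Y₁ s)
    rw [add_sub_cancel, add_sub_cancel] at this
    convert this using 4
    abel
  have hL := norm_sub_le_of_norm_fderiv_le hf' hF2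
  rw [e]
  calc _ ≤ _ := norm_add₄_le
    _ ≤ ‖(G (Y t) - G (Y s)) - (G (Y₁ t) - G (Y₁ s))‖ * ‖Y' t‖
        + ‖G (Y₁ t) - G (Y₁ s)‖ * ‖Y' t - Y₁' t‖
        + ‖G (Y s) - G (Y₁ s)‖ * ‖Y' t - Y' s‖
        + ‖G (Y₁ s)‖ * ‖(Y' t - Y₁' t) - (Y' s - Y₁' s)‖ := by
      gcongr <;> exact ContinuousLinearMap.opNorm_comp_le _ _
    _ ≤ (F * (‖(Y t - Y₁ t) - (Y s - Y₁ s)‖ + ‖Y s - Y₁ s‖ * ‖Y t - Y s‖)) * ‖Y' t‖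
        + (F * ‖Y₁ t - Y₁ s‖) * ‖Y' t - Y₁' t‖
        + (F * ‖Y s - Y₁ s‖) * ‖Y' t - Y' s‖
        + F * ‖(Y' t - Y₁' t) - (Y' s - Y₁' s)‖ := by
      gcongr
      · exact hL _ _
      · exact hL _ _
      · exact hF1 _
    _ = _ := by ring

theorem norm_remainder_comp_sub_le {f : W → U} {F : ℝ} (hf : Differentiable ℝ f)
    (hf' : Differentiable ℝ (fderiv ℝ f)) (hF0 : 0 ≤ F)
    (hF1 : ∀ x, ‖fderiv ℝ f x‖ ≤ F) (hF2 : ∀ x, ‖fderiv ℝ (fderiv ℝ f) x‖ ≤ F)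
    (hF3 : ∀ a b, ‖fderiv ℝ (fderiv ℝ f) b - fderiv ℝ (fderiv ℝ f) a‖ ≤ F * ‖b - a‖)
    (X X₁ : ℝ → V) (Y Y₁ : ℝ → W) (Y' Y₁' : ℝ → V →L[ℝ] W) (s t : ℝ) :
    ‖remainder X (fun r => f (Y r)) (compDeriv f Y Y') s t
        - remainder X₁ (fun r => f (Y₁ r)) (compDeriv f Y₁ Y₁') s t‖
      ≤ F * ‖Y s - Y₁ s‖ * (‖Y t - Y s‖ * ‖Y t - Y s‖)
        + F * (‖Y t - Y s‖ * ‖(Y t - Y₁ t) - (Y s - Y₁ s)‖)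
        + F * (‖Y₁ t - Y₁ s‖ * ‖(Y t - Y₁ t) - (Y s - Y₁ s)‖)
        + F * ‖Y s - Y₁ s‖ * ‖remainder X Y Y' s t‖
        + F * ‖remainder X Y Y' s t - remainder X₁ Y₁ Y₁' s t‖ := by
  set R := remainder X Y Y' s t
  set R₁ := remainder X₁ Y₁ Y₁' s t
  have h1 := norm_taylorError_sub_taylorError_le hf hf' hF0 hF2 hF3 (Y s) (Y₁ s) (Y t - Y s)
    (Y₁ t - Y₁ s)
  have e1 : (Y t - Y s) - (Y₁ t - Y₁ s) = (Y t - Y₁ t) - (Y s - Y₁ s) := by abel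
  rw [e1] at h1
  have e : remainder X (fun r => f (Y r)) (compDeriv f Y Y') s t
        - remainder X₁ (fun r => f (Y₁ r)) (compDeriv f Y₁ Y₁') s t
      = (taylorError f (Y s) (Y t - Y s) - taylorError f (Y₁ s) (Y₁ t - Y₁ s))
        + (fderiv ℝ f (Y s) - fderiv ℝ f (Y₁ s)) R + fderiv ℝ f (Y₁ s) (R - R₁) := by
    rw [remainder_comp, remainder_comp]
    simp only [map_sub, FunLike.coe_sub, Pi.sub_apply]
    abel
  rw [e]
  calc _ ≤ _ := norm_add₃_le
    _ ≤ F * (‖Y s - Y₁ s‖ * (‖Y t - Y s‖ * ‖Y t - Y s‖) + (‖Y t - Y s‖ + ‖Y₁ t - Y₁ s‖)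
          * ‖(Y t - Y₁ t) - (Y s - Y₁ s)‖)
        + (F * ‖Y s - Y₁ s‖) * ‖R‖ + F * ‖R - R₁‖ := by
      gcongr
      · exact (ContinuousLinearMap.le_opNorm _ _).trans (mul_le_mul_of_nonneg_right
          (norm_sub_le_of_norm_fderiv_le hf' hF2 _ _) (norm_nonneg _))
      · exact (ContinuousLinearMap.le_opNorm _ _).trans
          (mul_le_mul_of_nonneg_right (hF1 _) (norm_nonneg _))
    _ = _ := by ring

end Pointwise

/-- The composition estimate in terms of real bounds. -/
theorem exists_comp_bound {β : ℝ} (hβ : 0 < β) {q : ℝ≥0∞} (hq : 0 < q) {α : ℝ}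
    (hα : 1 / 3 < α) {T₀ : ℝ} (hT₀ : 0 < T₀) : ∃ C : ℝ, 1 ≤ C ∧
    ∀ (V W U : Type) [NormedAddCommGroup V] [NormedSpace ℝ V] [NormedAddCommGroup W]
      [NormedSpace ℝ W] [NormedAddCommGroup U] [NormedSpace ℝ U]
      (T : ℝ) (X : ℝ → V) (Y : ℝ → W) (Y' : ℝ → V →L[ℝ] W) (f : W → U)
      (x y' r F : ℝ), 0 ≤ T → T ≤ T₀ → ContinuousOn Y (Icc 0 T) →
      PathBound α β q T X x → PathBound α β q T Y' y' →
      BOBound (2 * α) (β / 2) (q / 2) T (fun s t => ‖remainder X Y Y' s t‖) r →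
      Differentiable ℝ f → Continuous (fderiv ℝ f) → 0 ≤ F → (∀ x, ‖fderiv ℝ f x‖ ≤ F) →
      (∀ a b, ‖fderiv ℝ f b - fderiv ℝ f a‖ ≤ F * ‖b - a‖) →
      PathBound α β q T (compDeriv f Y Y')
        (C * F * (1 + x) * max (‖Y' 0‖ + y' + r) ((‖Y' 0‖ + y' + r) ^ 2)) ∧
      BOBound (2 * α) (β / 2) (q / 2) T
        (fun s t => ‖remainder X (fun r => f (Y r)) (compDeriv f Y Y') s t‖)
        (C * F * (1 + x) ^ 2 * max (‖Y' 0‖ + y' + r) ((‖Y' 0‖ + y' + r) ^ 2)) := by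
  have hβ2 : 0 < β / 2 := by positivity
  obtain ⟨C₁, hC₁, hpath⟩ := exists_path_le hβ hq (by linarith : 1 / 8 < α) hT₀
  obtain ⟨C₂, hC₂, hcon⟩ := exists_PathBound_controlled hβ hq hα hT₀
  obtain ⟨K, hK, hadd⟩ := exists_BOBound_add hβ q
  obtain ⟨K₂, hK₂, hadd₂⟩ := exists_BOBound_add hβ2 (q / 2)
  obtain ⟨K₃, hK₃, hmul⟩ := exists_BOBound_mul hβ hq
  set Ca := K * (C₁ * C₂ + 1)
  set Cb := K₂ * (K₃ * (C₂ * C₂) + 1)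
  have hCa : 1 ≤ Ca := one_le_mul_of_one_le_of_one_le hK (by nlinarith)
  refine ⟨max Ca Cb, hCa.trans (le_max_left _ _), ?_⟩
  intro V W U _ _ _ _ _ _ T X Y Y' f x y' r F hT0 hT hY hX hY' hR hf hfc hF0 hF1 hF2
  have hx := hX.2.bound_nonneg
  have hy' := hY'.2.bound_nonneg
  have hr := hR.bound_nonneg
  have hYb := hcon V W T X Y Y' x y' r hT0 hT hY hX hY' hR
  obtain ⟨-, hY's⟩ := hpath _ T Y' y' hT hY'
  set A := ‖Y' 0‖ + y' + r with hA
  have hA0 : 0 ≤ A := by positivity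
  -- Terms containing `Y' δY` or `δY δY` are quadratic in `A`, those containing `δY'` or `R^Y` alone
  -- are linear.
  set m := max A (A ^ 2)
  have hm1 : A ≤ m := le_max_left _ _
  have hm2 : A * A ≤ m := by rw [← sq]; exact le_max_right _ _
  have hm0 : 0 ≤ m := hA0.trans hm1
  have hyA : y' ≤ A := by rw [hA]; linarith [norm_nonneg (Y' 0)]
  have hrA : r ≤ A := by rw [hA]; linarith [norm_nonneg (Y' 0)]
  have hx1 : 1 ≤ 1 + x := by linarith
  have hcc := continuousOn_compDeriv hfc hY hY'.1
  constructor
  · have h := hadd α T _ _ _ _ (hYb.2.const_mul hβ (c := F * (C₁ * A)) (by positivity))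
      (hY'.2.const_mul hβ hF0)
    refine ⟨hcc, (h.of_le hβ (continuousOn_increment hcc) fun s t hs hst ht => ?_).mono ?_⟩
    · refine (norm_compDeriv_sub_le hF1 hF2 Y Y' s t).trans ?_
      gcongr
      refine (hY's t (hs.trans hst) ht).trans ?_
      gcongr
      rw [hA]; linarith
    · calc K * (F * (C₁ * A) * (C₂ * (A * (1 + x))) + F * y')
          = K * (C₁ * C₂ * F * (1 + x) * (A * A) + F * 1 * y') := by ring
        _ ≤ K * (C₁ * C₂ * F * (1 + x) * m + F * (1 + x) * m) := by
          gcongr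
          exact hyA.trans hm1
        _ = Ca * F * (1 + x) * m := by ring
        _ ≤ _ := by gcongr; exact le_max_left _ _
  · have hfY : ContinuousOn (fun t => f (Y t)) (Icc 0 T) := hf.continuous.comp_continuousOn hY
    have h := hadd₂ (2 * α) T _ _ _ _
      ((hmul α T _ _ _ _ (by linarith) hYb.2 hYb.2).const_mul hβ2 hF0) (hR.const_mul hβ2 hF0)
    refine (h.of_le hβ2 (continuousOn_remainder hX.1 hfY hcc) fun s t hs hst ht => ?_).mono ?_
    · rw [remainder_comp]
      refine (norm_add_le _ _).trans (add_le_add (norm_taylorError_le hf hF0 hF2 _ _) ?_)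
      exact (ContinuousLinearMap.le_opNorm _ _).trans
        (mul_le_mul_of_nonneg_right (hF1 _) (norm_nonneg _))
    · calc K₂ * (F * (K₃ * (C₂ * (A * (1 + x)) * (C₂ * (A * (1 + x))))) + F * r)
          = K₂ * (K₃ * (C₂ * C₂) * F * (1 + x) ^ 2 * (A * A) + F * 1 * r) := by ring
        _ ≤ K₂ * (K₃ * (C₂ * C₂) * F * (1 + x) ^ 2 * m + F * (1 + x) ^ 2 * m) := by
          gcongr
          · exact one_le_pow₀ hx1
          · exact hrA.trans hm1
        _ = Cb * F * (1 + x) ^ 2 * m := by ring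
        _ ≤ _ := by gcongr; exact le_max_right _ _

theorem exists_BOBound_add₅ {β : ℝ} (hβ : 0 < β) (q : ℝ≥0∞) : ∃ C : ℝ, 1 ≤ C ∧
    ∀ (γ T : ℝ) (ξ₁ ξ₂ ξ₃ ξ₄ ξ₅ : ℝ → ℝ → ℝ) (a : ℝ), BOBound γ β q T ξ₁ a →
      BOBound γ β q T ξ₂ a → BOBound γ β q T ξ₃ a → BOBound γ β q T ξ₄ a →
      BOBound γ β q T ξ₅ a →
      BOBound γ β q T (fun s t => ξ₁ s t + ξ₂ s t + ξ₃ s t + ξ₄ s t + ξ₅ s t) (C * a) := by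
  obtain ⟨K, hK, hadd⟩ := exists_BOBound_add hβ q
  have hK0 : 0 ≤ K := by linarith
  refine ⟨K * (K * (K * (K * 2 + 1) + 1) + 1),
    one_le_mul_of_one_le_of_one_le hK (le_add_of_nonneg_left (by positivity)), ?_⟩
  intro γ T ξ₁ ξ₂ ξ₃ ξ₄ ξ₅ a h₁ h₂ h₃ h₄ h₅
  exact (hadd _ _ _ _ _ _ (hadd _ _ _ _ _ _ (hadd _ _ _ _ _ _ (hadd _ _ _ _ _ _ h₁ h₂) h₃) h₄)
    h₅).mono (le_of_eq (by ring))

/-- The stability estimate in terms of real bounds: `B` bounds the data, `d` the differences. -/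
theorem exists_comp_sub_bound {β : ℝ} (hβ : 0 < β) {q : ℝ≥0∞} (hq : 0 < q) {α : ℝ}
    (hα : 0 ≤ α) : ∃ C : ℝ, 1 ≤ C ∧
    ∀ (V W U : Type) [NormedAddCommGroup V] [NormedSpace ℝ V] [NormedAddCommGroup W]
      [NormedSpace ℝ W] [NormedAddCommGroup U] [NormedSpace ℝ U]
      (T : ℝ) (X X₁ : ℝ → V) (Y Y₁ : ℝ → W) (Y' Y₁' : ℝ → V →L[ℝ] W) (f : W → U)
      (B d F : ℝ), 1 ≤ B → 0 ≤ d → ContinuousOn X (Icc 0 T) → ContinuousOn X₁ (Icc 0 T) →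
      ContinuousOn Y₁' (Icc 0 T) →
      PathBound α β q T Y B → PathBound α β q T Y₁ B → PathBound α β q T Y' B →
      PathBound α β q T (fun t => Y t - Y₁ t) d → PathBound α β q T (fun t => Y' t - Y₁' t) d →
      BOBound (2 * α) (β / 2) (q / 2) T (fun s t => ‖remainder X Y Y' s t‖) B →
      BOBound (2 * α) (β / 2) (q / 2) T
        (fun s t => ‖remainder X Y Y' s t - remainder X₁ Y₁ Y₁' s t‖) d →
      (∀ t, 0 ≤ t → t ≤ T → ‖Y' t‖ ≤ B) → (∀ t, 0 ≤ t → t ≤ T → ‖Y t - Y₁ t‖ ≤ d) →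
      (∀ t, 0 ≤ t → t ≤ T → ‖Y' t - Y₁' t‖ ≤ d) →
      Differentiable ℝ f → Differentiable ℝ (fderiv ℝ f) → 0 ≤ F → (∀ x, ‖fderiv ℝ f x‖ ≤ F) →
      (∀ x, ‖fderiv ℝ (fderiv ℝ f) x‖ ≤ F) →
      (∀ a b, ‖fderiv ℝ (fderiv ℝ f) b - fderiv ℝ (fderiv ℝ f) a‖ ≤ F * ‖b - a‖) →
      PathBound α β q T (fun t => compDeriv f Y Y' t - compDeriv f Y₁ Y₁' t)
        (C * (F * (B ^ 2 * d))) ∧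
      BOBound (2 * α) (β / 2) (q / 2) T
        (fun s t => ‖remainder X (fun r => f (Y r)) (compDeriv f Y Y') s t
          - remainder X₁ (fun r => f (Y₁ r)) (compDeriv f Y₁ Y₁') s t‖)
        (C * (F * (B ^ 2 * d))) := by
  have hβ2 : 0 < β / 2 := by positivity
  obtain ⟨K, hK, hadd⟩ := exists_BOBound_add₅ hβ q
  obtain ⟨K₂, hK₂, hadd₂⟩ := exists_BOBound_add₅ hβ2 (q / 2)
  obtain ⟨K₃, hK₃, hmul⟩ := exists_BOBound_mul hβ hq
  refine ⟨max K (K₂ * K₃), hK.trans (le_max_left _ _), ?_⟩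
  intro V W U _ _ _ _ _ _ T X X₁ Y Y₁ Y' Y₁' f B d F hB hd hXc hX₁c hY₁'c hY hY₁ hY' hdY hdY' hR
    hdR hY's hdYs hdY's hf hf' hF0 hF1 hF2 hF3
  have hc := continuousOn_compDeriv hf'.continuous hY.1 hY'.1
  have hc₁ := continuousOn_compDeriv hf'.continuous hY₁.1 hY₁'c
  have hFd : 0 ≤ F * d := by positivity
  -- As `B ≥ 1`, terms of degree zero, one and two in the data all fit under `B ^ 2`, so the five
  -- summands share one bound.
  have b1 : F * d ≤ F * (B ^ 2 * d) := by
    gcongr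
    exact le_mul_of_one_le_left hd (one_le_pow₀ hB)
  have b2 : F * (B * d) ≤ F * (B ^ 2 * d) := by
    gcongr
    exact le_self_pow₀ hB (by norm_num)
  constructor
  · have h := hadd α T _ _ _ _ _ (F * (B ^ 2 * d))
      ((hdY.2.const_mul hβ (c := F * B) (by positivity)).mono (by linarith))
      ((hY.2.const_mul hβ (c := F * B * d) (by positivity)).mono (le_of_eq (by ring)))
      ((hY₁.2.const_mul hβ (c := F * d) (by positivity)).mono (by linarith))
      ((hY'.2.const_mul hβ (c := F * d) (by positivity)).mono (by linarith))
      ((hdY'.2.const_mul hβ (c := F) (by positivity)).mono (by linarith))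
    refine ⟨hc.sub hc₁, (h.of_le hβ (continuousOn_increment (hc.sub hc₁))
      fun s t hs hst ht => ?_).mono (by gcongr; exact le_max_left _ _)⟩
    refine (norm_compDeriv_sub_compDeriv_le hf' hF1 hF2 hF3 Y Y₁ Y' Y₁' s t).trans ?_
    have p1 := hY's t (hs.trans hst) ht
    have p2 := hdYs s hs (hst.trans ht)
    have p3 := hdY's t (hs.trans hst) ht
    gcongr
  · have c1 : F * d ≤ K₃ * (F * (B ^ 2 * d)) :=
      b1.trans (le_mul_of_one_le_left (by positivity) hK₃)
    have c2 : F * (B * d) ≤ K₃ * (F * (B ^ 2 * d)) :=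
      b2.trans (le_mul_of_one_le_left (by positivity) hK₃)
    have c3 := mul_le_mul_of_nonneg_left b2 (by linarith : 0 ≤ K₃)
    have h := hadd₂ (2 * α) T _ _ _ _ _ (K₃ * (F * (B ^ 2 * d)))
      (((hmul α T _ _ _ _ hα hY.2 hY.2).const_mul hβ2 (c := F * d) (by positivity)).mono
        (le_of_eq (by ring)))
      (((hmul α T _ _ _ _ hα hY.2 hdY.2).const_mul hβ2 (c := F) (by positivity)).mono
        (by linarith))
      (((hmul α T _ _ _ _ hα hY₁.2 hdY.2).const_mul hβ2 (c := F) (by positivity)).mono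
        (by linarith))
      ((hR.const_mul hβ2 (c := F * d) (by positivity)).mono (by linarith))
      ((hdR.const_mul hβ2 (c := F) (by positivity)).mono (by linarith))
    have hfY : ContinuousOn (fun t => f (Y t)) (Icc 0 T) := hf.continuous.comp_continuousOn hY.1
    have hfY₁ : ContinuousOn (fun t => f (Y₁ t)) (Icc 0 T) :=
      hf.continuous.comp_continuousOn hY₁.1
    refine (h.of_le hβ2 ((continuousOn_remainder hXc hfY hc).sub
      (continuousOn_remainder hX₁c hfY₁ hc₁)) fun s t hs hst ht => ?_).mono ?_
    · refine (norm_remainder_comp_sub_le hf hf' hF0 hF1 hF2 hF3 X X₁ Y Y₁ Y' Y₁' s t).trans ?_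
      have p2 := hdYs s hs (hst.trans ht)
      gcongr
    · rw [← mul_assoc]
      gcongr
      exact le_max_right _ _

/-! ### Estimates in terms of the seminorms -/

section Final

variable {V W U : Type} [NormedAddCommGroup V] [NormedSpace ℝ V] [NormedAddCommGroup W]
  [NormedSpace ℝ W] [NormedAddCommGroup U] [NormedSpace ℝ U]

theorem memOrlicz_of_continuousOn {V : Type*} [NormedAddCommGroup V] {β T : ℝ} (hβ : 0 < β)
    {g : ℝ → V} (hg : ContinuousOn g (Icc 0 T)) : MemOrlicz β (Icc 0 T) g := by
  refine ⟨hg.aestronglyMeasurable measurableSet_Icc, 1, one_pos, ?_⟩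
  obtain ⟨S, hS⟩ := isCompact_Icc.exists_bound_of_continuousOn hg
  calc ∫⁻ r in Icc 0 T, ENNReal.ofReal (Phi β (‖g r‖ / 1))
      ≤ ∫⁻ r in Icc 0 T, ENNReal.ofReal (Phi β S) := by
        refine setLIntegral_mono' measurableSet_Icc fun r hr => ENNReal.ofReal_le_ofReal ?_
        rw [div_one]
        exact Phi_mono hβ (norm_nonneg _) (hS r hr)
    _ < ∞ := by
        rw [setLIntegral_const, Real.volume_Icc]
        exact ENNReal.mul_lt_top ENNReal.ofReal_lt_top ENNReal.ofReal_lt_top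

theorem memBO₂_of_continuousOn {V : Type*} [NormedAddCommGroup V] {γ β T : ℝ} {q : ℝ≥0∞}
    {Ξ : ℝ → ℝ → V} (hc : ContinuousOn (fun p : ℝ × ℝ => Ξ p.1 p.2) (simplex T))
    (h : boNorm₂ γ β q T Ξ < ∞) : MemBO₂ γ β q T Ξ := by
  have hm : MeasurableSet (simplex T) := by
    refine MeasurableSet.inter (measurableSet_le measurable_const measurable_fst)
      (MeasurableSet.inter (measurableSet_le measurable_fst measurable_snd)
        (measurableSet_le measurable_snd measurable_const))
  exact ⟨hc.aestronglyMeasurable hm, fun u hu =>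
    (continuousOn_slice hu.1 hc).aestronglyMeasurable measurableSet_Icc, h⟩

theorem boSeminorm_comp_le {α β T : ℝ} {q : ℝ≥0∞} (hβ : 0 < β) {f : W → U} (Y : ℝ → W)
    (hf : Differentiable ℝ f) (hS : (⨆ x, ‖fderiv ℝ f x‖ₑ) ≠ ∞) :
    boSeminorm α β q T (fun t => f (Y t)) ≤ (⨆ x, ‖fderiv ℝ f x‖ₑ) * boSeminorm α β q T Y := by
  have h := boNorm₂_le_mul (γ := α) (q := q) (T := T) (Ξ := fun s t => f (Y t) - f (Y s))
    (Ξ₁ := fun s t => Y t - Y s) hβ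
    (ENNReal.toReal_nonneg (a := ⨆ x, ‖fderiv ℝ f x‖ₑ)) fun s t _ _ _ =>
      norm_sub_le_of_norm_fderiv_le hf (fun x => by
        rw [← toReal_enorm]
        exact ENNReal.toReal_mono hS (le_iSup (fun x => ‖fderiv ℝ f x‖ₑ) x)) _ _
  rwa [ENNReal.ofReal_toReal hS] at h

/-- Composition of a controlled path with a `C²_b` function, on bounded time intervals. -/
theorem exists_controlled_comp {β : ℝ} (hβ : 0 < β) {q : ℝ≥0∞} (hq : 0 < q) {α : ℝ}
    (hα : 1 / 3 < α) {T₀ : ℝ} (hT₀ : 0 < T₀) : ∃ C : ℝ≥0,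
    ∀ (V W U : Type) [NormedAddCommGroup V] [NormedSpace ℝ V] [NormedAddCommGroup W]
      [NormedSpace ℝ W] [NormedAddCommGroup U] [NormedSpace ℝ U]
      (T : ℝ) (X : ℝ → V) (Y : ℝ → W) (Y' : ℝ → V →L[ℝ] W) (f : W → U), 0 < T → T ≤ T₀ →
      MemBO α β q T X → IsControlled α β q T X Y Y' → MemCb 2 f →
        IsControlled α β q T X (fun t => f (Y t)) (compDeriv f Y Y') ∧
        boSeminorm α β q T (fun t => f (Y t))
          ≤ (⨆ x, ‖fderiv ℝ f x‖ₑ) * boSeminorm α β q T Y ∧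
        boSeminorm α β q T (compDeriv f Y Y')
          ≤ C * cbNorm 2 f * (1 + boSeminorm α β q T X)
            * max (‖Y' 0‖ₑ + controlledSeminorm α β q T X Y Y')
                ((‖Y' 0‖ₑ + controlledSeminorm α β q T X Y Y') ^ 2) ∧
        controlledSeminorm α β q T X (fun t => f (Y t)) (compDeriv f Y Y')
          ≤ C * cbNorm 2 f * (1 + boSeminorm α β q T X) ^ 2
            * max (‖Y' 0‖ₑ + controlledSeminorm α β q T X Y Y')
                ((‖Y' 0‖ₑ + controlledSeminorm α β q T X Y Y') ^ 2) := by
  have hβ2 : 0 < β / 2 := by positivity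
  obtain ⟨C, hC, hcomp⟩ := exists_comp_bound hβ hq hα hT₀
  -- The factor `2` accounts for the controlled seminorm being the sum of the two bounds.
  refine ⟨(2 * C).toNNReal, ?_⟩
  intro V W U _ _ _ _ _ _ T X Y Y' f hT0 hT hX hY hf
  have hfd : Differentiable ℝ f := hf.1.differentiable (by norm_num)
  have hfd' := hf.differentiable_fderiv le_rfl
  have hF1 := hf.norm_fderiv_le (by norm_num)
  have hF2 := hf.norm_fderiv_sub_le le_rfl
  have hXb := PathBound.of_finite hβ hX.1 hX.2.2.ne
  have hY'b := PathBound.of_finite hβ hY.deriv.1 hY.deriv.2.2.ne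
  have hRb := BOBound.of_norm hβ2 (continuousOn_remainder hX.1 hY.path.1 hY.deriv.1)
    hY.rem.2.2.ne
  obtain ⟨h1, h2⟩ := hcomp V W U T X Y Y' f _ _ _ _ hT0.le hT hY.path.1 hXb hY'b hRb hfd
    hfd'.continuous ENNReal.toReal_nonneg hF1 hF2
  have hS : (⨆ x, ‖fderiv ℝ f x‖ₑ) ≠ ∞ := by
    refine ((iSup_le fun x => ?_).trans_lt (ENNReal.ofReal_lt_top (r := (cbNorm 2 f).toReal))).ne
    rw [← ofReal_norm]
    exact ENNReal.ofReal_le_ofReal (hF1 x)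
  have hfirst := boSeminorm_comp_le (α := α) (q := q) (T := T) hβ Y hfd hS
  set x := (boSeminorm α β q T X).toReal with hx
  set F := (cbNorm 2 f).toReal with hF
  set A := ‖Y' 0‖ + (boSeminorm α β q T Y').toReal
    + (boNorm₂ (2 * α) (β / 2) (q / 2) T (remainder X Y Y')).toReal with hA
  have hx0 : 0 ≤ x := ENNReal.toReal_nonneg
  have hF0 : 0 ≤ F := ENNReal.toReal_nonneg
  have hA0 : 0 ≤ A := add_nonneg (add_nonneg (norm_nonneg _) ENNReal.toReal_nonneg)
    ENNReal.toReal_nonneg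
  have eX : 1 + boSeminorm α β q T X = ENNReal.ofReal (1 + x) := by
    rw [ENNReal.ofReal_add zero_le_one hx0, ENNReal.ofReal_one, hx,
      ENNReal.ofReal_toReal hX.2.2.ne]
  have eF : cbNorm 2 f = ENNReal.ofReal F := (ENNReal.ofReal_toReal hf.2.ne).symm
  have eA : ‖Y' 0‖ₑ + controlledSeminorm α β q T X Y Y' = ENNReal.ofReal A := by
    rw [hA, ENNReal.ofReal_add (add_nonneg (norm_nonneg _) ENNReal.toReal_nonneg)
      ENNReal.toReal_nonneg, ENNReal.ofReal_add (norm_nonneg _) ENNReal.toReal_nonneg,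
      ENNReal.ofReal_toReal hY.deriv.2.2.ne, ENNReal.ofReal_toReal hY.rem.2.2.ne, ofReal_norm,
      add_assoc]
    rfl
  have em : max (ENNReal.ofReal A) (ENNReal.ofReal A ^ 2) = ENNReal.ofReal (max A (A ^ 2)) := by
    rw [← ENNReal.ofReal_pow hA0, ENNReal.ofReal_max]
  have hm0 : 0 ≤ max A (A ^ 2) := hA0.trans (le_max_left _ _)
  rw [eX, eF, eA, em]
  clear_value x F A
  generalize max A (A ^ 2) = m at *
  have eC : (((2 * C).toNNReal : ℝ≥0) : ℝ≥0∞) = ENNReal.ofReal (2 * C) := rfl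
  have k1 := h1.boSeminorm_le hβ
  have k2 := h2.boNorm₂_le hβ2 (Ξ := remainder X (fun t => f (Y t)) (compDeriv f Y Y'))
    fun _ _ _ _ _ => le_rfl
  have g1 : boSeminorm α β q T (compDeriv f Y Y')
      ≤ ENNReal.ofReal (2 * C) * ENNReal.ofReal F * ENNReal.ofReal (1 + x)
        * ENNReal.ofReal m := by
    rw [← ENNReal.ofReal_mul (by positivity), ← ENNReal.ofReal_mul (by positivity),
      ← ENNReal.ofReal_mul (by positivity)]
    refine k1.trans (ENNReal.ofReal_le_ofReal ?_)
    gcongr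
    linarith
  have g2 : controlledSeminorm α β q T X (fun t => f (Y t)) (compDeriv f Y Y')
      ≤ ENNReal.ofReal (2 * C) * ENNReal.ofReal F * ENNReal.ofReal (1 + x) ^ 2
        * ENNReal.ofReal m := by
    rw [← ENNReal.ofReal_mul (by positivity), ← ENNReal.ofReal_pow (by positivity),
      ← ENNReal.ofReal_mul (by positivity), ← ENNReal.ofReal_mul (by positivity)]
    rw [controlledSeminorm]
    refine (add_le_add k1 k2).trans ?_
    rw [← ENNReal.ofReal_add (by positivity) (by positivity)]
    refine ENNReal.ofReal_le_ofReal ?_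
    have : C * F * (1 + x) * m ≤ C * F * (1 + x) ^ 2 * m := by
      gcongr
      exact le_self_pow₀ (by linarith) (by norm_num)
    linarith
  rw [eC]
  refine ⟨⟨⟨hfd.continuous.comp_continuousOn hY.path.1, memOrlicz_of_continuousOn hβ
      (hfd.continuous.comp_continuousOn hY.path.1), ?_⟩,
    ⟨h1.1, memOrlicz_of_continuousOn hβ h1.1, k1.trans_lt ENNReal.ofReal_lt_top⟩, ?_⟩,
    hfirst, g1, g2⟩
  · exact hfirst.trans_lt (ENNReal.mul_lt_top hS.lt_top hY.path.2.2)
  · exact memBO₂_of_continuousOn (continuousOn_remainder hX.1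
      (hfd.continuous.comp_continuousOn hY.path.1) h1.1) (k2.trans_lt ENNReal.ofReal_lt_top)

/-- Writing `a = a ^ (1 - θ) * a ^ θ` and bounding the first factor converts linear estimates into
estimates by the powers in the metric. -/
theorem le_ofReal_mul_rpow {a : ℝ≥0∞} {S θ : ℝ} (hS : 1 ≤ S) (ha : a ≤ ENNReal.ofReal S)
    (hθ0 : 0 ≤ θ) (hθ1 : θ ≤ 1) : a ≤ ENNReal.ofReal S * a ^ θ := by
  have h1 : (1 : ℝ≥0∞) ≤ ENNReal.ofReal S := by simpa using hS
  calc a = a ^ (1 - θ) * a ^ θ := by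
        rw [← ENNReal.rpow_add_of_nonneg _ _ (by linarith) hθ0]
        simp
    _ ≤ ENNReal.ofReal S ^ (1 - θ) * a ^ θ := by
        gcongr
    _ ≤ ENNReal.ofReal S ^ (1 : ℝ) * a ^ θ := by
        gcongr
        linarith
    _ = _ := by rw [ENNReal.rpow_one]

theorem min_one_toReal_le_one (q : ℝ≥0∞) : (min q 1).toReal ≤ 1 := by
  have := ENNReal.toReal_mono ENNReal.one_ne_top (min_le_right q 1)
  simpa using this

/-- The stability estimate in terms of real bounds for the data of two controlled paths. -/
theorem exists_controlled_comp_sub_bound {β : ℝ} (hβ : 0 < β) {q : ℝ≥0∞} (hq : 0 < q) {α : ℝ}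
    (hα : 1 / 3 < α) {T₀ : ℝ} (hT₀ : 0 < T₀) {M : ℝ} (hM : 0 < M) : ∃ C : ℝ, 1 ≤ C ∧
    ∀ (V W U : Type) [NormedAddCommGroup V] [NormedSpace ℝ V] [NormedAddCommGroup W]
      [NormedSpace ℝ W] [NormedAddCommGroup U] [NormedSpace ℝ U]
      (T : ℝ) (X X₁ : ℝ → V) (Y Y₁ : ℝ → W) (Y' Y₁' : ℝ → V →L[ℝ] W) (f : W → U)
      (x x₁ y' y₁' r r₁ dx dy' dr F : ℝ), 0 ≤ T → T ≤ T₀ →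
      ContinuousOn Y (Icc 0 T) → ContinuousOn Y₁ (Icc 0 T) →
      PathBound α β q T X x → PathBound α β q T X₁ x₁ →
      PathBound α β q T Y' y' → PathBound α β q T Y₁' y₁' →
      BOBound (2 * α) (β / 2) (q / 2) T (fun s t => ‖remainder X Y Y' s t‖) r →
      BOBound (2 * α) (β / 2) (q / 2) T (fun s t => ‖remainder X₁ Y₁ Y₁' s t‖) r₁ →
      x ≤ M → x₁ ≤ M → ‖Y' 0‖ + y' + r ≤ M → ‖Y₁' 0‖ + y₁' + r₁ ≤ M →
      PathBound α β q T (fun t => X t - X₁ t) dx →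
      PathBound α β q T (fun t => Y' t - Y₁' t) dy' →
      BOBound (2 * α) (β / 2) (q / 2) T
        (fun s t => ‖remainder X Y Y' s t - remainder X₁ Y₁ Y₁' s t‖) dr →
      Differentiable ℝ f → Differentiable ℝ (fderiv ℝ f) → 0 ≤ F → (∀ x, ‖fderiv ℝ f x‖ ≤ F) →
      (∀ x, ‖fderiv ℝ (fderiv ℝ f) x‖ ≤ F) →
      (∀ a b, ‖fderiv ℝ (fderiv ℝ f) b - fderiv ℝ (fderiv ℝ f) a‖ ≤ F * ‖b - a‖) →
      PathBound α β q T (fun t => compDeriv f Y Y' t - compDeriv f Y₁ Y₁' t)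
        (C * F * (‖Y 0 - Y₁ 0‖ + ‖Y' 0 - Y₁' 0‖ + dx + (dy' + dr))) ∧
      BOBound (2 * α) (β / 2) (q / 2) T
        (fun s t => ‖remainder X (fun r => f (Y r)) (compDeriv f Y Y') s t
          - remainder X₁ (fun r => f (Y₁ r)) (compDeriv f Y₁ Y₁') s t‖)
        (C * F * (‖Y 0 - Y₁ 0‖ + ‖Y' 0 - Y₁' 0‖ + dx + (dy' + dr))) := by
  obtain ⟨C₁, hC₁, hpath⟩ := exists_path_le hβ hq (by linarith : 1 / 8 < α) hT₀
  obtain ⟨C₂, hC₂, hcon⟩ := exists_PathBound_controlled hβ hq hα hT₀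
  obtain ⟨C₃, hC₃, hsub⟩ := exists_PathBound_sub hβ hq hα hT₀
  obtain ⟨C₄, hC₄, hcomp⟩ := exists_comp_sub_bound hβ hq (by linarith : 0 ≤ α)
  obtain ⟨B, hB1, hBM, hBC₁, hBC₂, hBC₃, hBC₁', hBC₁₃⟩ : ∃ B : ℝ, 1 ≤ B ∧ M ≤ B ∧ C₁ * M ≤ B ∧
      C₂ * (M * (1 + M)) ≤ B ∧ C₃ * (1 + M) ≤ B ∧ C₁ ≤ B ∧ C₁ * C₃ * (2 * (1 + M)) ≤ B := by
    have h3 : 0 ≤ C₂ * (M * (1 + M)) := by positivity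
    have h4 : 0 ≤ C₃ * (1 + M) := by positivity
    have h5 : 0 ≤ C₁ * C₃ * (2 * (1 + M)) := by positivity
    have h6 : 0 ≤ C₁ * M := by positivity
    refine ⟨1 + M + C₁ * M + C₂ * (M * (1 + M)) + C₃ * (1 + M) + C₁
      + C₁ * C₃ * (2 * (1 + M)), ?_, ?_, ?_, ?_, ?_, ?_, ?_⟩ <;> linarith
  -- The stability estimate gives `B ^ 2` times the distance bound, and all distances needed there
  -- are at most `B * N`, which supplies the third power.
  refine ⟨C₄ * B ^ 3, one_le_mul_of_one_le_of_one_le hC₄ (one_le_pow₀ hB1), ?_⟩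
  intro V W U _ _ _ _ _ _ T X X₁ Y Y₁ Y' Y₁' f x x₁ y' y₁' r r₁ dx dy' dr F hT0 hT hYc hY₁c hXb
    hX₁b hY'b hY₁'b hRb hR₁b hxM hx₁M hA hA₁ hdXb hdY'b hdRb hfd hfd' hF0 hF1 hF2 hF3
  have hYb := hcon V W T X Y Y' _ _ _ hT0 hT hYc hXb hY'b hRb
  have hY₁b := hcon V W T X₁ Y₁ Y₁' _ _ _ hT0 hT hY₁c hX₁b hY₁'b hR₁b
  obtain ⟨-, hY's⟩ := hpath _ T Y' _ hT hY'b
  have hdYb := hsub V W T X X₁ Y Y₁ Y' Y₁' _ _ _ _ _ hT0 hT hYc hY₁c hXb hdXb hY₁'b hdY'b hdRb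
  obtain ⟨-, hdY's⟩ := hpath _ T (fun t => Y' t - Y₁' t) _ hT hdY'b
  obtain ⟨-, hdYs⟩ := hpath _ T (fun t => Y t - Y₁ t) _ hT hdYb
  have hx0 := hXb.2.bound_nonneg
  have hx₁0 := hX₁b.2.bound_nonneg
  have hy'0 := hY'b.2.bound_nonneg
  have hy₁'0 := hY₁'b.2.bound_nonneg
  have hr0 := hRb.bound_nonneg
  have hr₁0 := hR₁b.bound_nonneg
  have hdx0 := hdXb.2.bound_nonneg
  have hdy'0 := hdY'b.2.bound_nonneg
  have hdr0 := hdRb.bound_nonneg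
  have hn0 := norm_nonneg (Y' 0)
  have hn₁0 := norm_nonneg (Y₁' 0)
  have he00 := norm_nonneg (Y 0 - Y₁ 0)
  have he0'0 := norm_nonneg (Y' 0 - Y₁' 0)
  generalize ‖Y 0 - Y₁ 0‖ = e0 at *
  generalize ‖Y' 0 - Y₁' 0‖ = e0' at *
  obtain ⟨N, hN⟩ : ∃ N, N = e0 + e0' + dx + (dy' + dr) := ⟨_, rfl⟩
  rw [← hN]
  have hN0 : 0 ≤ N := by rw [hN]; positivity
  have hM1' : 1 ≤ 1 + M := by linarith
  have hdyN : (e0' + dy') * x + (‖Y₁' 0‖ + y₁') * dx + dr ≤ (1 + M) * N := by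
    have i1 : (e0' + dy') * x ≤ (e0' + dy') * (1 + M) := by gcongr; linarith
    have i2 : (‖Y₁' 0‖ + y₁') * dx ≤ (1 + M) * dx :=
      mul_le_mul_of_nonneg_right (by linarith) hdx0
    have i3 : dr ≤ (1 + M) * dr := le_mul_of_one_le_left hdr0 hM1'
    have i4 : 0 ≤ (1 + M) * e0 := by positivity
    rw [hN]; linarith
  have hdyB : C₃ * ((e0' + dy') * x + (‖Y₁' 0‖ + y₁') * dx + dr) ≤ B * N := by
    calc _ ≤ C₃ * ((1 + M) * N) := by gcongr
      _ = C₃ * (1 + M) * N := by ring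
      _ ≤ B * N := by gcongr
  have hNB : N ≤ B * N := le_mul_of_one_le_left hN0 hB1
  have hyB : ∀ a x : ℝ, 0 ≤ a → 0 ≤ x → a ≤ M → x ≤ M → C₂ * (a * (1 + x)) ≤ B := by
    intro a x ha0 hx0 ha hx
    refine le_trans ?_ hBC₂
    gcongr
  have sup1 : C₁ * (‖Y' 0‖ + y') ≤ B := le_trans (by gcongr; linarith) hBC₁
  have sup2 : C₁ * (e0 + C₃ * ((e0' + dy') * x + (‖Y₁' 0‖ + y₁') * dx + dr)) ≤ B * N := by
    have i1 : e0 ≤ C₃ * ((1 + M) * N) := by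
      have i2 : e0 ≤ N := by rw [hN]; linarith
      have i3 : N ≤ (1 + M) * N := le_mul_of_one_le_left hN0 hM1'
      exact (i2.trans i3).trans (le_mul_of_one_le_left (by positivity) hC₃)
    calc _ ≤ C₁ * (C₃ * ((1 + M) * N) + C₃ * ((1 + M) * N)) := by gcongr
      _ = C₁ * C₃ * (2 * (1 + M)) * N := by ring
      _ ≤ B * N := by gcongr
  have sup3 : C₁ * (e0' + dy') ≤ B * N := by
    calc C₁ * (e0' + dy') ≤ C₁ * N := by gcongr; rw [hN]; linarith
      _ ≤ B * N := by gcongr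
  have e : C₄ * (F * (B ^ 2 * (B * N))) = C₄ * B ^ 3 * F * N := by ring
  rw [← e]
  exact hcomp V W U T X X₁ Y Y₁ Y' Y₁' f B (B * N) F hB1 (by positivity) hXb.1 hX₁b.1
    hY₁'b.1 (hYb.mono (hyB _ _ (by positivity) hx0 hA hxM))
    (hY₁b.mono (hyB _ _ (by positivity) hx₁0 hA₁ hx₁M)) (hY'b.mono (by linarith))
    (hdYb.mono hdyB) (hdY'b.mono (by linarith)) (hRb.mono (by linarith))
    (hdRb.mono (by linarith))
    (fun t h0 ht => (hY's t h0 ht).trans sup1) (fun t h0 ht => (hdYs t h0 ht).trans sup2)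
    (fun t h0 ht => (hdY's t h0 ht).trans sup3) hfd hfd' hF0 hF1 hF2 hF3

theorem toReal_controlled_le {α β T M : ℝ} {q : ℝ≥0∞} (hM : 0 ≤ M) {X : ℝ → V} {Y : ℝ → W}
    {Y' : ℝ → V →L[ℝ] W} (hY : IsControlled α β q T X Y Y')
    (h : ‖Y' 0‖ₑ + controlledSeminorm α β q T X Y Y' ≤ ENNReal.ofReal M) :
    ‖Y' 0‖ + (boSeminorm α β q T Y').toReal
      + (boNorm₂ (2 * α) (β / 2) (q / 2) T (remainder X Y Y')).toReal ≤ M := by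
  have h' := ENNReal.toReal_mono ENNReal.ofReal_ne_top h
  rw [ENNReal.toReal_ofReal hM, controlledSeminorm, ENNReal.toReal_add enorm_ne_top
    (ENNReal.add_ne_top.2 ⟨hY.deriv.2.2.ne, hY.rem.2.2.ne⟩),
    ENNReal.toReal_add hY.deriv.2.2.ne hY.rem.2.2.ne, toReal_enorm] at h'
  linarith

/-- Provides the a priori bound on differences without which a linear term could not be replaced by
its power `q ∧ 1`. -/
theorem exists_boSeminorm_sub_le {β : ℝ} (hβ : 0 < β) (q : ℝ≥0∞) (M : ℝ) (hM : 0 ≤ M) :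
    ∃ S : ℝ, 1 ≤ S ∧ ∀ (V : Type) [NormedAddCommGroup V] (α T : ℝ) (g g₁ : ℝ → V) (a a₁ : ℝ),
      a ≤ M → a₁ ≤ M → PathBound α β q T g a → PathBound α β q T g₁ a₁ →
      boSeminorm α β q T (fun t => g t - g₁ t) ≤ ENNReal.ofReal S := by
  obtain ⟨K, hK, hadd⟩ := exists_BOBound_add hβ q
  have hKM : 0 ≤ K * (M + M) := by positivity
  refine ⟨1 + K * (M + M), by linarith, fun V _ α T g g₁ a a₁ ha ha₁ hg hg₁ => ?_⟩
  refine ((hadd α T _ _ _ _ (hg.2.mono ha) (hg₁.2.mono ha₁)).boNorm₂_le hβ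
    fun s t _ _ _ => ?_).trans (ENNReal.ofReal_le_ofReal (by linarith))
  rw [sub_sub_sub_comm]
  exact norm_sub_le _ _

theorem exists_boNorm₂_sub_le {β : ℝ} (hβ : 0 < β) (q : ℝ≥0∞) (M : ℝ) (hM : 0 ≤ M) :
    ∃ S : ℝ, 1 ≤ S ∧ ∀ (V : Type) [NormedAddCommGroup V] (γ T : ℝ) (Ξ Ξ₁ : ℝ → ℝ → V) (a a₁ : ℝ),
      a ≤ M → a₁ ≤ M → BOBound γ β q T (fun s t => ‖Ξ s t‖) a →
      BOBound γ β q T (fun s t => ‖Ξ₁ s t‖) a₁ →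
      boNorm₂ γ β q T (fun s t => Ξ s t - Ξ₁ s t) ≤ ENNReal.ofReal S := by
  obtain ⟨K, hK, hadd⟩ := exists_BOBound_add hβ q
  have hKM : 0 ≤ K * (M + M) := by positivity
  refine ⟨1 + K * (M + M), by linarith, fun V _ γ T Ξ Ξ₁ a a₁ ha ha₁ hΞ hΞ₁ => ?_⟩
  exact ((hadd γ T _ _ _ _ (hΞ.mono ha) (hΞ₁.mono ha₁)).boNorm₂_le hβ
    fun s t _ _ _ => norm_sub_le _ _).trans (ENNReal.ofReal_le_ofReal (by linarith))

/-- Linear bounds in the differences are bounds in terms of the metrics. -/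
theorem ofReal_le_controlledDist {α β T : ℝ} {q : ℝ≥0∞} {S : ℝ} (hS : 1 ≤ S) {X X₁ : ℝ → V}
    {Y Y₁ : ℝ → W} {Y' Y₁' : ℝ → V →L[ℝ] W}
    (hdX : boSeminorm α β q T (fun t => X t - X₁ t) ≤ ENNReal.ofReal S)
    (hdY' : boSeminorm α β q T (fun t => Y' t - Y₁' t) ≤ ENNReal.ofReal S)
    (hdR : boNorm₂ (2 * α) (β / 2) (q / 2) T
      (fun s t => remainder X Y Y' s t - remainder X₁ Y₁ Y₁' s t) ≤ ENNReal.ofReal S) :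
    ENNReal.ofReal (‖Y 0 - Y₁ 0‖ + ‖Y' 0 - Y₁' 0‖
        + (boSeminorm α β q T (fun t => X t - X₁ t)).toReal
        + ((boSeminorm α β q T (fun t => Y' t - Y₁' t)).toReal
          + (boNorm₂ (2 * α) (β / 2) (q / 2) T
            (fun s t => remainder X Y Y' s t - remainder X₁ Y₁ Y₁' s t)).toReal))
      ≤ ENNReal.ofReal S * (‖Y 0 - Y₁ 0‖ₑ + ‖Y' 0 - Y₁' 0‖ₑ
        + boSeminorm α β q T (fun t => X t - X₁ t)
        + controlledDist α β q T X Y Y' X₁ Y₁ Y₁') := by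
  have hSe : (1 : ℝ≥0∞) ≤ ENNReal.ofReal S := by simpa using hS
  have edX := ENNReal.ofReal_toReal (hdX.trans_lt ENNReal.ofReal_lt_top).ne
  have edY' := ENNReal.ofReal_toReal (hdY'.trans_lt ENNReal.ofReal_lt_top).ne
  have edR := ENNReal.ofReal_toReal (hdR.trans_lt ENNReal.ofReal_lt_top).ne
  rw [ENNReal.ofReal_add (add_nonneg (add_nonneg (norm_nonneg _) (norm_nonneg _))
      ENNReal.toReal_nonneg) (add_nonneg ENNReal.toReal_nonneg ENNReal.toReal_nonneg),
    ENNReal.ofReal_add (add_nonneg (norm_nonneg _) (norm_nonneg _)) ENNReal.toReal_nonneg,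
    ENNReal.ofReal_add (norm_nonneg _) (norm_nonneg _),
    ENNReal.ofReal_add ENNReal.toReal_nonneg ENNReal.toReal_nonneg, edX, edY', edR, ofReal_norm,
    ofReal_norm, mul_add]
  refine add_le_add (le_mul_of_one_le_left' hSe) ?_
  rw [controlledDist, boDist, boDist₂, mul_add, mul_add]
  refine add_le_add (le_add_of_nonneg_of_le zero_le ?_) ?_
  · exact le_ofReal_mul_rpow hS hdY' ENNReal.toReal_nonneg (min_one_toReal_le_one q)
  · exact le_ofReal_mul_rpow hS hdR ENNReal.toReal_nonneg (min_one_toReal_le_one (q / 2))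

/-- Stability of the composition with a `C³_b` function, on bounded sets of data. -/
theorem exists_controlled_comp_sub {β : ℝ} (hβ : 0 < β) {q : ℝ≥0∞} (hq : 0 < q) {α : ℝ}
    (hα : 1 / 3 < α) {T₀ : ℝ} (hT₀ : 0 < T₀) {M : ℝ} (hM : 0 < M) : ∃ C : ℝ≥0,
    ∀ (V W U : Type) [NormedAddCommGroup V] [NormedSpace ℝ V] [NormedAddCommGroup W]
      [NormedSpace ℝ W] [NormedAddCommGroup U] [NormedSpace ℝ U]
      (T : ℝ) (X X₁ : ℝ → V) (Y Y₁ : ℝ → W) (Y' Y₁' : ℝ → V →L[ℝ] W) (f : W → U),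
      0 < T → T ≤ T₀ → MemBO α β q T X → IsControlled α β q T X Y Y' →
      MemBO α β q T X₁ → IsControlled α β q T X₁ Y₁ Y₁' →
      ‖Y' 0‖ₑ + controlledSeminorm α β q T X Y Y' ≤ ENNReal.ofReal M →
      ‖Y₁' 0‖ₑ + controlledSeminorm α β q T X₁ Y₁ Y₁' ≤ ENNReal.ofReal M →
      boSeminorm α β q T X ≤ ENNReal.ofReal M →
      boSeminorm α β q T X₁ ≤ ENNReal.ofReal M →
      MemCb 3 f →
        boSeminorm α β q T (fun t => compDeriv f Y Y' t - compDeriv f Y₁ Y₁' t)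
          ≤ C * cbNorm 3 f
            * (‖Y 0 - Y₁ 0‖ₑ + ‖Y' 0 - Y₁' 0‖ₑ + boSeminorm α β q T (fun t => X t - X₁ t)
              + controlledDist α β q T X Y Y' X₁ Y₁ Y₁') ∧
        boNorm₂ (2 * α) (β / 2) (q / 2) T
            (fun s t => remainder X (fun r => f (Y r)) (compDeriv f Y Y') s t
              - remainder X₁ (fun r => f (Y₁ r)) (compDeriv f Y₁ Y₁') s t)
          ≤ C * cbNorm 3 f
            * (‖Y 0 - Y₁ 0‖ₑ + ‖Y' 0 - Y₁' 0‖ₑ + boSeminorm α β q T (fun t => X t - X₁ t)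
              + controlledDist α β q T X Y Y' X₁ Y₁ Y₁') := by
  have hβ2 : 0 < β / 2 := by positivity
  obtain ⟨C, hC, hcomp⟩ := exists_controlled_comp_sub_bound hβ hq hα hT₀ hM
  obtain ⟨S₁, hS₁, hpath⟩ := exists_boSeminorm_sub_le hβ q M hM.le
  obtain ⟨S₂, hS₂, hrem⟩ := exists_boNorm₂_sub_le hβ2 (q / 2) M hM.le
  obtain ⟨D, eC⟩ : ∃ D : ℝ≥0, (D : ℝ≥0∞) = ENNReal.ofReal C * ENNReal.ofReal (max S₁ S₂) :=
    ⟨C.toNNReal * (max S₁ S₂).toNNReal, by rw [ENNReal.coe_mul]; rfl⟩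
  refine Exists.intro D ?_
  intro V W U _ _ _ _ _ _ T X X₁ Y Y₁ Y' Y₁' f hT0 hT hX hY hX₁ hY₁ hM1 hM2 hM3 hM4 hf
  have hfd : Differentiable ℝ f := hf.1.differentiable (by norm_num)
  have hfd' := hf.differentiable_fderiv (by norm_num)
  have hF1 := hf.norm_fderiv_le (by norm_num)
  have hF2 := hf.norm_fderiv_fderiv_le (by norm_num)
  have hF3 := hf.norm_fderiv_fderiv_sub_le le_rfl
  have hXb := PathBound.of_finite hβ hX.1 hX.2.2.ne
  have hX₁b := PathBound.of_finite hβ hX₁.1 hX₁.2.2.ne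
  have hY'b := PathBound.of_finite hβ hY.deriv.1 hY.deriv.2.2.ne
  have hY₁'b := PathBound.of_finite hβ hY₁.deriv.1 hY₁.deriv.2.2.ne
  have hRc := continuousOn_remainder hX.1 hY.path.1 hY.deriv.1
  have hR₁c := continuousOn_remainder hX₁.1 hY₁.path.1 hY₁.deriv.1
  have hRb := BOBound.of_norm hβ2 hRc hY.rem.2.2.ne
  have hR₁b := BOBound.of_norm hβ2 hR₁c hY₁.rem.2.2.ne
  have hA := toReal_controlled_le hM.le hY hM1
  have hA₁ := toReal_controlled_le hM.le hY₁ hM2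
  have hxM := ENNReal.toReal_le_of_le_ofReal hM.le hM3
  have hx₁M := ENNReal.toReal_le_of_le_ofReal hM.le hM4
  have hn0 := norm_nonneg (Y' 0)
  have hn₁0 := norm_nonneg (Y₁' 0)
  have hy'0 := hY'b.2.bound_nonneg
  have hy₁'0 := hY₁'b.2.bound_nonneg
  have hr0 := hRb.bound_nonneg
  have hr₁0 := hR₁b.bound_nonneg
  have hle₁ := ENNReal.ofReal_le_ofReal (le_max_left S₁ S₂)
  have hle₂ := ENNReal.ofReal_le_ofReal (le_max_right S₁ S₂)
  have hdX := (hpath V α T X X₁ _ _ hxM hx₁M hXb hX₁b).trans hle₁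
  have hdY' := (hpath _ α T Y' Y₁' _ _ (by linarith) (by linarith) hY'b hY₁'b).trans hle₁
  have hdR := (hrem _ (2 * α) T _ _ _ _ (by linarith) (by linarith) hRb hR₁b).trans hle₂
  have hdXb := PathBound.of_finite hβ (hX.1.sub hX₁.1) (hdX.trans_lt ENNReal.ofReal_lt_top).ne
  have hdY'b := PathBound.of_finite hβ (hY.deriv.1.sub hY₁.deriv.1)
    (hdY'.trans_lt ENNReal.ofReal_lt_top).ne
  have hdRb := BOBound.of_norm hβ2 (hRc.sub hR₁c) (hdR.trans_lt ENNReal.ofReal_lt_top).ne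
  obtain ⟨h1, h2⟩ := hcomp V W U T X X₁ Y Y₁ Y' Y₁' f _ _ _ _ _ _ _ _ _ _ hT0.le hT hY.path.1
    hY₁.path.1 hXb hX₁b hY'b hY₁'b hRb hR₁b hxM hx₁M hA hA₁ hdXb hdY'b hdRb hfd hfd'
    ENNReal.toReal_nonneg hF1 hF2 hF3
  have hN := ofReal_le_controlledDist (hS₁.trans (le_max_left S₁ S₂)) hdX hdY' hdR
  have k1 := h1.boSeminorm_le hβ
  have k2 := h2.boNorm₂_le hβ2 (Ξ := fun s t =>
    remainder X (fun r => f (Y r)) (compDeriv f Y Y') s t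
      - remainder X₁ (fun r => f (Y₁ r)) (compDeriv f Y₁ Y₁') s t) fun _ _ _ _ _ => le_rfl
  rw [ENNReal.ofReal_mul (mul_nonneg (by linarith) ENNReal.toReal_nonneg),
    ENNReal.ofReal_mul (by linarith), ENNReal.ofReal_toReal hf.2.ne] at k1 k2
  rw [eC, mul_right_comm (ENNReal.ofReal C), mul_assoc (ENNReal.ofReal C * cbNorm 3 f)]
  exact ⟨k1.trans (mul_le_mul' le_rfl hN), k2.trans (mul_le_mul' le_rfl hN)⟩

end Final

end BesovOrlicz

end

/-! ### The theorem: constants monotone in the time horizon and in the size of the data -/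

open BesovOrlicz in
theorem theorem4p9 (α β : ℝ) (q : ℝ≥0∞) (hα : 1 / 3 < α) (hα' : α ≤ 1 / 2) (hβ : 0 < β)
    (hq : 0 < q) :
    (∃ C : ℝ → ℝ≥0, Monotone C ∧
      ∀ (n m k : ℕ) (T : ℝ), 0 < T →
      ∀ (X : ℝ → Vec n) (Y : ℝ → Mat m k) (Y' : ℝ → Vec n →L[ℝ] Mat m k)
        (f : Mat m k → Mat m n),
      MemBO α β q T X → IsControlled α β q T X Y Y' → MemCb 2 f →
        IsControlled α β q T X (fun t => f (Y t)) (compDeriv f Y Y') ∧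
        boSeminorm α β q T (fun t => f (Y t))
          ≤ (⨆ x, ‖fderiv ℝ f x‖ₑ) * boSeminorm α β q T Y ∧
        boSeminorm α β q T (compDeriv f Y Y')
          ≤ C T * cbNorm 2 f * (1 + boSeminorm α β q T X)
            * max (‖Y' 0‖ₑ + controlledSeminorm α β q T X Y Y')
                ((‖Y' 0‖ₑ + controlledSeminorm α β q T X Y Y') ^ 2) ∧
        controlledSeminorm α β q T X (fun t => f (Y t)) (compDeriv f Y Y')
          ≤ C T * cbNorm 2 f * (1 + boSeminorm α β q T X) ^ 2
            * max (‖Y' 0‖ₑ + controlledSeminorm α β q T X Y Y')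
                ((‖Y' 0‖ₑ + controlledSeminorm α β q T X Y Y') ^ 2)) ∧
    (∃ C : ℝ → ℝ → ℝ≥0, (∀ M, Monotone fun T => C T M) ∧ (∀ T, Monotone fun M => C T M) ∧
      ∀ (n m k : ℕ) (T M : ℝ), 0 < T → 0 < M →
      ∀ (X X₁ : ℝ → Vec n) (Y Y₁ : ℝ → Mat m k) (Y' Y₁' : ℝ → Vec n →L[ℝ] Mat m k)
        (f : Mat m k → Mat m n),
      MemBO α β q T X → IsControlled α β q T X Y Y' →
      MemBO α β q T X₁ → IsControlled α β q T X₁ Y₁ Y₁' →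
      ‖Y' 0‖ₑ + controlledSeminorm α β q T X Y Y' ≤ ENNReal.ofReal M →
      ‖Y₁' 0‖ₑ + controlledSeminorm α β q T X₁ Y₁ Y₁' ≤ ENNReal.ofReal M →
      boSeminorm α β q T X ≤ ENNReal.ofReal M →
      boSeminorm α β q T X₁ ≤ ENNReal.ofReal M →
      MemCb 3 f →
        boSeminorm α β q T (fun t => compDeriv f Y Y' t - compDeriv f Y₁ Y₁' t)
          ≤ C T M * cbNorm 3 f
            * (‖Y 0 - Y₁ 0‖ₑ + ‖Y' 0 - Y₁' 0‖ₑ + boSeminorm α β q T (fun t => X t - X₁ t)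
              + controlledDist α β q T X Y Y' X₁ Y₁ Y₁') ∧
        boNorm₂ (2 * α) (β / 2) (q / 2) T
            (fun s t => remainder X (fun r => f (Y r)) (compDeriv f Y Y') s t
              - remainder X₁ (fun r => f (Y₁ r)) (compDeriv f Y₁ Y₁') s t)
          ≤ C T M * cbNorm 3 f
            * (‖Y 0 - Y₁ 0‖ₑ + ‖Y' 0 - Y₁' 0‖ₑ + boSeminorm α β q T (fun t => X t - X₁ t)
              + controlledDist α β q T X Y Y' X₁ Y₁ Y₁')) := by
  constructor
  · choose c hc using fun N : ℕ => exists_controlled_comp hβ hq hα (T₀ := N + 1) (by positivity)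
    -- The constants `c N` for horizons `N + 1` need not increase with `N`; their partial sums do,
    -- and they dominate the term `c ⌈T⌉₊`.
    refine ⟨fun T => ∑ i ∈ Finset.range (⌈T⌉₊ + 1), c i, fun T T' h => ?_, ?_⟩
    · exact Finset.sum_le_sum_of_subset
        (Finset.range_mono (Nat.add_le_add_right (Nat.ceil_mono h) 1))
    · intro n m k T hT X Y Y' f hX hY hf
      obtain ⟨h1, h2, h3, h4⟩ := hc ⌈T⌉₊ _ _ _ T X Y Y' f hT
        ((Nat.le_ceil T).trans (by linarith)) hX hY hf
      have hle : ((c ⌈T⌉₊ : ℝ≥0) : ℝ≥0∞)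
          ≤ ((∑ i ∈ Finset.range (⌈T⌉₊ + 1), c i : ℝ≥0) : ℝ≥0∞) :=
        ENNReal.coe_le_coe.2 (Finset.single_le_sum (fun _ _ => zero_le)
          (Finset.mem_range.2 (Nat.lt_succ_self _)))
      refine ⟨h1, h2, h3.trans ?_, h4.trans ?_⟩ <;> gcongr
  · choose c hc using fun N : ℕ => exists_controlled_comp_sub hβ hq hα (T₀ := N + 1) (M := N + 1)
      (by positivity) (by positivity)
    -- One index bounds both the horizon and the data, so a single sequence of constants suffices
    -- and the maximum gives monotonicity in each variable.
    refine ⟨fun T M => ∑ i ∈ Finset.range (max ⌈T⌉₊ ⌈M⌉₊ + 1), c i, fun M T T' h => ?_,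
      fun T M M' h => ?_, ?_⟩
    · exact Finset.sum_le_sum_of_subset (Finset.range_mono
        (Nat.add_le_add_right (max_le_max_right _ (Nat.ceil_mono h)) 1))
    · exact Finset.sum_le_sum_of_subset (Finset.range_mono
        (Nat.add_le_add_right (max_le_max_left _ (Nat.ceil_mono h)) 1))
    · intro n m k T M hT hM X X₁ Y Y₁ Y' Y₁' f hX hY hX₁ hY₁ hM1 hM2 hM3 hM4 hf
      set N := max ⌈T⌉₊ ⌈M⌉₊
      have hTN : T ≤ (N : ℝ) + 1 := by
        have h1 := Nat.le_ceil T
        have h2 : ((⌈T⌉₊ : ℕ) : ℝ) ≤ N := Nat.cast_le.2 (le_max_left _ _)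
        linarith
      have hMN : ENNReal.ofReal M ≤ ENNReal.ofReal ((N : ℝ) + 1) := by
        have h1 := Nat.le_ceil M
        have h2 : ((⌈M⌉₊ : ℕ) : ℝ) ≤ N := Nat.cast_le.2 (le_max_right _ _)
        exact ENNReal.ofReal_le_ofReal (by linarith)
      obtain ⟨h1, h2⟩ := hc N _ _ _ T X X₁ Y Y₁ Y' Y₁' f hT hTN hX hY hX₁ hY₁ (hM1.trans hMN)
        (hM2.trans hMN) (hM3.trans hMN) (hM4.trans hMN) hf
      have hle : ((c N : ℝ≥0) : ℝ≥0∞) ≤ ((∑ i ∈ Finset.range (N + 1), c i : ℝ≥0) : ℝ≥0∞) :=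
        ENNReal.coe_le_coe.2 (Finset.single_le_sum (fun _ _ => zero_le)
          (Finset.mem_range.2 (Nat.lt_succ_self _)))
      refine ⟨h1.trans ?_, h2.trans ?_⟩ <;> gcongr
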